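/- **Setting.** Let $K\in\mathbb R$, let $g$ be a probability measure on $\mathbb R$ and let $r_{st}\in[0,1]$ with $Kr_{st}\ge 0$ be the order parameter of the stationary state $f_{st}$ of the mean-field Kuramoto equation with velocity distribution $g$ and all locked oscillators at the stable fixed point, i.e. $$f_{st}(\theta,\omega)=\begin{cases}\delta_{\arcsin(\omega/(Kr_{st}))}(\theta)\,g(\omega),&|\omega|\le Kr_{st},\\ \frac{\sqrt{\omega^2-(Kr_{st})^2}}{2\pi|\omega-Kr_{st}\sin\theta|}\,g(\omega),&|\omega|>Kr_{st},\end{cases}\qquad r_{st}=\iint e^{i\theta}f_{st}\,d\theta\,d\omega .$$ Write $(\hat f_{st})_\ell(\xi)=\iint e^{-i\ell\theta-i\xi\omega}f_{st}\,d\theta\,d\omega$. For $u=(u_\ell(\xi))_{\ell\ge1,\,\xi\ge0}$ with complex values (and $u_0\equiv0$) let $L=L_1+L_2$, where $$(L_1u)_\ell=\ell\,\partial_\xi u_\ell+\tfrac{K\ell}{2}r_{st}(u_{\ell-1}-u_{\ell+1}),\qquad (L_2u)_\ell=\tfrac{K\ell}{2}\bigl(u_1(0)(\hat f_{st})_{\ell-1}-\overline{u_1(0)}(\hat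 f_{st})_{\ell+1}\bigr);$$ $L$ is linear over $\mathbb R$. Let $(r_r)_\ell=\frac{K\ell}{2}\bigl((\hat f_{st})_{\ell-1}-(\hat f_{st})_{\ell+1}\bigr)$ and $(r_i)_\ell=\frac{K\ell i}{2}\bigl((\hat f_{st})_{\ell-1}+(\hat f_{st})_{\ell+1}\bigr)$. For $b\ge0$ let $X_b$ be the space of all $u$ with $$\sum_{\ell\ge1}\int_0^\infty\bigl(|u_\ell|^2+|\partial_\xi u_\ell|^2\bigr)(1+\xi)^{2b}\,\ell^{-1}\,d\xi<\infty .$$ For $v\in X_b$ let $e^{tL_1}v$ be the unique weak solution of $\partial_tw=L_1w$, $w(0)=v$, that is locally bounded in time and weakly continuous with values in $X_b$. For $r_r,r_i\in X_{b_r}$ put $$k_{Lc}(t)=-\begin{pmatrix}\Re(e^{tL_1}r_r)_1(0)&\Re(e^{tL_1}r_i)_1(0)\\ \Im(e^{tL_1}r_r)_1(0)&\Im(e^{tL_1}r_i)_1(0)\end{pmatrix},\quad (\mathcal Lk_{Lc})(z)=\int_0^\infty k_{Lc}(t)e^{-zt}dt,\quad D(z)=\det\bigl(\mathrm{Id}+(\mathcal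 Lk_{Lc})(z)\bigr).$$ **Proposition.** Let $b_r\ge0$ and assume $r_r,r_i\in X_{b_r}$. 1. If $D(\lambda)=0$, $\Re\lambda>0$ and $\Im\lambda=0$, there is $v\in X_{b_r}$, $v\ne0$, with $Lv=\lambda v$. 2. If $D(\lambda)=0$, $\Re\lambda>0$ and $\Im\lambda\neq0$, then $D(\overline\lambda)=0$ and there are $v_c,v_s\in X_{b_r}$, linearly independent over $\mathbb R$, with $$Lv_c=(\Re\lambda)v_c-(\Im\lambda)v_s,\qquad Lv_s=(\Im\lambda)v_c+(\Re\lambda)v_s .$$ 3. If $b_r>1$, $D(\lambda)=0$ and $\Re\lambda=0$, the conclusions of 1 (if $\Im\lambda=0$) and of 2 (if $\Im\lambda\ne0$) hold with modes that lie in $X_b$ for all $0\le b<b_r-1$, in place of $X_{b_r}$. 4. If $b_r>2$ and $0$ is a root of $D$ that is not simple, i.e. $D(0)=0$ and $D'(0)=0$ (the derivative taken within $\{\Re z\ge0\}$), then at least one of the following holds: - there are two eigenmodes $v_{0,r},v_{0,i}$, linearly independent over $\mathbb R$, with $Lv_{0,r}=Lv_{0,i}=0$, both in $X_b$ for all $0\le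 b<b_r-1$; - there are $v_{0,0}\neq0$, in $X_b$ for all $0\le b<b_r-1$, and $v_{0,1}$, in $X_b$ for all $0\le b<b_r-2$, with $Lv_{0,0}=0$ and $Lv_{0,1}=v_{0,0}$. -/

import Mathlib

open MeasureTheory Set
open scoped ENNReal ComplexConjugate

namespace Kuramoto

noncomputable section

/-! ### The stationary state -/

/-- Distribution of the phase `θ`, in the fundamental domain `(-π, π]` of the torus, of the
oscillators with intrinsic frequency `ω` in the stationary state with coupling `K` and order
parameter `r`: a Dirac mass at the stable fixed point for the locked oscillators, and the invariant
density for the drifting ones. -/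
def phaseMeasure (K r ω : ℝ) : Measure ℝ :=
  if |ω| ≤ K * r then Measure.dirac (Real.arcsin (ω / (K * r)))
  else (volume.restrict (Ioc (-Real.pi) Real.pi)).withDensity fun θ =>
    ENNReal.ofReal
      (Real.sqrt (ω ^ 2 - (K * r) ^ 2) / (2 * Real.pi * |ω - K * r * Real.sin θ|))

/-- `r ∈ [0,1]` is the order parameter of the stationary state with velocity distribution `g`,
i.e. the self-consistency equation holds. (`0 ≤ K * r` is automatic for `0 ≤ K`.) -/
structure IsStationaryState (K r : ℝ) (g : Measure ℝ) : Prop where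
  mem_Icc : r ∈ Icc (0 : ℝ) 1
  coupling_nonneg : 0 ≤ K * r
  self_consistent :
    (r : ℂ) = ∫ ω, ∫ θ, Complex.exp (Complex.I * θ) ∂(phaseMeasure K r ω) ∂g

/-- Fourier transform `(f̂_st)_ℓ(ξ) = ∫∫ e^{-iℓθ - iξω} f_st(θ,ω) dθ dω` of the stationary state,
for `ℓ ≥ 0`. -/
def statHat (K r : ℝ) (g : Measure ℝ) (ℓ : ℕ) (ξ : ℝ) : ℂ :=
  ∫ ω, ∫ θ, Complex.exp (-Complex.I * ℓ * θ - Complex.I * ξ * ω) ∂(phaseMeasure K r ω) ∂g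

/-- `(r_r)_ℓ = (K ℓ / 2) ((f̂_st)_{ℓ-1} - (f̂_st)_{ℓ+1})` for `ℓ ≥ 1`. -/
def rR (K r : ℝ) (g : Measure ℝ) (ℓ : ℕ) (ξ : ℝ) : ℂ :=
  (K * ℓ / 2 : ℂ) * (statHat K r g (ℓ - 1) ξ - statHat K r g (ℓ + 1) ξ)

/-- `(r_i)_ℓ = (K ℓ i / 2) ((f̂_st)_{ℓ-1} + (f̂_st)_{ℓ+1})` for `ℓ ≥ 1`. -/
def rI (K r : ℝ) (g : Measure ℝ) (ℓ : ℕ) (ξ : ℝ) : ℂ :=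
  (K * ℓ * Complex.I / 2 : ℂ) * (statHat K r g (ℓ - 1) ξ + statHat K r g (ℓ + 1) ξ)

/-! ### Weighted Sobolev spaces

States are families `u : ℕ → ℝ → ℂ`; only the values `u ℓ ξ` with `ℓ ≥ 1` and `ξ ≥ 0` matter. -/

/-- The weight `p_b(ξ) = (1 + ξ)^b`. -/
def weight (b ξ : ℝ) : ℝ := (1 + ξ) ^ b

/-- `∑_{ℓ ≥ 1} ∫_0^∞ (|u_ℓ|² + |∂_ξ u_ℓ|²) φ² ℓ^{2k} dξ`; the summation index is `ℓ - 1`. -/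
def xNormSq (φ : ℝ → ℝ) (k : ℝ) (u : ℕ → ℝ → ℂ) : ℝ≥0∞ :=
  ∑' m : ℕ, ∫⁻ ξ in Ioi (0 : ℝ),
    ENNReal.ofReal
      ((‖u (m + 1) ξ‖ ^ 2 + ‖deriv (u (m + 1)) ξ‖ ^ 2) * φ ξ ^ 2 * ((m : ℝ) + 1) ^ (2 * k))

/-- The weighted Sobolev space. In one dimension, a function on `[0, ∞)` with a locally integrable
weak derivative is (in its continuous representative) a locally absolutely continuous function, and
its weak derivative is its a.e. derivative. -/
def MemX (φ : ℝ → ℝ) (k : ℝ) (u : ℕ → ℝ → ℂ) : Prop :=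
  (∀ ℓ, 1 ≤ ℓ → ∀ R : ℝ, 0 < R → AbsolutelyContinuousOnInterval (u ℓ) 0 R) ∧
    xNormSq φ k u < ⊤

/-- The inner product of the weighted Sobolev space. -/
def xInner (φ : ℝ → ℝ) (k : ℝ) (u h : ℕ → ℝ → ℂ) : ℂ :=
  ∑' m : ℕ, ∫ ξ in Ioi (0 : ℝ),
    (u (m + 1) ξ * conj (h (m + 1) ξ) + deriv (u (m + 1)) ξ * conj (deriv (h (m + 1)) ξ)) *
      ((φ ξ ^ 2 * ((m : ℝ) + 1) ^ (2 * k) : ℝ) : ℂ)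

/-- Finite norm `‖u‖_{p_b} = ‖u‖_{p_b, -1/2}`. -/
def MemXp (b : ℝ) (u : ℕ → ℝ → ℂ) : Prop := MemX (weight b) (-1 / 2) u

/-- Equality of states on `ℓ ≥ 1`, almost everywhere in `ξ > 0`. -/
def ModeEq (u v : ℕ → ℝ → ℂ) : Prop :=
  ∀ ℓ, 1 ≤ ℓ → ∀ᵐ ξ ∂(volume.restrict (Ioi (0 : ℝ))), u ℓ ξ = v ℓ ξ

/-- Linear independence over `ℝ` of two states. -/
def ModeIndep (u v : ℕ → ℝ → ℂ) : Prop :=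
  ∀ a b : ℝ, ModeEq (a • u + b • v) 0 → a = 0 ∧ b = 0

/-! ### The linearised operators, restricted to `ℓ ≥ 1` -/

/-- `u_{ℓ-1}` with the convention `u_0 ≡ 0`. -/
def lowerMode (u : ℕ → ℝ → ℂ) (ℓ : ℕ) (ξ : ℝ) : ℂ := if 2 ≤ ℓ then u (ℓ - 1) ξ else 0

def opL1 (K r : ℝ) (u : ℕ → ℝ → ℂ) (ℓ : ℕ) (ξ : ℝ) : ℂ :=
  ℓ * deriv (u ℓ) ξ + (K * ℓ / 2 : ℂ) * (r * lowerMode u ℓ ξ - r * u (ℓ + 1) ξ)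

def opL2 (K r : ℝ) (g : Measure ℝ) (u : ℕ → ℝ → ℂ) (ℓ : ℕ) (ξ : ℝ) : ℂ :=
  (K * ℓ / 2 : ℂ) *
    (u 1 0 * statHat K r g (ℓ - 1) ξ - conj (u 1 0) * statHat K r g (ℓ + 1) ξ)

def opL (K r : ℝ) (g : Measure ℝ) (u : ℕ → ℝ → ℂ) : ℕ → ℝ → ℂ :=
  opL1 K r u + opL2 K r g u

/-! ### The semigroup generated by `L₁` -/

/-- `w` is a weak solution of `∂_t w = L₁ w`, `w(0) = v`, on `[0, ∞)`, which is locally bounded in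
time with values in `X_{p_b}` and weakly continuous. -/
structure IsWeakSolution (K r b : ℝ) (v : ℕ → ℝ → ℂ) (w : ℝ → ℕ → ℝ → ℂ) : Prop where
  mem : ∀ t, 0 ≤ t → MemXp b (w t)
  locally_bounded : ∀ T : ℝ, ∃ C : ℝ≥0∞, C < ⊤ ∧
    ∀ t ∈ Icc (0 : ℝ) T, xNormSq (weight b) (-1 / 2) (w t) ≤ C
  weakly_continuous : ∀ h, MemXp b h →
    ContinuousOn (fun t => xInner (weight b) (-1 / 2) (w t) h) (Ici 0)
  initial : ∀ ℓ, 1 ≤ ℓ → ∀ ξ : ℝ, 0 ≤ ξ → w 0 ℓ ξ = v ℓ ξ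
  equation : ∀ ℓ, 1 ≤ ℓ → ∀ ψ : ℝ → ℝ, ContDiff ℝ (⊤ : ℕ∞) ψ → HasCompactSupport ψ →
    tsupport ψ ⊆ Ioi 0 → ∀ t : ℝ, 0 ≤ t →
      ∫ ξ in Ioi (0 : ℝ), w t ℓ ξ * (ψ ξ : ℂ) =
        (∫ ξ in Ioi (0 : ℝ), v ℓ ξ * (ψ ξ : ℂ)) +
          ∫ s in (0 : ℝ)..t,
            (-(ℓ : ℂ) * (∫ ξ in Ioi (0 : ℝ), w s ℓ ξ * ((deriv ψ ξ : ℝ) : ℂ)) +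
              (K * ℓ / 2 : ℂ) *
                ∫ ξ in Ioi (0 : ℝ),
                  (r * lowerMode (w s) ℓ ξ - r * w s (ℓ + 1) ξ) * (ψ ξ : ℂ))

open Classical in
/-- `e^{t L₁} v` for `t ≥ 0` and `v ∈ X_{p_b}`: the value at time `t` of the (unique) weak solution
with initial value `v`. -/
def expL1 (K r b t : ℝ) (v : ℕ → ℝ → ℂ) : ℕ → ℝ → ℂ :=
  if h : ∃ w, IsWeakSolution K r b v w then h.choose t else 0

/-! ### The Volterra kernel and the characteristic equation -/

/-- The kernel `k_{Lc}(t)`, for `r_r, r_i ∈ X_{p_b}`. -/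
def kLc (K r : ℝ) (g : Measure ℝ) (b t : ℝ) : Matrix (Fin 2) (Fin 2) ℝ :=
  -!![(expL1 K r b t (rR K r g) 1 0).re, (expL1 K r b t (rI K r g) 1 0).re;
      (expL1 K r b t (rR K r g) 1 0).im, (expL1 K r b t (rI K r g) 1 0).im]

/-- Laplace transform (entrywise) of a matrix-valued function on `(0, ∞)`. -/
def laplace (k : ℝ → Matrix (Fin 2) (Fin 2) ℝ) (z : ℂ) : Matrix (Fin 2) (Fin 2) ℂ :=
  Matrix.of fun i j => ∫ t in Ioi (0 : ℝ), (k t i j : ℂ) * Complex.exp (-z * t)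

/-- `det (Id + (𝓛 k_{Lc})(z))`. -/
def charDet (K r : ℝ) (g : Measure ℝ) (b : ℝ) (z : ℂ) : ℂ :=
  (1 + laplace (kLc K r g b) z).det

/-- `v` is an eigenmode of `L` for the real eigenvalue `a`. -/
def IsEigenmode (K r : ℝ) (g : Measure ℝ) (a : ℝ) (v : ℕ → ℝ → ℂ) : Prop :=
  ¬ ModeEq v 0 ∧ ModeEq (opL K r g v) (a • v)

/-- `vc, vs` are linearly independent over `ℝ` and
`L vc = (Re z) vc - (Im z) vs`, `L vs = (Im z) vc + (Re z) vs`. -/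
def IsRotatingPair (K r : ℝ) (g : Measure ℝ) (z : ℂ) (vc vs : ℕ → ℝ → ℂ) : Prop :=
  ModeIndep vc vs ∧
    ModeEq (opL K r g vc) (z.re • vc - z.im • vs) ∧
    ModeEq (opL K r g vs) (z.im • vc + z.re • vs)

end

end Kuramoto

/-! The operator `L₂` sees a state `u` only through the two real numbers `Re u₁(0)` and `Im u₁(0)`,
and `L₂ u = Re u₁(0) · r_r + Im u₁(0) · r_i`. An eigenmode must therefore satisfy `(λ - L₁) v = c₀
r_r + c₁ r_i` with `c₀ + i c₁ = v₁(0)`. The resolvent of `L₁` is a Laplace transform of its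
semigroup, so `v = ∫₀^∞ e^{-λt} e^{tL₁}(c₀ r_r + c₁ r_i) dt`, and the condition on `v₁(0)` reads
`(Id + 𝓛k(λ)) c = 0`. A root of the determinant supplies such a `c ≠ 0`.

Since `L` is only real linear, real kernels `κ = (κ₀, κ₁)` replace `e^{-λt} c`. Put `V(κ) = ∫₀^∞ κ₀
e^{tL₁} r_r + κ₁ e^{tL₁} r_i dt`. Integration by parts in time gives `L₁ V(κ) = -κ₀(0) r_r - κ₁(0)
r_i - V(κ')`; hence `L V(κ) = -V(κ')` as soon as the value of the first mode at `0` is `κ₀(0) + i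
κ₁(0)` (`modeEq_opL_modeOf`). All four cases are choices of `κ`. For a root `z`, the kernels `Re(γ
e^{-zt} c)` with `γ ∈ ℂ` give modes `F γ` with `L (F γ) = F (z γ)`, real linear in `γ`. For a
multiple root at `0`, let `M + x N` be the expansion of `Id + 𝓛k(x)` to first order. Either `M = 0`
and constant kernels give two eigenmodes, or there is a Jordan chain `M p = 0`, `M q + N p = 0`, and
the kernels `p` and `q - t p` give the chain of modes.

Convergence of these integrals rests on the decay of `e^{tL₁}`. In the coordinates `u_ℓ / √ℓ` the
interaction is skew-symmetric. As `∂_ξ` commutes with `L₁`, the evolution is the translation by `t`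
composed with the evolution of `L₁ - ∂_ξ`, whose transport speeds `ℓ - 1` are still nonnegative and
which is thus contractive for the increasing weight. The translation turns the weight `(1 + ξ)^b`
into a factor `(1 + t)^{b' - b}` in the weaker norm with weight `(1 + ξ)^{b'}`. The evolution itself
is a weak ultralimit of exponentials of bounded dissipative operators (`exists_weak_evolution`,
`exists_decaying_solution`).

Because `e^{tL₁} v` is defined as some weak solution, uniqueness is needed to transfer the decay to
it. The interaction grows like `ℓ`, so an energy estimate on the first `n` modes leaks through mode
`n`. The leakage, divided by `n`, is summable in `n`, and divergence of the harmonic series forces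
the energy to vanish (`IsRegularSolution.eq_zero`). Finally a weighted Cauchy-Schwarz inequality in
time places `V(κ)` in `X_b` whenever `κ` has order `(1 + t)^{-j}` and `br - b + j > 1`
(`l2NormSq_superpose_lt_top`): `j = 2`, `0`, `-1` for exponential, bounded and affine kernels. -/

namespace Kuramoto

open Filter Topology

/-! ### Primitives on the half line -/

/-- Lebesgue measure on the open half line. -/
noncomputable abbrev halfLine : Measure ℝ := volume.restrict (Ioi 0)

/-- `f` is a primitive of the locally integrable function `d` on `[0, ∞)`. -/
structure IsPrim (f d : ℝ → ℂ) : Prop where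
  integrable : ∀ R : ℝ, 0 < R → IntervalIntegrable d volume 0 R
  eq : ∀ x : ℝ, 0 ≤ x → f x = f 0 + ∫ t in (0 : ℝ)..x, d t

/-- Smooth test functions with compact support in `(0, ∞)`. -/
structure IsTest (ψ : ℝ → ℝ) : Prop where
  smooth : ContDiff ℝ (⊤ : ℕ∞) ψ
  compact : HasCompactSupport ψ
  supp : tsupport ψ ⊆ Ioi 0

/-- Absolute continuity of a complex function and of its real and imaginary parts are exchanged by
this comparison: increments of a part are bounded by those of the function, and those of the
function by the sum over both parts. -/
theorem absolutelyContinuousOnInterval_of_dist_le {X Y Z : Type*} [PseudoMetricSpace X]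
    [PseudoMetricSpace Y] [PseudoMetricSpace Z] {f : ℝ → X} {g : ℝ → Y} {h : ℝ → Z} {a b : ℝ}
    (hg : AbsolutelyContinuousOnInterval g a b) (hh : AbsolutelyContinuousOnInterval h a b)
    (hle : ∀ x ∈ uIcc a b, ∀ y ∈ uIcc a b,
      dist (f x) (f y) ≤ dist (g x) (g y) + dist (h x) (h y)) :
    AbsolutelyContinuousOnInterval f a b := by
  unfold AbsolutelyContinuousOnInterval at hg hh ⊢
  have := hg.add hh
  rw [add_zero] at this
  refine squeeze_zero' ?_ ?_ this
  · exact Eventually.of_forall fun E => Finset.sum_nonneg fun _ _ => dist_nonneg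
  · have hE : ∀ᶠ E : ℕ × (ℕ → ℝ × ℝ) in AbsolutelyContinuousOnInterval.totalLengthFilter ⊓
        𝓟 (AbsolutelyContinuousOnInterval.disjWithin a b),
        E ∈ AbsolutelyContinuousOnInterval.disjWithin a b :=
      eventually_inf_principal.mpr (by simp)
    filter_upwards [hE] with E hE
    rw [← Finset.sum_add_distrib]
    exact Finset.sum_le_sum fun i hi => hle _ (hE.1 i hi).1 _ (hE.1 i hi).2

theorem ac_re {f : ℝ → ℂ} {a b : ℝ} (hf : AbsolutelyContinuousOnInterval f a b) :
    AbsolutelyContinuousOnInterval (fun x => (f x).re) a b :=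
  absolutelyContinuousOnInterval_of_dist_le hf hf fun x _ y _ => by
    have : dist (f x).re (f y).re ≤ dist (f x) (f y) := by
      rw [Complex.dist_eq, Real.dist_eq, ← Complex.sub_re]; exact Complex.abs_re_le_norm _
    linarith [dist_nonneg (x := f x) (y := f y)]

theorem ac_im {f : ℝ → ℂ} {a b : ℝ} (hf : AbsolutelyContinuousOnInterval f a b) :
    AbsolutelyContinuousOnInterval (fun x => (f x).im) a b :=
  absolutelyContinuousOnInterval_of_dist_le hf hf fun x _ y _ => by
    have : dist (f x).im (f y).im ≤ dist (f x) (f y) := by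
      rw [Complex.dist_eq, Real.dist_eq, ← Complex.sub_im]; exact Complex.abs_im_le_norm _
    linarith [dist_nonneg (x := f x) (y := f y)]

theorem hasDerivAt_of_re_im {f : ℝ → ℂ} {a b x : ℝ} (hr : HasDerivAt (fun x => (f x).re) a x)
    (hi : HasDerivAt (fun x => (f x).im) b x) : HasDerivAt f (a + b * Complex.I) x := by
  have := (hr.ofReal_comp).add ((hi.ofReal_comp).mul_const Complex.I)
  refine this.congr_of_eventuallyEq (Eventually.of_forall fun y => ?_)
  simp [Complex.re_add_im]

/-- The fundamental theorem of calculus for the real and imaginary parts. Together with `IsPrim.ac`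
it identifies local absolute continuity with being a primitive, the form in which weak equations
deliver regularity. -/
theorem IsPrim.of_ac {f : ℝ → ℂ} (hf : ∀ R : ℝ, 0 < R → AbsolutelyContinuousOnInterval f 0 R) :
    IsPrim f (deriv f) := by
  have key : ∀ R : ℝ, 0 < R → IntervalIntegrable (deriv f) volume 0 R ∧
      f R = f 0 + ∫ t in (0 : ℝ)..R, deriv f t := by
    intro R hR
    have h1 := ac_re (hf R hR)
    have h2 := ac_im (hf R hR)
    have hae : ∀ᵐ x, x ∈ uIoc 0 R → deriv f x =
        ((deriv (fun x => (f x).re) x : ℝ) : ℂ) +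
          ((deriv (fun x => (f x).im) x : ℝ) : ℂ) * Complex.I := by
      filter_upwards [h1.ae_differentiableAt, h2.ae_differentiableAt] with x hx hx' hxm
      have hxm := uIoc_subset_uIcc hxm
      exact (hasDerivAt_of_re_im (hx hxm).hasDerivAt (hx' hxm).hasDerivAt).deriv
    have i1 : IntervalIntegrable (fun x => ((deriv (fun x => (f x).re) x : ℝ) : ℂ)) volume 0 R :=
      ⟨h1.intervalIntegrable_deriv.1.ofReal, h1.intervalIntegrable_deriv.2.ofReal⟩
    have i2 : IntervalIntegrable (fun x => ((deriv (fun x => (f x).im) x : ℝ) : ℂ) * Complex.I)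
        volume 0 R := IntervalIntegrable.mul_const
          ⟨h2.intervalIntegrable_deriv.1.ofReal, h2.intervalIntegrable_deriv.2.ofReal⟩ _
    have hae' := (ae_restrict_iff' measurableSet_uIoc).2 hae
    constructor
    · exact (i1.add i2).congr_ae (hae'.mono fun x hx => hx.symm)
    · rw [intervalIntegral.integral_congr_ae hae, intervalIntegral.integral_add i1 i2,
        intervalIntegral.integral_mul_const, intervalIntegral.integral_ofReal,
        intervalIntegral.integral_ofReal, h1.integral_deriv_eq_sub, h2.integral_deriv_eq_sub]
      apply Complex.ext <;> simp
  refine ⟨fun R hR => (key R hR).1, fun x hx => ?_⟩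
  rcases hx.eq_or_lt with rfl | hx
  · simp
  · exact (key x hx).2

theorem IsPrim.ac {f d : ℝ → ℂ} (h : IsPrim f d) (R : ℝ) (hR : 0 < R) :
    AbsolutelyContinuousOnInterval f 0 R := by
  have hi := h.integrable R hR
  have hre : IntervalIntegrable (fun x => (d x).re) volume 0 R := ⟨hi.1.re, hi.2.re⟩
  have him : IntervalIntegrable (fun x => (d x).im) volume 0 R := ⟨hi.1.im, hi.2.im⟩
  have h1 := hre.absolutelyContinuousOnInterval_intervalIntegral (c := 0) left_mem_uIcc
  have h2 := him.absolutelyContinuousOnInterval_intervalIntegral (c := 0) left_mem_uIcc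
  refine absolutelyContinuousOnInterval_of_dist_le h1 h2 fun x hx y hy => ?_
  rw [uIcc_of_le hR.le] at hx hy
  have hint : ∀ z ∈ Icc 0 R, IntervalIntegrable d volume 0 z := fun z hz =>
    hi.mono_set (by rw [uIcc_of_le hz.1, uIcc_of_le hR.le]; exact Icc_subset_Icc_right hz.2)
  have e1 : ∀ z ∈ Icc 0 R, (∫ t in (0 : ℝ)..z, (d t).re) = (∫ t in (0 : ℝ)..z, d t).re := by
    intro z hz
    rw [intervalIntegral.integral_of_le hz.1, intervalIntegral.integral_of_le hz.1]
    exact integral_re (hint z hz).1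
  have e2 : ∀ z ∈ Icc 0 R, (∫ t in (0 : ℝ)..z, (d t).im) = (∫ t in (0 : ℝ)..z, d t).im := by
    intro z hz
    rw [intervalIntegral.integral_of_le hz.1, intervalIntegral.integral_of_le hz.1]
    exact integral_im (hint z hz).1
  rw [h.eq x hx.1, h.eq y hy.1, dist_add_left, e1 x hx, e1 y hy, e2 x hx, e2 y hy,
    Complex.dist_eq, Real.dist_eq, Real.dist_eq, ← Complex.sub_re, ← Complex.sub_im]
  exact Complex.norm_le_abs_re_add_abs_im _

theorem IsPrim.continuousOn {f d : ℝ → ℂ} (h : IsPrim f d) : ContinuousOn f (Ici 0) := by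
  intro x hx
  have h1 := (h.ac (x + 1) (by linarith [mem_Ici.1 hx])).continuousOn
  rw [uIcc_of_le (by linarith [mem_Ici.1 hx])] at h1
  refine (h1 x ⟨hx, by linarith⟩).mono_of_mem_nhdsWithin ?_
  filter_upwards [self_mem_nhdsWithin, mem_nhdsWithin_of_mem_nhds (Iic_mem_nhds (lt_add_one x))]
    with y hy hy' using ⟨hy, hy'⟩

theorem ae_halfLine_of_forall {p : ℝ → Prop} (h : ∀ R : ℝ, 0 < R → ∀ᵐ x, x ∈ Ioo 0 R → p x) :
    ∀ᵐ x ∂halfLine, p x := by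
  rw [ae_restrict_iff' measurableSet_Ioi]
  have : ∀ᵐ x : ℝ, ∀ n : ℕ, x ∈ Ioo 0 ((n : ℝ) + 1) → p x :=
    ae_all_iff.2 fun n => h _ (by positivity)
  filter_upwards [this] with x hx hx0
  obtain ⟨n, hn⟩ := exists_nat_gt x
  exact hx n ⟨hx0, hn.trans (lt_add_one _)⟩

theorem IsPrim.ae_hasDerivAt {f d : ℝ → ℂ} (h : IsPrim f d) :
    ∀ᵐ x ∂halfLine, HasDerivAt f (d x) x := by
  refine ae_halfLine_of_forall fun R hR => ?_
  filter_upwards [(h.integrable R hR).ae_hasDerivAt_integral] with x hx hxm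
  have h1 := hx (by rw [uIcc_of_le hR.le]; exact Ioo_subset_Icc_self hxm) 0 left_mem_uIcc
  refine (h1.const_add (f 0)).congr_of_eventuallyEq ?_
  filter_upwards [Ioi_mem_nhds hxm.1] with y hy using h.eq y (le_of_lt hy)

theorem IsPrim.deriv_ae {f d : ℝ → ℂ} (h : IsPrim f d) : deriv f =ᵐ[halfLine] d :=
  h.ae_hasDerivAt.mono fun _ hx => hx.deriv

theorem IsPrim.intervalIntegrable {f d : ℝ → ℂ} (h : IsPrim f d) {a b : ℝ} (ha : 0 ≤ a)
    (hb : 0 ≤ b) : IntervalIntegrable d volume a b := by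
  refine (h.integrable (max a b + 1) (by positivity)).mono_set ?_
  rw [uIcc_of_le (by positivity : (0 : ℝ) ≤ max a b + 1)]
  intro x hx
  rcases le_total a b with hab | hab
  · rw [uIcc_of_le hab] at hx
    exact ⟨ha.trans hx.1, hx.2.trans ((le_max_right a b).trans (by linarith))⟩
  · rw [uIcc_of_ge hab] at hx
    exact ⟨hb.trans hx.1, hx.2.trans ((le_max_left a b).trans (by linarith))⟩

theorem IsPrim.sub_eq {f d : ℝ → ℂ} (h : IsPrim f d) {a b : ℝ} (ha : 0 ≤ a) (hb : 0 ≤ b) :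
    f b - f a = ∫ t in a..b, d t := by
  rw [h.eq a ha, h.eq b hb, add_sub_add_left_eq_sub,
    intervalIntegral.integral_interval_sub_left (h.intervalIntegrable le_rfl hb)
      (h.intervalIntegrable le_rfl ha)]

theorem IsPrim.add {f d g e : ℝ → ℂ} (h : IsPrim f d) (h' : IsPrim g e) :
    IsPrim (f + g) (d + e) := by
  refine ⟨fun R hR => (h.integrable R hR).add (h'.integrable R hR), fun x hx => ?_⟩
  have : ∫ t in (0 : ℝ)..x, (d + e) t = (∫ t in (0 : ℝ)..x, d t) + ∫ t in (0 : ℝ)..x, e t :=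
    intervalIntegral.integral_add (h.intervalIntegrable le_rfl hx)
      (h'.intervalIntegrable le_rfl hx)
  rw [this, Pi.add_apply, Pi.add_apply, h.eq x hx, h'.eq x hx]
  ring

theorem IsPrim.smul {f d : ℝ → ℂ} (h : IsPrim f d) (c : ℂ) : IsPrim (c • f) (c • d) := by
  refine ⟨fun R hR => (h.integrable R hR).smul c, fun x hx => ?_⟩
  have : ∫ t in (0 : ℝ)..x, (c • d) t = c • ∫ t in (0 : ℝ)..x, d t :=
    intervalIntegral.integral_smul c d
  rw [this, Pi.smul_apply, Pi.smul_apply, h.eq x hx, smul_add]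

theorem IsPrim.shift {f d : ℝ → ℂ} (h : IsPrim f d) {t : ℝ} (ht : 0 ≤ t) :
    IsPrim (fun x => f (x + t)) (fun x => d (x + t)) := by
  refine ⟨fun R hR => ?_, fun x hx => ?_⟩
  · have := (h.intervalIntegrable ht (add_nonneg hR.le ht)).comp_add_right t
    simpa using this
  · rw [intervalIntegral.integral_comp_add_right (fun x => d x), zero_add,
      ← h.sub_eq ht (add_nonneg hx ht)]
    ring

theorem IsPrim.congr_ae {f d e : ℝ → ℂ} (h : IsPrim f d) (hde : d =ᵐ[halfLine] e) :
    IsPrim f e := by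
  have hr : ∀ x : ℝ, 0 ≤ x → d =ᵐ[volume.restrict (uIoc 0 x)] e := fun x hx => by
    rw [uIoc_of_le hx]
    exact ae_restrict_of_ae_restrict_of_subset (fun y hy => hy.1) hde
  refine ⟨fun R hR => (h.integrable R hR).congr_ae (hr R hR.le), fun x hx => ?_⟩
  rw [h.eq x hx]
  congr 1
  exact intervalIntegral.integral_congr_ae ((ae_restrict_iff' measurableSet_uIoc).1 (hr x hx))

theorem eqOn_of_ae_eq_halfLine {f g : ℝ → ℂ} (hf : ContinuousOn f (Ici 0))
    (hg : ContinuousOn g (Ici 0)) (h : f =ᵐ[halfLine] g) : EqOn f g (Ici 0) := by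
  have h1 : EqOn f g (Ioi 0) :=
    Measure.eqOn_open_of_ae_eq h isOpen_Ioi (hf.mono Ioi_subset_Ici_self)
      (hg.mono Ioi_subset_Ici_self)
  refine h1.of_subset_closure hf hg Ioi_subset_Ici_self ?_
  rw [closure_Ioi]

/-! ### Test functions -/

theorem IsTest.exists_Icc {ψ : ℝ → ℝ} (h : IsTest ψ) :
    ∃ a R : ℝ, 0 < a ∧ a < R ∧ ∀ x, x ∉ Icc a R → ψ x = 0 := by
  rcases (tsupport ψ).eq_empty_or_nonempty with he | hne
  · exact ⟨1, 2, one_pos, one_lt_two, fun x _ => image_eq_zero_of_notMem_tsupport (by simp [he])⟩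
  · obtain ⟨a, ha, ha'⟩ := h.compact.isCompact.exists_isLeast hne
    obtain ⟨R, hR, hR'⟩ := h.compact.isCompact.exists_isGreatest hne
    refine ⟨a, R + 1, h.supp ha, by linarith [ha' hR], fun x hx => ?_⟩
    refine image_eq_zero_of_notMem_tsupport fun hx' => hx ⟨ha' hx', by linarith [hR' hx']⟩

theorem isTest_of_Icc {ψ : ℝ → ℝ} {a R : ℝ} (ha : 0 < a) (hs : ContDiff ℝ (⊤ : ℕ∞) ψ)
    (h : ∀ x, x ∉ Icc a R → ψ x = 0) : IsTest ψ := by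
  have h1 : tsupport ψ ⊆ Icc a R :=
    closure_minimal (fun x hx => by_contra fun hx' => hx (h x hx')) isClosed_Icc
  exact ⟨hs, HasCompactSupport.intro isCompact_Icc h, fun x hx => ha.trans_le (h1 hx).1⟩

theorem IsTest.deriv {ψ : ℝ → ℝ} (h : IsTest ψ) : IsTest (deriv ψ) :=
  ⟨(contDiff_infty_iff_deriv.1 h.smooth).2, h.compact.deriv,
    (tsupport_deriv_subset).trans h.supp⟩

theorem IsTest.shift {ψ : ℝ → ℝ} (h : IsTest ψ) {t : ℝ} (ht : 0 ≤ t) :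
    IsTest (fun x => ψ (x - t)) := by
  obtain ⟨a, R, ha, -, hs⟩ := h.exists_Icc
  refine isTest_of_Icc (a := a) (R := R + t) ha
    (h.smooth.comp (contDiff_id.sub contDiff_const)) fun x hx => hs _ fun hx' => hx ?_
  exact ⟨by linarith [hx'.1], by linarith [hx'.2]⟩

theorem IsTest.continuous {ψ : ℝ → ℝ} (h : IsTest ψ) : Continuous ψ := h.smooth.continuous

theorem setIntegral_Ioi_eq_interval {F : ℝ → ℂ} {R : ℝ} (hR : 0 ≤ R)
    (h : ∀ x, R < x → F x = 0) : ∫ x in Ioi (0 : ℝ), F x = ∫ x in (0 : ℝ)..R, F x := by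
  rw [intervalIntegral.integral_of_le hR]
  refine (setIntegral_eq_of_subset_of_forall_sdiff_eq_zero measurableSet_Ioi
    (fun x hx => hx.1) fun x hx => h x ?_)
  by_contra hx'
  exact hx.2 ⟨hx.1, (not_lt.1 hx' :)⟩

/-- Integration by parts against a test function. -/
theorem IsPrim.integral_mul_deriv {f d : ℝ → ℂ} (h : IsPrim f d) {ψ : ℝ → ℝ} (hψ : IsTest ψ) :
    ∫ x in Ioi (0 : ℝ), f x * ((deriv ψ x : ℝ) : ℂ) = -∫ x in Ioi (0 : ℝ), d x * (ψ x : ℂ) := by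
  obtain ⟨a, R, ha, haR, hs⟩ := hψ.exists_Icc
  have hR : 0 < R + 1 := by linarith
  have hs' : ∀ x, R + 1 < x → ψ x = 0 := fun x hx => hs x fun hx' => by linarith [hx'.2]
  have hd' : ∀ x, R + 1 < x → deriv ψ x = 0 := fun x hx => by
    have : ψ =ᶠ[𝓝 x] fun _ => 0 := by
      filter_upwards [Ioi_mem_nhds hx] with y hy using hs' y hy
    rw [this.deriv_eq, deriv_const]
  rw [setIntegral_Ioi_eq_interval hR.le fun x hx => by simp [hd' x hx],
    setIntegral_Ioi_eq_interval hR.le fun x hx => by simp [hs' x hx]]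
  have hac : ∀ S : ℝ, 0 < S → AbsolutelyContinuousOnInterval (ψ • f) 0 S := fun S hS =>
    ((hψ.smooth.of_le (by exact_mod_cast le_top)).contDiffOn.absolutelyContinuousOnInterval).smul
      (h.ac S hS)
  have hp := (IsPrim.of_ac hac).eq (R + 1) hR.le
  have z1 : ψ (R + 1) = 0 := hs _ fun hx' => by linarith [hx'.2]
  have z2 : ψ 0 = 0 := hs _ fun hx' => by linarith [hx'.1]
  have hae : ∀ᵐ x, x ∈ uIoc 0 (R + 1) →
      deriv (ψ • f) x = f x * ((deriv ψ x : ℝ) : ℂ) + d x * (ψ x : ℂ) := by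
    have := (ae_restrict_iff' measurableSet_Ioi).1 h.ae_hasDerivAt
    filter_upwards [this] with x hx hxm
    rw [uIoc_of_le hR.le] at hxm
    have h1 : HasDerivAt ψ (deriv ψ x) x :=
      (hψ.smooth.differentiable (by simp)).differentiableAt.hasDerivAt
    rw [(h1.smul (hx hxm.1)).deriv, Complex.real_smul, Complex.real_smul]
    ring
  rw [intervalIntegral.integral_congr_ae hae, intervalIntegral.integral_add] at hp
  · simp only [Pi.smul_apply', z1, z2, zero_smul, zero_add] at hp
    linear_combination -hp
  · refine ContinuousOn.intervalIntegrable (ContinuousOn.mul ?_ ?_)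
    · rw [uIcc_of_le hR.le]; exact h.continuousOn.mono Icc_subset_Ici_self
    · exact (Complex.continuous_ofReal.comp hψ.deriv.continuous).continuousOn
  · exact (h.integrable _ hR).mul_continuousOn
      (Complex.continuous_ofReal.comp hψ.continuous).continuousOn

theorem exists_isTest_integral_eq_one : ∃ η : ℝ → ℝ, IsTest η ∧ ∫ x in Ioi (0 : ℝ), η x = 1 := by
  let φ : ContDiffBump (2 : ℝ) := ⟨1 / 2, 1, by norm_num, by norm_num⟩
  have hs : ∀ x, x ∉ Icc (1 : ℝ) 3 → φ.normed volume x = 0 := by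
    intro x hx
    by_contra h
    have : x ∈ Function.support (φ.normed volume) := h
    rw [φ.support_normed_eq, Metric.mem_ball, Real.dist_eq, abs_lt] at this
    change -1 < x - 2 ∧ x - 2 < 1 at this
    exact hx ⟨by linarith, by linarith⟩
  refine ⟨φ.normed volume, isTest_of_Icc one_pos φ.contDiff_normed hs, ?_⟩
  rw [setIntegral_eq_integral_of_forall_compl_eq_zero, φ.integral_normed]
  intro x hx
  exact hs x fun hx' => hx (lt_of_lt_of_le one_pos hx'.1)

/-- Vanishing mean is exactly what makes the primitive starting at `0` vanish again to the right of
the support, so that test functions of mean zero are derivatives of test functions. -/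
theorem IsTest.exists_primitive {θ : ℝ → ℝ} (h : IsTest θ) (h0 : ∫ x in Ioi (0 : ℝ), θ x = 0) :
    ∃ ψ, IsTest ψ ∧ ∀ x, HasDerivAt ψ (θ x) x := by
  obtain ⟨a, R, ha, haR, hs⟩ := h.exists_Icc
  have hd : ∀ x, HasDerivAt (fun x => ∫ t in (0 : ℝ)..x, θ t) (θ x) x := fun x =>
    intervalIntegral.integral_hasDerivAt_right (h.continuous.intervalIntegrable _ _)
      (h.continuous.stronglyMeasurableAtFilter _ _) h.continuous.continuousAt
  refine ⟨fun x => ∫ t in (0 : ℝ)..x, θ t, isTest_of_Icc (a := a) (R := R) ha ?_ ?_, hd⟩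
  · rw [contDiff_infty_iff_deriv]
    refine ⟨fun x => (hd x).differentiableAt, ?_⟩
    rw [show _root_.deriv (fun x => ∫ t in (0 : ℝ)..x, θ t) = θ from funext fun x => (hd x).deriv]
    exact h.smooth
  · intro x hx
    rcases lt_or_ge x a with hxa | hxa
    · refine intervalIntegral.integral_zero_ae (Eventually.of_forall fun t ht => hs t fun ht' => ?_)
      rcases le_total 0 x with h0x | h0x
      · rw [uIoc_of_le h0x] at ht; linarith [ht.2, ht'.1]
      · rw [uIoc_of_ge h0x] at ht; linarith [ht.2, ht'.1]
    · have hxR : R < x := by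
        by_contra hh; exact hx ⟨hxa, not_lt.1 hh⟩
      rw [intervalIntegral.integral_of_le (by linarith)]
      refine Eq.trans (Eq.symm ?_) h0
      refine setIntegral_eq_of_subset_of_forall_sdiff_eq_zero measurableSet_Ioi
        (fun y hy => hy.1) fun y hy => hs y fun hy' => hy.2 ⟨hy.1, by linarith [hy'.2]⟩

theorem integrableOn_mul_test {u : ℝ → ℂ} (hu : ∀ R : ℝ, 0 < R → IntervalIntegrable u volume 0 R)
    {ψ : ℝ → ℝ} (hψ : IsTest ψ) : Integrable (fun x => u x * (ψ x : ℂ)) halfLine := by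
  obtain ⟨a, R, ha, haR, hs⟩ := hψ.exists_Icc
  have h1 : IntegrableOn (fun x => u x * (ψ x : ℂ)) (Ioc 0 R) :=
    ((hu R (by linarith)).mul_continuousOn
      (Complex.continuous_ofReal.comp hψ.continuous).continuousOn).1
  refine h1.of_forall_sdiff_eq_zero measurableSet_Ioi fun x hx => ?_
  rw [hs x fun hx' => hx.2 ⟨hx.1, hx'.2⟩]
  simp

/-- The lemma of du Bois-Reymond on the half line. -/
theorem exists_isPrim_of_weak_deriv {u d : ℝ → ℂ}
    (hu : ∀ R : ℝ, 0 < R → IntervalIntegrable u volume 0 R)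
    (hd : ∀ R : ℝ, 0 < R → IntervalIntegrable d volume 0 R)
    (h : ∀ ψ, IsTest ψ → ∫ x in Ioi (0 : ℝ), u x * ((deriv ψ x : ℝ) : ℂ) =
      -∫ x in Ioi (0 : ℝ), d x * (ψ x : ℂ)) :
    ∃ f, IsPrim f d ∧ u =ᵐ[halfLine] f := by
  set U : ℝ → ℂ := fun x => ∫ t in (0 : ℝ)..x, d t with hU
  have hUp : IsPrim U d := ⟨hd, fun x _ => by simp [hU]⟩
  have hUi : ∀ R : ℝ, 0 < R → IntervalIntegrable U volume 0 R := fun R hR =>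
    ContinuousOn.intervalIntegrable (by
      rw [uIcc_of_le hR.le]; exact hUp.continuousOn.mono Icc_subset_Ici_self)
  have hei : ∀ R : ℝ, 0 < R → IntervalIntegrable (u - U) volume 0 R := fun R hR =>
    (hu R hR).sub (hUi R hR)
  have he : ∀ ψ, IsTest ψ → ∫ x in Ioi (0 : ℝ), (u - U) x * ((deriv ψ x : ℝ) : ℂ) = 0 := by
    intro ψ hψ
    simp only [Pi.sub_apply, sub_mul]
    rw [integral_sub (integrableOn_mul_test hu hψ.deriv) (integrableOn_mul_test hUi hψ.deriv),
      h ψ hψ, hUp.integral_mul_deriv hψ, sub_self]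
  obtain ⟨η₀, hη₀, hη₁⟩ := exists_isTest_integral_eq_one
  -- The function `u - U` has vanishing weak derivative, hence is constant; the constant is read off
  -- by a test function of mass one.
  set c : ℂ := ∫ x in Ioi (0 : ℝ), (u - U) x * (η₀ x : ℂ) with hc
  have hz : ∀ᵐ x : ℝ, x ∈ Ioi (0 : ℝ) → (u - U) x - c = 0 := by
    refine isOpen_Ioi.ae_eq_zero_of_integral_contDiff_smul_eq_zero ?_ ?_
    · intro x hx
      refine ⟨Ioo 0 (x + 1), mem_nhdsWithin_of_mem_nhds (Ioo_mem_nhds hx (lt_add_one x)), ?_⟩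
      have h1 := (hei (x + 1) (by linarith [mem_Ioi.1 hx])).1
      have h2 : IntegrableOn (fun _ : ℝ => c) (Ioc 0 (x + 1)) := by
        simp [integrableOn_const_iff]
      exact (h1.sub h2).mono_set Ioo_subset_Ioc_self
    · intro η hη hηc hηs
      have hηt : IsTest η := ⟨hη, hηc, hηs⟩
      have hηi : Integrable η halfLine := (hηt.continuous.integrable_of_hasCompactSupport hηc).restrict
      have hη₀i : Integrable η₀ halfLine :=
        (hη₀.continuous.integrable_of_hasCompactSupport hη₀.compact).restrict
      set m : ℝ := ∫ x in Ioi (0 : ℝ), η x with hm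
      -- Subtracting the right multiple of `η₀` removes the mean of `η`. The difference is then a
      -- derivative, to which `u - U` is orthogonal.
      have hθ : IsTest (fun x => η x - m * η₀ x) := by
        obtain ⟨a, R, ha, haR, hs⟩ := hηt.exists_Icc
        obtain ⟨a', R', ha', haR', hs'⟩ := hη₀.exists_Icc
        refine isTest_of_Icc (a := min a a') (R := max R R') (lt_min ha ha')
          (hη.sub (contDiff_const.mul hη₀.smooth)) fun x hx => ?_
        rw [hs x fun hx' => hx ⟨(min_le_left _ _).trans hx'.1, hx'.2.trans (le_max_left _ _)⟩,
          hs' x fun hx' => hx ⟨(min_le_right _ _).trans hx'.1, hx'.2.trans (le_max_right _ _)⟩]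
        simp
      have hθ0 : ∫ x in Ioi (0 : ℝ), (η x - m * η₀ x) = 0 := by
        rw [integral_sub hηi (hη₀i.const_mul m), integral_const_mul, hη₁]
        simp [hm]
      obtain ⟨ψ, hψ, hψd⟩ := hθ.exists_primitive hθ0
      have h1 := he ψ hψ
      have h2 : ∀ x, ((deriv ψ x : ℝ) : ℂ) = (η x : ℂ) - m * η₀ x := fun x => by
        rw [(hψd x).deriv]; push_cast; rfl
      have i1 := integrableOn_mul_test hei hηt
      have i2 := integrableOn_mul_test hei hη₀
      have h3 : ∫ x in Ioi (0 : ℝ), (u - U) x * (η x : ℂ) = m * c := by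
        have : ∀ x, (u - U) x * ((deriv ψ x : ℝ) : ℂ) =
            (u - U) x * (η x : ℂ) - m * ((u - U) x * (η₀ x : ℂ)) := fun x => by
          rw [h2 x]; ring
        simp only [this] at h1
        rw [integral_sub i1 (i2.const_mul _), integral_const_mul] at h1
        exact sub_eq_zero.1 h1
      have h4 : ∫ x in Ioi (0 : ℝ), (η x : ℂ) * c = m * c := by
        rw [integral_mul_const, integral_complex_ofReal]
      rw [← setIntegral_eq_integral_of_forall_compl_eq_zero (s := Ioi 0)]
      · have : ∀ x, η x • ((u - U) x - c) = (u - U) x * (η x : ℂ) - (η x : ℂ) * c := fun x => by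
          rw [Complex.real_smul]; ring
        simp only [this]
        have i3 : Integrable (fun x => (η x : ℂ) * c) halfLine := hηi.ofReal.mul_const c
        rw [integral_sub i1 i3, h3, h4, sub_self]
      · intro x hx
        rw [image_eq_zero_of_notMem_tsupport fun hx' => hx (hηs hx'), zero_smul]
  refine ⟨fun x => c + U x, ⟨hd, fun x _ => by simp [hU]⟩, ?_⟩
  rw [EventuallyEq, ae_restrict_iff' measurableSet_Ioi]
  filter_upwards [hz] with x hx hx0
  have := hx hx0
  simp only [Pi.sub_apply] at this
  linear_combination this

/-! ### The Hilbert space of a single mode -/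

/-- The weight `(1 + |x|)^b`, which is positive and continuous on the whole line. -/
noncomputable def wt (b x : ℝ) : ℝ := (1 + |x|) ^ b

theorem wt_pos (b x : ℝ) : 0 < wt b x := Real.rpow_pos_of_pos (by positivity) _

theorem wt_ne_zero (b x : ℝ) : (wt b x : ℂ) ≠ 0 := by exact_mod_cast (wt_pos b x).ne'

theorem continuous_wt (b : ℝ) : Continuous (wt b) :=
  (continuous_const.add continuous_abs).rpow_const fun x =>
    Or.inl (by positivity : (0 : ℝ) < 1 + |x|).ne'

theorem wt_eq_weight {b x : ℝ} (hx : 0 ≤ x) : wt b x = weight b x := by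
  rw [wt, weight, abs_of_nonneg hx]

theorem one_le_wt {b : ℝ} (hb : 0 ≤ b) (x : ℝ) : 1 ≤ wt b x :=
  Real.one_le_rpow (by linarith [abs_nonneg x]) hb

theorem wt_mono {b x y : ℝ} (hb : 0 ≤ b) (hx : 0 ≤ x) (hxy : x ≤ y) : wt b x ≤ wt b y := by
  rw [wt, wt, abs_of_nonneg hx, abs_of_nonneg (hx.trans hxy)]
  exact Real.rpow_le_rpow (by linarith) (by linarith) hb

/-- Square integrable functions on the half line. -/
noncomputable abbrev HalfL2 := Lp ℂ 2 halfLine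

/-- Integration of `u / wt b` against a continuous function with compact support. -/
noncomputable def pairing (b : ℝ) (η : ℝ → ℝ) (hη : Continuous η) (hc : HasCompactSupport η) :
    HalfL2 →L[ℂ] ℂ :=
  innerSL ℂ (MemLp.toLp (fun x => ((η x / wt b x : ℝ) : ℂ))
    (((Complex.continuous_ofReal.comp (hη.div (continuous_wt b) fun x => (wt_pos b x).ne')
      ).memLp_of_hasCompactSupport (hc.mono fun x hx hx' => hx (by simp [hx']))).restrict (Ioi 0)))

theorem pairing_apply {b : ℝ} {η : ℝ → ℝ} (hη : Continuous η) (hc : HasCompactSupport η)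
    (u : HalfL2) :
    pairing b η hη hc u = ∫ x in Ioi (0 : ℝ), u x / (wt b x : ℂ) * (η x : ℂ) := by
  rw [pairing, innerSL_apply_apply, L2.inner_def]
  refine integral_congr_ae ?_
  filter_upwards [MemLp.coeFn_toLp (f := fun x => ((η x / wt b x : ℝ) : ℂ))
    (((Complex.continuous_ofReal.comp (hη.div (continuous_wt b) fun x => (wt_pos b x).ne')
      ).memLp_of_hasCompactSupport (hc.mono fun x hx hx' => hx (by simp [hx']))).restrict (Ioi 0))]
    with x hx
  rw [hx]
  simp only [RCLike.inner_apply, Complex.conj_ofReal]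
  push_cast
  ring

/-- The weighted Sobolev space of a single mode: pairs `(φ f, φ f')` of square integrable functions,
where `φ = wt b`. -/
noncomputable def modeSubmodule (b : ℝ) : Submodule ℂ (WithLp 2 (HalfL2 × HalfL2)) :=
  ⨅ ψ : {ψ : ℝ → ℝ // IsTest ψ},
    LinearMap.ker ((pairing b (deriv ψ.1) ψ.2.deriv.continuous ψ.2.deriv.compact).comp
      (WithLp.fstL 2 ℂ HalfL2 HalfL2) +
    (pairing b ψ.1 ψ.2.continuous ψ.2.compact).comp
      (WithLp.sndL 2 ℂ HalfL2 HalfL2)).toLinearMap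

theorem mem_modeSubmodule {b : ℝ} {e : WithLp 2 (HalfL2 × HalfL2)} :
    e ∈ modeSubmodule b ↔ ∀ ψ, IsTest ψ →
      (∫ x in Ioi (0 : ℝ), e.fst x / (wt b x : ℂ) * ((deriv ψ x : ℝ) : ℂ)) =
        -∫ x in Ioi (0 : ℝ), e.snd x / (wt b x : ℂ) * (ψ x : ℂ) := by
  simp only [modeSubmodule, Submodule.mem_iInf, LinearMap.mem_ker, Subtype.forall]
  refine forall₂_congr fun ψ hψ => ?_
  rw [← add_eq_zero_iff_eq_neg, ← pairing_apply hψ.deriv.continuous hψ.deriv.compact,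
    ← pairing_apply hψ.continuous hψ.compact]
  rfl

/-- Each weak derivative identity is the kernel of a continuous functional. Closedness gives
completeness, on which the Riesz representation and weak compactness below depend. -/
theorem isClosed_modeSubmodule (b : ℝ) : IsClosed (modeSubmodule b : Set (WithLp 2 (HalfL2 × HalfL2))) := by
  rw [modeSubmodule, Submodule.coe_iInf]
  refine isClosed_iInter fun ψ => ?_
  exact ContinuousLinearMap.isClosed_ker _

/-- `modeSubmodule b` as a Hilbert space. -/
def ModeSpace (b : ℝ) : Type := modeSubmodule b

noncomputable instance (b : ℝ) : NormedAddCommGroup (ModeSpace b) :=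
  inferInstanceAs (NormedAddCommGroup (modeSubmodule b))

noncomputable instance (b : ℝ) : InnerProductSpace ℂ (ModeSpace b) :=
  inferInstanceAs (InnerProductSpace ℂ (modeSubmodule b))

instance (b : ℝ) : CompleteSpace (ModeSpace b) := (isClosed_modeSubmodule b).completeSpace_coe

namespace ModeSpace

variable {b : ℝ}

/-- The component `φ f` of a pair `(φ f, φ f')`. -/
noncomputable def fst (e : ModeSpace b) : HalfL2 := (Subtype.val (p := (· ∈ modeSubmodule b)) e).fst

/-- The component `φ f'` of a pair `(φ f, φ f')`. -/
noncomputable def snd (e : ModeSpace b) : HalfL2 := (Subtype.val (p := (· ∈ modeSubmodule b)) e).snd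

theorem fst_add (e e' : ModeSpace b) : (e + e').fst = e.fst + e'.fst := rfl
theorem snd_add (e e' : ModeSpace b) : (e + e').snd = e.snd + e'.snd := rfl
theorem fst_smul (c : ℂ) (e : ModeSpace b) : (c • e).fst = c • e.fst := rfl
theorem snd_smul (c : ℂ) (e : ModeSpace b) : (c • e).snd = c • e.snd := rfl

theorem ext {e e' : ModeSpace b} (h1 : e.fst = e'.fst) (h2 : e.snd = e'.snd) : e = e' :=
  Subtype.ext (WithLp.ofLp_injective 2 (Prod.ext h1 h2))

theorem inner_eq (e e' : ModeSpace b) :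
    inner ℂ e e' = inner ℂ e.fst e'.fst + inner ℂ e.snd e'.snd := rfl

theorem norm_fst_le (e : ModeSpace b) : ‖e.fst‖ ≤ ‖e‖ :=
  WithLp.norm_fst_le _ (Subtype.val (p := (· ∈ modeSubmodule b)) e)

theorem norm_snd_le (e : ModeSpace b) : ‖e.snd‖ ≤ ‖e‖ :=
  WithLp.norm_snd_le _ (Subtype.val (p := (· ∈ modeSubmodule b)) e)

theorem weak_deriv (e : ModeSpace b) (ψ : ℝ → ℝ) (hψ : IsTest ψ) :
    (∫ x in Ioi (0 : ℝ), e.fst x / (wt b x : ℂ) * ((deriv ψ x : ℝ) : ℂ)) =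
        -∫ x in Ioi (0 : ℝ), e.snd x / (wt b x : ℂ) * (ψ x : ℂ) :=
  mem_modeSubmodule.1 (Subtype.property (p := (· ∈ modeSubmodule b)) e) ψ hψ

end ModeSpace

/-- `f` is the absolutely continuous representative of `e`. -/
structure IsRep (b : ℝ) (f : ℝ → ℂ) (e : ModeSpace b) : Prop where
  prim : IsPrim f (deriv f)
  fst : e.fst =ᵐ[halfLine] fun x => (wt b x : ℂ) * f x
  snd : e.snd =ᵐ[halfLine] fun x => (wt b x : ℂ) * deriv f x

theorem intervalIntegrable_div_wt (b : ℝ) (u : HalfL2) (R : ℝ) (hR : 0 < R) :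
    IntervalIntegrable (fun x => u x / (wt b x : ℂ)) volume 0 R := by
  rw [intervalIntegrable_iff_integrableOn_Ioc_of_le hR.le]
  have h1 : MemLp u 2 (volume.restrict (Ioc 0 R)) :=
    (Lp.memLp u).mono_measure (Measure.restrict_mono (fun x hx => hx.1) le_rfl)
  have h2 : IntegrableOn u (Ioc 0 R) := h1.integrable one_le_two
  have h3 : IntervalIntegrable u volume 0 R :=
    (intervalIntegrable_iff_integrableOn_Ioc_of_le hR.le).2 h2
  have h4 := h3.mul_continuousOn (g := fun x => (wt b x : ℂ)⁻¹)
    ((Complex.continuous_ofReal.comp (continuous_wt b)).inv₀ (wt_ne_zero b)).continuousOn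
  exact ((intervalIntegrable_iff_integrableOn_Ioc_of_le hR.le).1 h4)

/-- The du Bois-Reymond lemma applied to both components divided by the weight, which is continuous
and positive and so does not affect local integrability. -/
theorem exists_isRep {b : ℝ} (e : ModeSpace b) : ∃ f, IsRep b f e := by
  obtain ⟨f, hf, hu⟩ := exists_isPrim_of_weak_deriv (intervalIntegrable_div_wt b e.fst)
    (intervalIntegrable_div_wt b e.snd) e.weak_deriv
  refine ⟨f, hf.congr_ae hf.deriv_ae.symm, ?_, ?_⟩
  · filter_upwards [hu] with x hx
    rw [← hx, mul_div_cancel₀ _ (wt_ne_zero b x)]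
  · filter_upwards [hf.deriv_ae] with x hx
    rw [hx, mul_div_cancel₀ _ (wt_ne_zero b x)]

theorem exists_modeSpace {b : ℝ} {f : ℝ → ℂ} (hf : IsPrim f (deriv f))
    (h1 : MemLp (fun x => (wt b x : ℂ) * f x) 2 halfLine)
    (h2 : MemLp (fun x => (wt b x : ℂ) * deriv f x) 2 halfLine) : ∃ e, IsRep b f e := by
  refine ⟨⟨WithLp.toLp 2 (h1.toLp, h2.toLp), ?_⟩, hf, h1.coeFn_toLp, h2.coeFn_toLp⟩
  rw [mem_modeSubmodule]
  intro ψ hψ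
  have e1 : ∫ x in Ioi (0 : ℝ), h1.toLp _ x / (wt b x : ℂ) * ((deriv ψ x : ℝ) : ℂ) =
      ∫ x in Ioi (0 : ℝ), f x * ((deriv ψ x : ℝ) : ℂ) := by
    refine integral_congr_ae ?_
    filter_upwards [h1.coeFn_toLp] with x hx
    rw [hx, mul_div_cancel_left₀ _ (wt_ne_zero b x)]
  have e2 : ∫ x in Ioi (0 : ℝ), h2.toLp _ x / (wt b x : ℂ) * (ψ x : ℂ) =
      ∫ x in Ioi (0 : ℝ), deriv f x * (ψ x : ℂ) := by
    refine integral_congr_ae ?_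
    filter_upwards [h2.coeFn_toLp] with x hx
    rw [hx, mul_div_cancel_left₀ _ (wt_ne_zero b x)]
  exact e1.trans ((hf.integral_mul_deriv hψ).trans (congrArg Neg.neg e2.symm))

theorem IsRep.add {b : ℝ} {f g : ℝ → ℂ} {e e' : ModeSpace b} (h : IsRep b f e)
    (h' : IsRep b g e') : IsRep b (f + g) (e + e') := by
  have hp := h.prim.add h'.prim
  have hd := hp.deriv_ae
  refine ⟨hp.congr_ae hd.symm, ?_, ?_⟩
  · filter_upwards [Lp.coeFn_add e.fst e'.fst, h.fst, h'.fst] with x h1 h2 h3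
    rw [ModeSpace.fst_add, h1, Pi.add_apply, h2, h3, Pi.add_apply]; ring
  · filter_upwards [Lp.coeFn_add e.snd e'.snd, h.snd, h'.snd, hd] with x h1 h2 h3 h4
    rw [ModeSpace.snd_add, h1, Pi.add_apply, h2, h3, h4, Pi.add_apply]; ring

theorem IsRep.smul {b : ℝ} {f : ℝ → ℂ} {e : ModeSpace b} (h : IsRep b f e) (c : ℂ) :
    IsRep b (c • f) (c • e) := by
  have hp := h.prim.smul c
  have hd := hp.deriv_ae
  refine ⟨hp.congr_ae hd.symm, ?_, ?_⟩
  · filter_upwards [Lp.coeFn_smul c e.fst, h.fst] with x h1 h2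
    rw [ModeSpace.fst_smul, h1, Pi.smul_apply, h2, Pi.smul_apply, smul_eq_mul, smul_eq_mul]; ring
  · filter_upwards [Lp.coeFn_smul c e.snd, h.snd, hd] with x h1 h2 h4
    rw [ModeSpace.snd_smul, h1, Pi.smul_apply, h2, h4, Pi.smul_apply, smul_eq_mul, smul_eq_mul]; ring

theorem IsRep.eqOn {b : ℝ} {f g : ℝ → ℂ} {e : ModeSpace b} (h : IsRep b f e)
    (h' : IsRep b g e) : EqOn f g (Ici 0) := by
  refine eqOn_of_ae_eq_halfLine h.prim.continuousOn h'.prim.continuousOn ?_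
  filter_upwards [h.fst, h'.fst] with x h1 h2
  exact mul_left_cancel₀ (wt_ne_zero b x) (h1.symm.trans h2)

theorem deriv_ae_eq_of_eqOn {f g : ℝ → ℂ} (hfg : EqOn f g (Ici 0)) :
    ∀ x, 0 < x → deriv f x = deriv g x := fun x hx =>
  EventuallyEq.deriv_eq (by filter_upwards [Ioi_mem_nhds hx] with y hy using hfg (mem_Ici.2 (le_of_lt hy)))

theorem IsRep.eq_of_eqOn {b : ℝ} {f g : ℝ → ℂ} {e e' : ModeSpace b} (h : IsRep b f e)
    (h' : IsRep b g e') (hfg : EqOn f g (Ici 0)) : e = e' := by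
  have hpos : ∀ᵐ x ∂halfLine, 0 < x := ae_restrict_mem measurableSet_Ioi
  have h1 : e.fst = e'.fst := Lp.ext (by
    filter_upwards [h.fst, h'.fst, hpos] with x h1 h2 h3
    rw [h1, h2, hfg (le_of_lt h3)])
  have h2 : e.snd = e'.snd := Lp.ext (by
    filter_upwards [h.snd, h'.snd, hpos] with x h1 h2 h3
    rw [h1, h2, deriv_ae_eq_of_eqOn hfg x h3])
  exact ModeSpace.ext h1 h2

theorem IsRep.inner_eq {b : ℝ} {f g : ℝ → ℂ} {e e' : ModeSpace b} (h : IsRep b f e)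
    (h' : IsRep b g e') :
    inner ℂ e' e = ∫ x in Ioi (0 : ℝ), (f x * conj (g x) + deriv f x * conj (deriv g x)) *
      ((wt b x ^ 2 : ℝ) : ℂ) := by
  rw [ModeSpace.inner_eq, L2.inner_def, L2.inner_def,
    ← integral_add (L2.integrable_inner _ _) (L2.integrable_inner _ _)]
  refine integral_congr_ae ?_
  filter_upwards [h.fst, h'.fst, h.snd, h'.snd] with x h1 h2 h3 h4
  rw [h1, h2, h3, h4]
  simp only [RCLike.inner_apply, map_mul, Complex.conj_ofReal]
  push_cast
  ring

theorem IsRep.memLp {b : ℝ} {f : ℝ → ℂ} {e : ModeSpace b} (h : IsRep b f e) :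
    MemLp (fun x => (wt b x : ℂ) * f x) 2 halfLine :=
  (memLp_congr_ae h.fst).1 (Lp.memLp _)

theorem IsRep.memLp_deriv {b : ℝ} {f : ℝ → ℂ} {e : ModeSpace b} (h : IsRep b f e) :
    MemLp (fun x => (wt b x : ℂ) * deriv f x) 2 halfLine :=
  (memLp_congr_ae h.snd).1 (Lp.memLp _)

theorem IsRep.integrable_sq {b : ℝ} {f : ℝ → ℂ} {e : ModeSpace b} (h : IsRep b f e) :
    Integrable (fun x => (‖f x‖ ^ 2 + ‖deriv f x‖ ^ 2) * wt b x ^ 2) halfLine := by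
  have h1 := (memLp_two_iff_integrable_sq_norm h.memLp.1).1 h.memLp
  have h2 := (memLp_two_iff_integrable_sq_norm h.memLp_deriv.1).1 h.memLp_deriv
  refine (h1.add h2).congr (Eventually.of_forall fun x => ?_)
  simp only [Pi.add_apply, norm_mul, Complex.norm_real, Real.norm_eq_abs, mul_pow, sq_abs]
  ring

theorem IsRep.norm_sq {b : ℝ} {f : ℝ → ℂ} {e : ModeSpace b} (h : IsRep b f e) :
    ‖e‖ ^ 2 = ∫ x in Ioi (0 : ℝ), (‖f x‖ ^ 2 + ‖deriv f x‖ ^ 2) * wt b x ^ 2 := by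
  have h1 := h.inner_eq h
  rw [inner_self_eq_norm_sq_to_K (𝕜 := ℂ) e] at h1
  have h2 : ∀ x, (f x * conj (f x) + deriv f x * conj (deriv f x)) * ((wt b x ^ 2 : ℝ) : ℂ) =
      (((‖f x‖ ^ 2 + ‖deriv f x‖ ^ 2) * wt b x ^ 2 : ℝ) : ℂ) := fun x => by
    rw [Complex.mul_conj, Complex.mul_conj, Complex.normSq_eq_norm_sq, Complex.normSq_eq_norm_sq]
    push_cast; ring
  simp only [h2] at h1
  rw [integral_complex_ofReal] at h1
  apply Complex.ofReal_injective
  rw [← h1]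
  simp

theorem IsRep.ofReal_norm_sq {b : ℝ} {f : ℝ → ℂ} {e : ModeSpace b} (h : IsRep b f e) :
    ENNReal.ofReal (‖e‖ ^ 2) =
      ∫⁻ x in Ioi (0 : ℝ), ENNReal.ofReal ((‖f x‖ ^ 2 + ‖deriv f x‖ ^ 2) * wt b x ^ 2) := by
  rw [h.norm_sq, ofReal_integral_eq_lintegral_ofReal h.integrable_sq
    (Eventually.of_forall fun x => by positivity)]

/-! ### Pointwise bounds and contractivity of translations in the weighted space -/

theorem setIntegral_norm_le_of_memLp_two {u : ℝ → ℂ} (hu : MemLp u 2 halfLine) {x : ℝ}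
    (hx : 0 ≤ x) : ∫ y in Ioc x (x + 1), ‖u y‖ ≤ (eLpNorm u 2 halfLine).toReal := by
  have hle : volume.restrict (Ioc x (x + 1)) ≤ halfLine :=
    Measure.restrict_mono (fun y hy => hx.trans_lt hy.1) le_rfl
  have : IsProbabilityMeasure (volume.restrict (Ioc x (x + 1))) := ⟨by simp⟩
  have h1 := hu.mono_measure hle
  have h2 : ∫ y in Ioc x (x + 1), ‖u y‖ = (eLpNorm u 1 (volume.restrict (Ioc x (x + 1)))).toReal := by
    rw [eLpNorm_one_eq_lintegral_enorm, integral_norm_eq_lintegral_enorm h1.1]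
  rw [h2]
  refine ENNReal.toReal_mono hu.2.ne ?_
  exact (eLpNorm_le_eLpNorm_of_exponent_le one_le_two h1.1).trans (eLpNorm_mono_measure _ hle)

/-- A weighted Sobolev embedding. The value at `x` is bounded by the mean of `|f|` over `[x, x + 1]`
plus the integral of `|f'|` there; the weight is smallest at the left end, so it can be moved
inside. Each integral costs at most `‖e‖`, whence the factor `2`. -/
theorem IsRep.norm_le {b : ℝ} (hb : 0 ≤ b) {f : ℝ → ℂ} {e : ModeSpace b} (h : IsRep b f e) {x : ℝ}
    (hx : 0 ≤ x) : wt b x * ‖f x‖ ≤ 2 * ‖e‖ := by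
  have hx1 : x ≤ x + 1 := by linarith
  have hd : IntervalIntegrable (fun y => ‖deriv f y‖) volume x (x + 1) :=
    (h.prim.intervalIntegrable hx (by linarith)).norm
  have hc : ContinuousOn f (uIcc x (x + 1)) := h.prim.continuousOn.mono (by
    rw [uIcc_of_le hx1]; exact fun y hy => hx.trans hy.1)
  have hf : IntervalIntegrable (fun y => ‖f y‖) volume x (x + 1) :=
    (hc.norm).intervalIntegrable
  have h1 : ∀ y ∈ Icc x (x + 1), ‖f x‖ ≤ ‖f y‖ + ∫ z in x..(x + 1), ‖deriv f z‖ := by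
    intro y hy
    have e1 : f x = f y - ∫ z in x..y, deriv f z := by
      rw [← h.prim.sub_eq hx (hx.trans hy.1)]; ring
    have e2 : ‖∫ z in x..y, deriv f z‖ ≤ ∫ z in x..(x + 1), ‖deriv f z‖ :=
      (intervalIntegral.norm_integral_le_integral_norm hy.1).trans
        (intervalIntegral.integral_mono_interval le_rfl hy.1 hy.2
          (Eventually.of_forall fun _ => norm_nonneg _) hd)
    calc ‖f x‖ = ‖f y - ∫ z in x..y, deriv f z‖ := by rw [← e1]
      _ ≤ ‖f y‖ + ‖∫ z in x..y, deriv f z‖ := norm_sub_le _ _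
      _ ≤ _ := by gcongr
  have h2 : ‖f x‖ ≤ (∫ y in x..(x + 1), ‖f y‖) + ∫ z in x..(x + 1), ‖deriv f z‖ := by
    have := intervalIntegral.integral_mono_on (μ := volume) hx1 intervalIntegrable_const
      (hf.add intervalIntegrable_const) h1
    rw [intervalIntegral.integral_add hf intervalIntegrable_const] at this
    simpa using this
  have key : ∀ {g : ℝ → ℂ} {u : HalfL2}, IntervalIntegrable (fun y => ‖g y‖) volume x (x + 1) →
      u =ᵐ[halfLine] (fun x => (wt b x : ℂ) * g x) →
      wt b x * ∫ y in x..(x + 1), ‖g y‖ ≤ ‖u‖ := by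
    intro g u hg hu
    rw [← intervalIntegral.integral_const_mul, Lp.norm_def]
    refine le_trans ?_ (setIntegral_norm_le_of_memLp_two (Lp.memLp u) hx)
    rw [intervalIntegral.integral_of_le hx1]
    have hu' : u =ᵐ[volume.restrict (Ioc x (x + 1))] (fun x => (wt b x : ℂ) * g x) :=
      ae_restrict_of_ae_restrict_of_subset (fun y hy => hx.trans_lt hy.1) hu
    refine integral_mono_ae (hg.const_mul _).1 ?_ ?_
    · have : MemLp u 2 (volume.restrict (Ioc x (x + 1))) :=
        (Lp.memLp u).mono_measure (Measure.restrict_mono (fun y hy => hx.trans_lt hy.1) le_rfl)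
      exact (this.integrable one_le_two).norm
    · filter_upwards [hu', ae_restrict_mem measurableSet_Ioc] with y hy hy'
      rw [hy, norm_mul, Complex.norm_real, Real.norm_eq_abs, abs_of_pos (wt_pos b y)]
      exact mul_le_mul_of_nonneg_right (wt_mono hb hx hy'.1.le) (norm_nonneg _)
  have h3 := key hf h.fst
  have h4 := key hd h.snd
  have h5 : ‖e.fst‖ ≤ ‖e‖ := e.norm_fst_le
  have h6 : ‖e.snd‖ ≤ ‖e‖ := e.norm_snd_le
  have h7 := mul_le_mul_of_nonneg_left h2 (wt_pos b x).le
  rw [mul_add] at h7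
  linarith

theorem measurePreserving_add_Ioi (t : ℝ) :
    MeasurePreserving (fun x : ℝ => x + t) halfLine (volume.restrict (Ioi t)) := by
  have := (measurePreserving_add_right (volume : Measure ℝ) t).restrict_preimage
    (s := Ioi t) measurableSet_Ioi
  rwa [show (fun x : ℝ => x + t) ⁻¹' Ioi t = Ioi 0 by ext x; simp] at this

theorem memLp_shift {u v : ℝ → ℂ} {t : ℝ} (ht : 0 ≤ t) (hu : MemLp u 2 halfLine)
    (hv : AEStronglyMeasurable v halfLine) (hvu : ∀ x, 0 < x → ‖v x‖ ≤ ‖u (x + t)‖) :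
    MemLp v 2 halfLine := by
  have h1 : MemLp (fun x => u (x + t)) 2 halfLine := by
    have h2 : MemLp u 2 (volume.restrict (Ioi t)) :=
      hu.mono_measure (Measure.restrict_mono (fun y hy => ht.trans_lt hy) le_rfl)
    exact h2.comp_measurePreserving (measurePreserving_add_Ioi t)
  refine h1.of_le hv ?_
  filter_upwards [ae_restrict_mem measurableSet_Ioi] with x hx using hvu x hx

/-- Translation to the left is a contraction because the weight is increasing and the mass that
leaves through `0` is discarded. -/
theorem IsRep.exists_shift {b : ℝ} (hb : 0 ≤ b) {f : ℝ → ℂ} {e : ModeSpace b} (h : IsRep b f e)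
    {t : ℝ} (ht : 0 ≤ t) : ∃ e', IsRep b (fun x => f (x + t)) e' ∧ ‖e'‖ ≤ ‖e‖ := by
  have hp := h.prim.shift ht
  have hdv : deriv (fun x => f (x + t)) = fun x => deriv f (x + t) := by
    funext x; exact deriv_comp_add_const f t x
  have hp' : IsPrim (fun x => f (x + t)) (deriv fun x => f (x + t)) := by rw [hdv]; exact hp
  have hle : ∀ (g : ℝ → ℂ) x, 0 < x →
      ‖(wt b x : ℂ) * g (x + t)‖ ≤ ‖(wt b (x + t) : ℂ) * g (x + t)‖ := fun g x hx => by
    rw [norm_mul, norm_mul, Complex.norm_real, Complex.norm_real, Real.norm_of_nonneg (wt_pos _ _).le,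
      Real.norm_of_nonneg (wt_pos _ _).le]
    exact mul_le_mul_of_nonneg_right (wt_mono hb hx.le (by linarith)) (norm_nonneg _)
  have hwc : AEStronglyMeasurable (fun x => (wt b x : ℂ)) halfLine :=
    (Complex.continuous_ofReal.comp (continuous_wt b)).aestronglyMeasurable
  have m1 : AEStronglyMeasurable (fun x => f (x + t)) halfLine :=
    (hp.continuousOn.mono Ioi_subset_Ici_self).aestronglyMeasurable measurableSet_Ioi
  have m2 : AEStronglyMeasurable (fun x => deriv f (x + t)) halfLine := by
    rw [← hdv]; exact (measurable_deriv _).aestronglyMeasurable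
  have l1 := memLp_shift ht h.memLp (hwc.mul m1) (hle f)
  have l2 := memLp_shift ht h.memLp_deriv (hwc.mul m2) (hle (deriv f))
  obtain ⟨e', he'⟩ := exists_modeSpace hp' l1 (by rw [hdv]; exact l2)
  refine ⟨e', he', ?_⟩
  rw [← abs_of_nonneg (norm_nonneg e'), ← abs_of_nonneg (norm_nonneg e), ← sq_le_sq, he'.norm_sq,
    h.norm_sq]
  have hs := h.integrable_sq
  calc ∫ x in Ioi (0 : ℝ), (‖f (x + t)‖ ^ 2 + ‖deriv (fun x => f (x + t)) x‖ ^ 2) * wt b x ^ 2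
      ≤ ∫ x in Ioi (0 : ℝ), (‖f (x + t)‖ ^ 2 + ‖deriv f (x + t)‖ ^ 2) * wt b (x + t) ^ 2 := by
        rw [hdv]
        refine setIntegral_mono_on ?_ ?_ measurableSet_Ioi fun x hx => ?_
        · have := he'.integrable_sq; rwa [hdv] at this
        · have h1 : IntegrableOn (fun x => (‖f x‖ ^ 2 + ‖deriv f x‖ ^ 2) * wt b x ^ 2) (Ioi t) :=
            IntegrableOn.mono_set hs (Ioi_subset_Ioi ht)
          exact (measurePreserving_add_Ioi t).integrable_comp_of_integrable h1
        · have := wt_mono hb (le_of_lt hx) (by linarith : x ≤ x + t)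
          have := (wt_pos b x).le
          gcongr
    _ = ∫ x in Ioi t, (‖f x‖ ^ 2 + ‖deriv f x‖ ^ 2) * wt b x ^ 2 := by
        exact (measurePreserving_add_Ioi t).integral_comp (measurableEmbedding_addRight t)
          fun x => (‖f x‖ ^ 2 + ‖deriv f x‖ ^ 2) * wt b x ^ 2
    _ ≤ _ := setIntegral_mono_set hs (Eventually.of_forall fun x => by positivity)
        (Ioi_subset_Ioi ht).eventuallyLE

/-! ### Functionals and translations on the space of a single mode -/

/-- The absolutely continuous representative of an element of `ModeSpace b`. -/
noncomputable def rep {b : ℝ} (e : ModeSpace b) : ℝ → ℂ := (exists_isRep e).choose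

theorem isRep_rep {b : ℝ} (e : ModeSpace b) : IsRep b (rep e) e := (exists_isRep e).choose_spec

theorem rep_add {b : ℝ} (e e' : ModeSpace b) {x : ℝ} (hx : 0 ≤ x) :
    rep (e + e') x = rep e x + rep e' x :=
  (isRep_rep (e + e')).eqOn ((isRep_rep e).add (isRep_rep e')) hx

theorem rep_smul {b : ℝ} (c : ℂ) (e : ModeSpace b) {x : ℝ} (hx : 0 ≤ x) :
    rep (c • e) x = c * rep e x :=
  (isRep_rep (c • e)).eqOn ((isRep_rep e).smul c) hx

theorem norm_rep_le {b : ℝ} (hb : 0 ≤ b) (e : ModeSpace b) {x : ℝ} (hx : 0 ≤ x) :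
    ‖rep e x‖ ≤ 2 * ‖e‖ :=
  (le_mul_of_one_le_left (norm_nonneg _) (one_le_wt hb x)).trans ((isRep_rep e).norm_le hb hx)

/-- Evaluation of a mode at a point. -/
noncomputable def evalL {b : ℝ} (hb : 0 ≤ b) {x : ℝ} (hx : 0 ≤ x) : ModeSpace b →L[ℂ] ℂ :=
  LinearMap.mkContinuous
    { toFun := fun e => rep e x
      map_add' := fun e e' => rep_add e e' hx
      map_smul' := fun c e => rep_smul c e hx } 2 fun e => norm_rep_le hb e hx

/-- Translation to the left by `t ≥ 0`. -/
noncomputable def shiftL {b : ℝ} (hb : 0 ≤ b) {t : ℝ} (ht : 0 ≤ t) :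
    ModeSpace b →L[ℂ] ModeSpace b :=
  LinearMap.mkContinuous
    { toFun := fun e => ((isRep_rep e).exists_shift hb ht).choose
      map_add' := fun e e' => by
        refine ((isRep_rep (e + e')).exists_shift hb ht).choose_spec.1.eq_of_eqOn
          (((isRep_rep e).exists_shift hb ht).choose_spec.1.add
            ((isRep_rep e').exists_shift hb ht).choose_spec.1) fun x hx => ?_
        exact rep_add e e' (add_nonneg hx ht)
      map_smul' := fun c e => by
        refine ((isRep_rep (c • e)).exists_shift hb ht).choose_spec.1.eq_of_eqOn
          (((isRep_rep e).exists_shift hb ht).choose_spec.1.smul c) fun x hx => ?_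
        exact rep_smul c e (add_nonneg hx ht) } 1 fun e => by
    rw [one_mul]; exact ((isRep_rep e).exists_shift hb ht).choose_spec.2

theorem isRep_shiftL {b : ℝ} (hb : 0 ≤ b) {t : ℝ} (ht : 0 ≤ t) (e : ModeSpace b) :
    IsRep b (fun x => rep e (x + t)) (shiftL hb ht e) :=
  ((isRep_rep e).exists_shift hb ht).choose_spec.1

theorem norm_shiftL_le {b : ℝ} (hb : 0 ≤ b) {t : ℝ} (ht : 0 ≤ t) (e : ModeSpace b) :
    ‖shiftL hb ht e‖ ≤ ‖e‖ :=
  ((isRep_rep e).exists_shift hb ht).choose_spec.2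

theorem rep_shiftL {b : ℝ} (hb : 0 ≤ b) {t : ℝ} (ht : 0 ≤ t) (e : ModeSpace b) {x : ℝ}
    (hx : 0 ≤ x) : rep (shiftL hb ht e) x = rep e (x + t) :=
  (isRep_rep _).eqOn (isRep_shiftL hb ht e) hx

theorem integrable_rep_mul {b : ℝ} (e : ModeSpace b) {ψ : ℝ → ℝ}
    (hψ : Continuous ψ) (hc : HasCompactSupport ψ) :
    Integrable (fun x => rep e x * (ψ x : ℂ)) halfLine := by
  obtain ⟨R, hR⟩ := hc.isCompact.isBounded.subset_closedBall (0 : ℝ)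
  have hR' : ∀ x, |R| + 1 < x → ψ x = 0 := fun x hx => image_eq_zero_of_notMem_tsupport fun hx' => by
    have := hR hx'
    rw [Metric.mem_closedBall, dist_zero_right, Real.norm_eq_abs] at this
    linarith [le_abs_self x, le_abs_self R]
  have h1 : IntegrableOn (fun x => rep e x * (ψ x : ℂ)) (Ioc 0 (|R| + 1)) := by
    refine (ContinuousOn.integrableOn_Icc (ContinuousOn.mul ?_ ?_)).mono_set Ioc_subset_Icc_self
    · exact (isRep_rep e).prim.continuousOn.mono Icc_subset_Ici_self
    · exact (Complex.continuous_ofReal.comp hψ).continuousOn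
  refine h1.of_forall_sdiff_eq_zero measurableSet_Ioi fun x hx => ?_
  rw [hR' x (by by_contra hh; exact hx.2 ⟨hx.1, not_lt.1 hh⟩)]
  simp

/-- Integration of a mode against a continuous function with compact support. -/
noncomputable def testL {b : ℝ} (hb : 0 ≤ b) {ψ : ℝ → ℝ} (hψ : Continuous ψ)
    (hc : HasCompactSupport ψ) : ModeSpace b →L[ℂ] ℂ :=
  LinearMap.mkContinuous
    { toFun := fun e => ∫ x in Ioi (0 : ℝ), rep e x * (ψ x : ℂ)
      map_add' := fun e e' => by
        rw [← integral_add (integrable_rep_mul e hψ hc) (integrable_rep_mul e' hψ hc)]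
        refine setIntegral_congr_fun measurableSet_Ioi fun x hx => ?_
        simp only [rep_add e e' (le_of_lt hx)]; ring
      map_smul' := fun c e => by
        rw [RingHom.id_apply, smul_eq_mul, ← integral_const_mul]
        refine setIntegral_congr_fun measurableSet_Ioi fun x hx => ?_
        simp only [rep_smul c e (le_of_lt hx)]; ring } (2 * ∫ x, |ψ x|) fun e => by
    have hi : Integrable (fun x => |ψ x|) := (hψ.integrable_of_hasCompactSupport hc).abs
    have h1 : ‖∫ x in Ioi (0 : ℝ), rep e x * (ψ x : ℂ)‖ ≤
        ∫ x in Ioi (0 : ℝ), 2 * ‖e‖ * |ψ x| := by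
      refine norm_integral_le_of_norm_le (hi.restrict.const_mul _) ?_
      filter_upwards [ae_restrict_mem measurableSet_Ioi] with x hx
      rw [norm_mul, Complex.norm_real, Real.norm_eq_abs]
      exact mul_le_mul_of_nonneg_right (norm_rep_le hb e (le_of_lt hx)) (abs_nonneg _)
    refine h1.trans ?_
    rw [integral_const_mul]
    have h2 : ∫ x in Ioi (0 : ℝ), |ψ x| ≤ ∫ x, |ψ x| :=
      setIntegral_le_integral hi (Eventually.of_forall fun x => abs_nonneg _)
    nlinarith [norm_nonneg e]

theorem testL_apply {b : ℝ} (hb : 0 ≤ b) {ψ : ℝ → ℝ} (hψ : Continuous ψ)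
    (hc : HasCompactSupport ψ) (e : ModeSpace b) :
    testL hb hψ hc e = ∫ x in Ioi (0 : ℝ), rep e x * (ψ x : ℂ) := rfl

theorem norm_testL_le {b : ℝ} (hb : 0 ≤ b) {ψ : ℝ → ℝ} (hψ : Continuous ψ)
    (hc : HasCompactSupport ψ) : ‖testL hb hψ hc‖ ≤ 2 * ∫ x, |ψ x| :=
  LinearMap.mkContinuous_norm_le _ (mul_nonneg zero_le_two (integral_nonneg fun _ => abs_nonneg _)) _

theorem hasCompactSupport_translate {ψ : ℝ → ℝ} (hc : HasCompactSupport ψ) (t : ℝ) :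
    HasCompactSupport fun x => ψ (x - t) :=
  hc.comp_homeomorph (Homeomorph.subRight t)

/-- Integration of a mode against the translate `x ↦ ψ (x - t)`. -/
noncomputable def translateL {b : ℝ} (hb : 0 ≤ b) {ψ : ℝ → ℝ} (hψ : Continuous ψ)
    (hc : HasCompactSupport ψ) (t : ℝ) : ModeSpace b →L[ℂ] ℂ :=
  testL hb (hψ.comp (continuous_id.sub continuous_const)) (hasCompactSupport_translate hc t)

theorem translateL_apply {b : ℝ} (hb : 0 ≤ b) {ψ : ℝ → ℝ} (hψ : Continuous ψ)
    (hc : HasCompactSupport ψ) (t : ℝ) (e : ModeSpace b) :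
    translateL hb hψ hc t e = ∫ x in Ioi (0 : ℝ), rep e x * (ψ (x - t) : ℂ) := rfl

theorem translateL_zero {b : ℝ} (hb : 0 ≤ b) {ψ : ℝ → ℝ} (hψ : Continuous ψ)
    (hc : HasCompactSupport ψ) : translateL hb hψ hc 0 = testL hb hψ hc := by
  ext e; rw [translateL_apply, testL_apply]; simp

/-- After the change of variables the integral runs over `(t, ∞)` only, but the translated test
function vanishes on `(0, t]`, so nothing is lost. -/
theorem testL_shiftL {b : ℝ} (hb : 0 ≤ b) {ψ : ℝ → ℝ} (h : IsTest ψ) {t : ℝ} (ht : 0 ≤ t)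
    (e : ModeSpace b) :
    testL hb h.continuous h.compact (shiftL hb ht e) =
      translateL hb h.continuous h.compact t e := by
  rw [testL_apply, translateL_apply]
  have h1 : ∫ x in Ioi (0 : ℝ), rep (shiftL hb ht e) x * (ψ x : ℂ) =
      ∫ x in Ioi (0 : ℝ), rep e (x + t) * (ψ (x + t - t) : ℂ) := by
    refine setIntegral_congr_fun measurableSet_Ioi fun x hx => ?_
    simp only [rep_shiftL hb ht e (le_of_lt hx), add_sub_cancel_right]
  rw [h1, (measurePreserving_add_Ioi t).integral_comp (measurableEmbedding_addRight t)
    fun x => rep e x * (ψ (x - t) : ℂ)]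
  refine (setIntegral_eq_of_subset_of_forall_sdiff_eq_zero measurableSet_Ioi (Ioi_subset_Ioi ht)
    fun x hx => ?_).symm
  rw [image_eq_zero_of_notMem_tsupport (f := ψ) fun hx' => hx.2 ?_]
  · simp
  · have : 0 < x - t := h.supp hx'
    exact mem_Ioi.2 (by linarith)

theorem eq_zero_of_testL {b : ℝ} (hb : 0 ≤ b) (e : ModeSpace b)
    (h : ∀ ψ (hψ : IsTest ψ), testL hb hψ.continuous hψ.compact e = 0) : e = 0 := by
  have h1 : ∀ᵐ x : ℝ, x ∈ Ioi (0 : ℝ) → rep e x = 0 := by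
    refine isOpen_Ioi.ae_eq_zero_of_integral_contDiff_smul_eq_zero ?_ ?_
    · exact ((isRep_rep e).prim.continuousOn.mono Ioi_subset_Ici_self).locallyIntegrableOn
        measurableSet_Ioi
    · intro ψ h1 h2 h3
      have h4 := h ψ ⟨h1, h2, h3⟩
      rw [testL_apply] at h4
      rw [← setIntegral_eq_integral_of_forall_compl_eq_zero (s := Ioi 0), ← h4]
      · simp only [Complex.real_smul, mul_comm]
      · intro x hx
        rw [image_eq_zero_of_notMem_tsupport fun hx' => hx (h3 hx'), zero_smul]
  have h2 : EqOn (rep e) 0 (Ici 0) := by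
    refine eqOn_of_ae_eq_halfLine (isRep_rep e).prim.continuousOn continuousOn_const ?_
    rw [EventuallyEq, ae_restrict_iff' measurableSet_Ioi]
    exact h1
  have h3 := (isRep_rep e).smul 0
  rw [zero_smul, zero_smul] at h3
  exact (isRep_rep e).eq_of_eqOn h3 h2

/-! ### Differentiability of translated test functionals -/

theorem exists_taylor_bound {ψ : ℝ → ℝ} (h : IsTest ψ) :
    ∃ C, 0 ≤ C ∧ ∀ s, |s| ≤ 1 →
      ∫ x, |ψ (x - s) - ψ x + s * deriv ψ x| ≤ C * s ^ 2 := by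
  obtain ⟨a, R, ha, haR, hs⟩ := h.exists_Icc
  have hd : ∀ x, x ∉ Icc a R → deriv ψ x = 0 := fun x hx => by
    have hx' : ∀ᶠ y in 𝓝 x, ψ y = (fun _ => (0 : ℝ)) y := by
      filter_upwards [isClosed_Icc.isOpen_compl.mem_nhds hx] with y hy using hs y hy
    rw [EventuallyEq.deriv_eq hx', deriv_const]
  obtain ⟨M, hM⟩ := (h.deriv.compact.deriv).exists_bound_of_continuous h.deriv.deriv.continuous
  have hM0 : 0 ≤ M := (norm_nonneg _).trans (hM 0)
  have hdiff : ∀ x, HasDerivAt ψ (deriv ψ x) x := fun x =>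
    (h.smooth.differentiable (by simp)).differentiableAt.hasDerivAt
  have hdiff' : ∀ x, HasDerivAt (deriv ψ) (deriv (deriv ψ) x) x := fun x =>
    (h.deriv.smooth.differentiable (by simp)).differentiableAt.hasDerivAt
  have hlip : ∀ x y, |deriv ψ x - deriv ψ y| ≤ M * |x - y| := fun x y => by
    have := Convex.norm_image_sub_le_of_norm_hasDerivWithin_le (s := univ)
      (fun z _ => (hdiff' z).hasDerivWithinAt) (fun z _ => hM z) convex_univ (mem_univ y)
      (mem_univ x)
    simpa using this
  -- Mean value inequality for `r ↦ ψ(x - r) + r ψ'(x)`, whose derivative is at most `M |s|` between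
  -- `0` and `s` by the Lipschitz bound on `ψ'`.
  have hb : ∀ s x, |ψ (x - s) - ψ x + s * deriv ψ x| ≤ M * s ^ 2 := fun s x => by
    have hg : ∀ r ∈ uIcc 0 s, HasDerivWithinAt (fun r => ψ (x - r) + r * deriv ψ x)
        (-deriv ψ (x - r) + deriv ψ x) (uIcc 0 s) r := fun r _ => by
      have h1 : HasDerivAt (fun r => ψ (x - r)) (-deriv ψ (x - r)) r := by
        have := (hdiff (x - r)).comp r ((hasDerivAt_id' r).const_sub x)
        rwa [mul_neg_one] at this
      have h2 : HasDerivAt (fun r => r * deriv ψ x) (deriv ψ x) r := by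
        simpa using (hasDerivAt_id r).mul_const (deriv ψ x)
      exact (h1.add h2).hasDerivWithinAt
    have := Convex.norm_image_sub_le_of_norm_hasDerivWithin_le (C := M * |s|) hg
      (fun r hr => by
        rw [neg_add_eq_sub, Real.norm_eq_abs]
        refine (hlip _ _).trans (mul_le_mul_of_nonneg_left ?_ hM0)
        rw [sub_sub_cancel]
        rcases le_total 0 s with h0 | h0
        · rw [uIcc_of_le h0] at hr; rw [abs_of_nonneg hr.1, abs_of_nonneg h0]; exact hr.2
        · rw [uIcc_of_ge h0] at hr; rw [abs_of_nonpos hr.2, abs_of_nonpos h0]; linarith [hr.1])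
      (convex_uIcc 0 s) left_mem_uIcc right_mem_uIcc
    simp only [sub_zero, zero_mul, add_zero, Real.norm_eq_abs] at this
    calc _ = |ψ (x - s) + s * deriv ψ x - ψ x| := by congr 1; ring
      _ ≤ M * |s| * |s| := this
      _ = M * s ^ 2 := by rw [mul_assoc, ← sq, sq_abs]
  -- For `|s| ≤ 1` the remainder lives on `[a - 1, R + 1]`, an interval of length `R - a + 2`.
  refine ⟨M * (R - a + 2), by nlinarith, fun s hs1 => ?_⟩
  have hz : ∀ x, x ∉ Icc (a - 1) (R + 1) → |ψ (x - s) - ψ x + s * deriv ψ x| = 0 := fun x hx => by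
    rw [abs_le] at hs1
    have n1 : x ∉ Icc a R := fun hx' => hx ⟨by linarith [hx'.1], by linarith [hx'.2]⟩
    have n2 : x - s ∉ Icc a R := fun hx' => hx ⟨by linarith [hx'.1], by linarith [hx'.2]⟩
    rw [hs _ n1, hs _ n2, hd _ n1]; simp
  rw [← setIntegral_eq_integral_of_forall_compl_eq_zero hz]
  have := norm_setIntegral_le_of_norm_le_const (μ := volume) (s := Icc (a - 1) (R + 1))
    (C := M * s ^ 2) (f := fun x => |ψ (x - s) - ψ x + s * deriv ψ x|)
    (by simp) (fun x _ => by simpa using hb s x)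
  refine (le_abs_self _).trans (this.trans (le_of_eq ?_))
  rw [Measure.real, Real.volume_Icc, ENNReal.toReal_ofReal (by linarith)]
  ring

/-- The functional norm is controlled by the `L¹` norm of the test function, and the Taylor
remainder is quadratically small in `L¹`. The derivative thus exists in the norm of the dual, which
allows the functionals to be combined with curves that are only weakly differentiable. -/
theorem hasDerivAt_translateL {b : ℝ} (hb : 0 ≤ b) {ψ : ℝ → ℝ} (h : IsTest ψ) (t : ℝ) :
    HasDerivAt (translateL hb h.continuous h.compact)
      (-translateL hb h.deriv.continuous h.deriv.compact t) t := by
  obtain ⟨C, hC0, hC⟩ := exists_taylor_bound h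
  rw [hasDerivAt_iff_isLittleO_nhds_zero]
  have key : ∀ s, |s| ≤ 1 → ‖translateL hb h.continuous h.compact (t + s) -
      translateL hb h.continuous h.compact t -
      s • -translateL hb h.deriv.continuous h.deriv.compact t‖ ≤ 2 * C * s ^ 2 := by
    intro s hs
    have c1 : Continuous fun x => ψ (x - (t + s)) - ψ (x - t) + s * deriv ψ (x - t) := by
      have := h.continuous; have := h.deriv.continuous; fun_prop
    have c2 : HasCompactSupport fun x => ψ (x - (t + s)) - ψ (x - t) + s * deriv ψ (x - t) :=
      ((hasCompactSupport_translate h.compact _).sub (hasCompactSupport_translate h.compact _)).add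
        ((hasCompactSupport_translate h.deriv.compact t).mul_left (f := fun _ => s))
    have e1 : translateL hb h.continuous h.compact (t + s) -
        translateL hb h.continuous h.compact t -
        s • -translateL hb h.deriv.continuous h.deriv.compact t = testL hb c1 c2 := by
      ext e
      simp only [_root_.sub_apply, _root_.smul_apply,
        _root_.neg_apply, translateL_apply, testL_apply]
      have i1 := integrable_rep_mul e (h.continuous.comp (continuous_id.sub continuous_const))
        (hasCompactSupport_translate h.compact (t + s))
      have i2 := integrable_rep_mul e (h.continuous.comp (continuous_id.sub continuous_const))
        (hasCompactSupport_translate h.compact t)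
      have i3 := integrable_rep_mul e (h.deriv.continuous.comp (continuous_id.sub continuous_const))
        (hasCompactSupport_translate h.deriv.compact t)
      simp only [Function.comp] at i1 i2 i3
      rw [smul_neg, sub_neg_eq_add, Complex.real_smul, ← integral_const_mul]
      erw [← integral_sub i1 i2, ← integral_add (i1.sub i2) (i3.const_mul _)]
      refine integral_congr_ae (Eventually.of_forall fun x => ?_)
      simp only [Pi.sub_apply, id]
      push_cast; ring
    rw [e1]
    refine (norm_testL_le hb c1 c2).trans ?_
    have e2 : ∫ x, |ψ (x - (t + s)) - ψ (x - t) + s * deriv ψ (x - t)| =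
        ∫ x, |ψ (x - s) - ψ x + s * deriv ψ x| := by
      rw [← integral_sub_right_eq_self (fun x => |ψ (x - s) - ψ x + s * deriv ψ x|) t]
      simp only [sub_sub]
    rw [e2]
    linarith [hC s hs]
  refine Asymptotics.IsBigO.trans_isLittleO (g := fun s : ℝ => s ^ 2) ?_ ?_
  · refine Asymptotics.IsBigO.of_bound (2 * C) ?_
    filter_upwards [Metric.closedBall_mem_nhds (0 : ℝ) one_pos] with s hs
    rw [Real.norm_eq_abs, abs_of_nonneg (sq_nonneg s)]
    exact key s (by simpa using hs)
  · simpa using Asymptotics.isLittleO_pow_id (one_lt_two : 1 < 2) (𝕜 := ℝ)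

/-! ### The Hilbert space of states -/

/-- The Hilbert space of states with weight `b`; the coordinate with index `m` is
`u_{m+1} / √(m+1)`. -/
noncomputable abbrev StateSpace (b : ℝ) := lp (fun _ : ℕ => ModeSpace b) 2

/-- `√(m+1)`. -/
noncomputable def rt (m : ℕ) : ℝ := Real.sqrt ((m : ℝ) + 1)

theorem rt_pos (m : ℕ) : 0 < rt m := Real.sqrt_pos.2 (by positivity)

theorem rt_sq (m : ℕ) : rt m ^ 2 = (m : ℝ) + 1 := Real.sq_sqrt (by positivity)

theorem rt_ne_zero (m : ℕ) : (rt m : ℂ) ≠ 0 := by exact_mod_cast (rt_pos m).ne'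

/-- `x` is the element of the state space with components `u`. -/
def IsState (b : ℝ) (u : ℕ → ℝ → ℂ) (x : StateSpace b) : Prop :=
  ∀ m, IsRep b ((rt m : ℂ)⁻¹ • u (m + 1)) (x m)

theorem norm_sq_stateSpace {b : ℝ} (x : StateSpace b) : HasSum (fun m => ‖x m‖ ^ 2) (‖x‖ ^ 2) := by
  have := lp.hasSum_norm (p := 2) (by simp) x
  simpa using this

theorem weight_term {b : ℝ} (u : ℝ → ℂ) (m : ℕ) {ξ : ℝ} (hξ : 0 < ξ) :
    (‖u ξ‖ ^ 2 + ‖deriv u ξ‖ ^ 2) * weight b ξ ^ 2 * ((m : ℝ) + 1) ^ (2 * (-1 / 2) : ℝ) =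
      (‖((rt m : ℂ)⁻¹ • u) ξ‖ ^ 2 + ‖deriv ((rt m : ℂ)⁻¹ • u) ξ‖ ^ 2) * wt b ξ ^ 2 := by
  rw [deriv_const_smul_field, Pi.smul_apply, smul_eq_mul, smul_eq_mul, norm_mul, norm_mul, norm_inv,
    Complex.norm_real, Real.norm_of_nonneg (rt_pos m).le, mul_pow, mul_pow, inv_pow, rt_sq,
    wt_eq_weight hξ.le, show (2 * (-1 / 2) : ℝ) = -1 by norm_num, Real.rpow_neg_one]
  ring

theorem xNormSq_eq_tsum (b : ℝ) (u : ℕ → ℝ → ℂ) :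
    xNormSq (weight b) (-1 / 2) u = ∑' m : ℕ, ∫⁻ ξ in Ioi (0 : ℝ),
      ENNReal.ofReal ((‖((rt m : ℂ)⁻¹ • u (m + 1)) ξ‖ ^ 2 +
        ‖deriv ((rt m : ℂ)⁻¹ • u (m + 1)) ξ‖ ^ 2) * wt b ξ ^ 2) := by
  unfold xNormSq
  congr 1; ext m
  refine setLIntegral_congr_fun measurableSet_Ioi fun ξ hξ => ?_
  simp only [weight_term (u (m + 1)) m hξ]

theorem IsState.xNormSq_eq {b : ℝ} {u : ℕ → ℝ → ℂ} {x : StateSpace b} (h : IsState b u x) :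
    xNormSq (weight b) (-1 / 2) u = ENNReal.ofReal (‖x‖ ^ 2) := by
  rw [xNormSq_eq_tsum, ← (norm_sq_stateSpace x).tsum_eq,
    ENNReal.ofReal_tsum_of_nonneg (fun m => sq_nonneg _) (norm_sq_stateSpace x).summable]
  congr 1; ext m
  rw [(h m).ofReal_norm_sq]

theorem IsState.prim {b : ℝ} {u : ℕ → ℝ → ℂ} {x : StateSpace b} (h : IsState b u x) (m : ℕ) :
    IsPrim (u (m + 1)) (deriv (u (m + 1))) := by
  have h1 := (h m).prim.smul (rt m : ℂ)
  rw [smul_inv_smul₀ (rt_ne_zero m)] at h1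
  exact h1.congr_ae h1.deriv_ae.symm

theorem IsState.memXp {b : ℝ} {u : ℕ → ℝ → ℂ} {x : StateSpace b} (h : IsState b u x) :
    MemXp b u := by
  refine ⟨fun ℓ hℓ R hR => ?_, by rw [h.xNormSq_eq]; exact ENNReal.ofReal_lt_top⟩
  obtain ⟨m, rfl⟩ : ∃ m, ℓ = m + 1 := ⟨ℓ - 1, by omega⟩
  exact (h.prim m).ac R hR

theorem aestronglyMeasurable_wt_mul {b : ℝ} {f : ℝ → ℂ} (hf : AEStronglyMeasurable f halfLine) :
    AEStronglyMeasurable (fun x => (wt b x : ℂ) * f x) halfLine :=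
  (Complex.continuous_ofReal.comp (continuous_wt b)).aestronglyMeasurable.mul hf

theorem memLp_two_of_lintegral {b : ℝ} {f : ℝ → ℂ} {G : ℝ → ℝ}
    (hf : AEStronglyMeasurable f halfLine)
    (hle : ∀ x, ‖f x‖ ^ 2 * wt b x ^ 2 ≤ G x)
    (hG : ∫⁻ x in Ioi (0 : ℝ), ENNReal.ofReal (G x) < ⊤) :
    MemLp (fun x => (wt b x : ℂ) * f x) 2 halfLine := by
  have hm := aestronglyMeasurable_wt_mul (b := b) hf
  rw [memLp_two_iff_integrable_sq_norm hm]
  refine ⟨hm.norm.pow 2, ?_⟩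
  rw [hasFiniteIntegral_iff_ofReal (Eventually.of_forall fun x => sq_nonneg _)]
  refine lt_of_le_of_lt (lintegral_mono fun x => ENNReal.ofReal_le_ofReal ?_) hG
  rw [norm_mul, Complex.norm_real, Real.norm_of_nonneg (wt_pos b x).le, mul_pow, mul_comm]
  exact hle x

theorem MemXp.exists_isState {b : ℝ} {u : ℕ → ℝ → ℂ} (h : MemXp b u) : ∃ x, IsState b u x := by
  have hfin := h.2
  rw [xNormSq_eq_tsum] at hfin
  have hE : ∀ m, ∃ e, IsRep b ((rt m : ℂ)⁻¹ • u (m + 1)) e := fun m => by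
    have hp := (IsPrim.of_ac (h.1 (m + 1) (by omega))).smul (rt m : ℂ)⁻¹
    have hp' := hp.congr_ae hp.deriv_ae.symm
    have hf := lt_of_le_of_lt (ENNReal.le_tsum m) hfin
    refine exists_modeSpace hp' (memLp_two_of_lintegral ?_ (fun x => ?_) hf)
      (memLp_two_of_lintegral ?_ (fun x => ?_) hf)
    · exact (hp.continuousOn.mono Ioi_subset_Ici_self).aestronglyMeasurable measurableSet_Ioi
    · exact mul_le_mul_of_nonneg_right (le_add_of_nonneg_right (by positivity)) (by positivity)
    · exact (measurable_deriv _).aestronglyMeasurable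
    · exact mul_le_mul_of_nonneg_right (le_add_of_nonneg_left (by positivity)) (by positivity)
  choose e he using hE
  have hs : Summable fun m => ‖e m‖ ^ 2 := by
    have h1 : ∑' m, ENNReal.ofReal (‖e m‖ ^ 2) ≠ ⊤ := by
      refine ne_of_lt (lt_of_eq_of_lt ?_ hfin)
      congr 1; ext m; exact (he m).ofReal_norm_sq
    have h2 := ENNReal.summable_toReal h1
    exact h2.congr fun m => ENNReal.toReal_ofReal (sq_nonneg _)
  refine ⟨⟨e, memℓp_gen (by simpa using hs)⟩, he⟩

theorem exists_isState_of_stateSpace {b : ℝ} (x : StateSpace b) : ∃ u, IsState b u x := by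
  refine ⟨fun ℓ => (rt (ℓ - 1) : ℂ) • rep (x (ℓ - 1)), fun m => ?_⟩
  simp only [Nat.add_sub_cancel]
  rw [inv_smul_smul₀ (rt_ne_zero m)]
  exact isRep_rep _

/-- The arguments are exchanged because `xInner` is linear in its first argument, where `inner` is
conjugate linear. -/
theorem IsState.xInner_eq {b : ℝ} {u h : ℕ → ℝ → ℂ} {x y : StateSpace b} (hu : IsState b u x)
    (hh : IsState b h y) : xInner (weight b) (-1 / 2) u h = inner ℂ y x := by
  rw [lp.inner_eq_tsum]
  unfold xInner
  congr 1; ext m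
  rw [(hu m).inner_eq (hh m)]
  refine setIntegral_congr_fun measurableSet_Ioi fun ξ hξ => ?_
  simp only [deriv_const_smul_field, Pi.smul_apply, smul_eq_mul, map_mul, map_inv₀,
    Complex.conj_ofReal, wt_eq_weight (le_of_lt hξ)]
  rw [show (2 * (-1 / 2) : ℝ) = -1 by norm_num, Real.rpow_neg_one, ← rt_sq m]
  push_cast
  ring

theorem IsState.rep_eq {b : ℝ} {u : ℕ → ℝ → ℂ} {x : StateSpace b} (h : IsState b u x) (m : ℕ)
    {ξ : ℝ} (hξ : 0 ≤ ξ) : u (m + 1) ξ = rt m * rep (x m) ξ := by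
  rw [(isRep_rep (x m)).eqOn (h m) hξ, Pi.smul_apply, smul_eq_mul,
    mul_inv_cancel_left₀ (rt_ne_zero m)]

/-! ### Weak limits of dissipative evolutions -/

section Abstract

variable {H : Type*} [NormedAddCommGroup H] [InnerProductSpace ℂ H] [CompleteSpace H]

/-- The Banach-Alaoglu theorem, transported by the Riesz isomorphism; the latter is conjugate
linear, which accounts for the conjugations. One fixed ultrafilter yields limits for all times at
once, without extracting subsequences. -/
theorem exists_weak_ultralimit (𝒰 : Ultrafilter ℕ) (y : ℕ → H) {C : ℝ} (hy : ∀ n, ‖y n‖ ≤ C) :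
    ∃ w : H, ‖w‖ ≤ C ∧ ∀ G : H →L[ℂ] ℂ, Tendsto (fun n => G (y n)) 𝒰 (𝓝 (G w)) := by
  have hc := WeakDual.isCompact_closedBall (𝕜 := ℂ) (0 : StrongDual ℂ H) C
  let z : ℕ → WeakDual ℂ H := fun n => StrongDual.toWeakDual (InnerProductSpace.toDual ℂ H (y n))
  have hz : ∀ n, z n ∈
      (WeakDual.toStrongDual : WeakDual ℂ H ≃ₗ[ℂ] StrongDual ℂ H) ⁻¹' Metric.closedBall (0 : StrongDual ℂ H) C := by
    intro n
    simp only [z, mem_preimage, Metric.mem_closedBall, dist_zero_right]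
    exact ((InnerProductSpace.toDual ℂ H).norm_map (y n)).le.trans (hy n)
  obtain ⟨φ, hφ, hle⟩ := hc.ultrafilter_le_nhds (𝒰.map z)
    (by
      rw [le_principal_iff]
      exact Filter.mem_map.2 (Eventually.of_forall hz))
  refine ⟨(InnerProductSpace.toDual ℂ H).symm (WeakDual.toStrongDual φ), ?_, fun G => ?_⟩
  · rw [LinearIsometryEquiv.norm_map]
    simpa using hφ
  · obtain ⟨g, rfl⟩ := (InnerProductSpace.toDual ℂ H).surjective G
    have h1 : Tendsto (fun n => z n g) 𝒰 (𝓝 (φ g)) :=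
      ((WeakDual.eval_continuous g).tendsto φ).comp (tendsto_iff_comap.2 (map_le_iff_le_comap.1 hle))
    have h2 := (Complex.continuous_conj.tendsto _).comp h1
    have e1 : ∀ n, (InnerProductSpace.toDual ℂ H g) (y n) = conj (z n g) := fun n => by
      simp only [z]
      exact (inner_conj_symm (𝕜 := ℂ) g (y n)).symm
    have e2 : (InnerProductSpace.toDual ℂ H g)
        ((InnerProductSpace.toDual ℂ H).symm (WeakDual.toStrongDual φ)) = conj (φ g) := by
      rw [InnerProductSpace.toDual_apply_apply, ← inner_conj_symm, InnerProductSpace.toDual_symm_apply]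
      rfl
    rw [e2]
    exact h2.congr fun n => (e1 n).symm

/-- A property of functionals which is linear and stable under norm limits holds everywhere if it
holds on a separating set. -/
theorem dual_induction {S : Set (H →L[ℂ] ℂ)} (hsep : ∀ x, (∀ F ∈ S, F x = 0) → x = 0)
    {P : (H →L[ℂ] ℂ) → Prop} (hmem : ∀ F ∈ S, P F) (h0 : P 0) (hadd : ∀ F G, P F → P G → P (F + G))
    (hsmul : ∀ (c : ℂ) F, P F → P (c • F))
    (hclosed : ∀ G, (∀ ε : ℝ, 0 < ε → ∃ F, P F ∧ ‖G - F‖ < ε) → P G) (G : H →L[ℂ] ℂ) : P G := by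
  let Φ := InnerProductSpace.toDual ℂ H
  -- A vector orthogonal to all Riesz representatives of `S` is annihilated by `S`, hence zero; the
  -- representatives therefore span a dense subspace.
  have hd : (Submodule.span ℂ {f : H | Φ f ∈ S}).topologicalClosure = ⊤ := by
    rw [Submodule.topologicalClosure_eq_top_iff, Submodule.eq_bot_iff]
    intro x hx
    refine hsep x fun F hF => ?_
    obtain ⟨f, rfl⟩ := Φ.surjective F
    exact (Submodule.mem_orthogonal _ x).1 hx f (Submodule.subset_span hF)
  have hspan : ∀ f ∈ Submodule.span ℂ {f : H | Φ f ∈ S}, P (Φ f) := fun f hf => by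
    refine Submodule.span_induction (p := fun f _ => P (Φ f)) (fun f hf => hmem _ hf) ?_ ?_ ?_ hf
    · rw [map_zero]; exact h0
    · intro f g _ _ hf hg; rw [map_add]; exact hadd _ _ hf hg
    · intro c f _ hf; rw [LinearIsometryEquiv.map_smulₛₗ]; exact hsmul _ _ hf
  obtain ⟨g, rfl⟩ := Φ.surjective G
  refine hclosed _ fun ε hε => ?_
  have hg : g ∈ closure (Submodule.span ℂ {f : H | Φ f ∈ S} : Set H) := by
    rw [← Submodule.topologicalClosure_coe, hd]; trivial
  obtain ⟨f, hf, hfg⟩ := Metric.mem_closure_iff.1 hg ε hε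
  refine ⟨Φ f, hspan f hf, ?_⟩
  rw [← map_sub, LinearIsometryEquiv.norm_map, ← dist_eq_norm]
  exact hfg

/-- As the curve is bounded, approximating a functional in norm approximates its values along the
curve uniformly in time, and continuity survives uniform limits. -/
theorem continuousOn_of_separating {S : Set (H →L[ℂ] ℂ)}
    (hsep : ∀ x, (∀ F ∈ S, F x = 0) → x = 0) {y : ℝ → H} {C : ℝ} (hy : ∀ t, 0 ≤ t → ‖y t‖ ≤ C)
    (hc : ∀ F ∈ S, ContinuousOn (fun t => F (y t)) (Ici 0)) (G : H →L[ℂ] ℂ) :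
    ContinuousOn (fun t => G (y t)) (Ici 0) := by
  refine dual_induction hsep (P := fun G => ContinuousOn (fun t => G (y t)) (Ici 0)) hc
    (by simpa using continuousOn_const) (fun F G hF hG => hF.add hG)
    (fun c F hF => hF.const_smul c) (fun G hG => ?_) G
  have hC : 0 ≤ C := (norm_nonneg _).trans (hy 0 le_rfl)
  refine continuousOn_of_uniform_approx_of_continuousOn fun U hU => ?_
  obtain ⟨ε, hε, hεU⟩ := Metric.mem_uniformity_dist.1 hU
  obtain ⟨F, hF, hFG⟩ := hG (ε / (C + 1)) (by positivity)
  refine ⟨_, hF, fun t ht => hεU ?_⟩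
  rw [dist_eq_norm, ← _root_.sub_apply]
  calc ‖(G - F) (y t)‖ ≤ ‖G - F‖ * ‖y t‖ := ContinuousLinearMap.le_opNorm _ _
    _ ≤ ‖G - F‖ * (C + 1) := by
        refine mul_le_mul_of_nonneg_left ?_ (norm_nonneg _); linarith [hy t ht]
    _ < ε / (C + 1) * (C + 1) := by gcongr
    _ = ε := by field_simp

theorem hasDerivAt_exp_smul_apply (A : H →L[ℂ] H) (v : H) (t : ℝ) :
    HasDerivAt (fun t : ℝ => NormedSpace.exp ((t : ℂ) • A) v)
      (A (NormedSpace.exp ((t : ℂ) • A) v)) t := by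
  have h1 := hasDerivAt_exp_smul_const' (𝕂 := ℂ) A (t : ℂ)
  have h2 := h1.scomp t Complex.ofRealCLM.hasDerivAt
  rw [Complex.ofRealCLM_apply, Complex.ofReal_one, one_smul] at h2
  have h3 := (ContinuousLinearMap.apply ℂ H v).hasFDerivAt.restrictScalars ℝ |>.comp_hasDerivAt t h2
  exact h3

/-- The derivative of `‖y‖²` along the flow is `2 Re ⟨y, A y⟩ ≤ 0`. -/
theorem norm_exp_smul_apply_le {A : H →L[ℂ] H} (hA : ∀ x, (inner ℂ x (A x)).re ≤ 0) (v : H)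
    {t : ℝ} (ht : 0 ≤ t) : ‖NormedSpace.exp ((t : ℂ) • A) v‖ ≤ ‖v‖ := by
  set y : ℝ → H := fun t => NormedSpace.exp ((t : ℂ) • A) v with hy
  have hd : ∀ s, HasDerivAt (fun s => ‖y s‖ ^ 2) (2 * (inner ℂ (y s) (A (y s))).re) s := fun s => by
    have h1 : HasDerivAt y (A (y s)) s := hasDerivAt_exp_smul_apply A v s
    have h2 := h1.inner ℂ h1
    have h3 := Complex.reCLM.hasFDerivAt.comp_hasDerivAt s h2
    have e1 : (fun s => ‖y s‖ ^ 2) = Complex.reCLM ∘ fun s => inner ℂ (y s) (y s) := by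
      funext s
      exact (inner_self_eq_norm_sq (𝕜 := ℂ) (y s)).symm
    rw [e1]
    refine h3.congr_deriv ?_
    have e2 : (inner ℂ (A (y s)) (y s)).re = (inner ℂ (y s) (A (y s))).re :=
      inner_re_symm (𝕜 := ℂ) _ _
    simp [two_mul, e2]
  have hanti : AntitoneOn (fun s => ‖y s‖ ^ 2) (Ici 0) :=
    antitoneOn_of_deriv_nonpos (convex_Ici 0)
      (fun s _ => (hd s).continuousAt.continuousWithinAt)
      (fun s _ => (hd s).differentiableAt.differentiableWithinAt)
      (fun s _ => by rw [(hd s).deriv]; linarith [hA (y s)])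
  have h1 : ‖y t‖ ^ 2 ≤ ‖y 0‖ ^ 2 := hanti (mem_Ici.2 le_rfl) (mem_Ici.2 ht) ht
  have h2 : y 0 = v := by simp [hy]
  rw [h2] at h1
  exact (sq_le_sq₀ (norm_nonneg _) (norm_nonneg _)).1 h1

/-- Stated for an arbitrary filter because it is used along an ultrafilter, where dominated
convergence is not at hand. A common Lipschitz constant upgrades pointwise convergence to uniform
convergence through a finite net. -/
theorem tendsto_integral_of_equilipschitz {l : Filter ℕ} {φ : ℕ → ℝ → ℂ} {φ₀ : ℝ → ℂ} {L t : ℝ}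
    (ht : 0 ≤ t) (hL : 0 ≤ L)
    (hφ : ∀ᶠ n in l, ∀ a ∈ Icc 0 t, ∀ b ∈ Icc 0 t, ‖φ n a - φ n b‖ ≤ L * |a - b|)
    (hφ₀ : ∀ a ∈ Icc 0 t, ∀ b ∈ Icc 0 t, ‖φ₀ a - φ₀ b‖ ≤ L * |a - b|)
    (hi : ∀ n, IntervalIntegrable (φ n) volume 0 t) (hi₀ : IntervalIntegrable φ₀ volume 0 t)
    (hlim : ∀ s ∈ Icc 0 t, Tendsto (fun n => φ n s) l (𝓝 (φ₀ s))) :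
    Tendsto (fun n => ∫ s in (0 : ℝ)..t, φ n s) l (𝓝 (∫ s in (0 : ℝ)..t, φ₀ s)) := by
  rw [Metric.tendsto_nhds]
  intro ε hε
  set δ : ℝ := ε / (3 * (t + 1)) with hδ
  have hδ0 : 0 < δ := by positivity
  -- With this radius each of the two Lipschitz errors is at most `δ / 2`; together with the error
  -- at the net point this gives `2 δ`, and `2 δ t < 3 δ (t + 1) = ε`.
  obtain ⟨N, hN, hfin, hcov⟩ := (isCompact_Icc (a := (0 : ℝ)) (b := t)).finite_cover_balls
    (e := δ / (2 * (L + 1))) (by positivity)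
  have hev : ∀ᶠ n in l, ∀ s ∈ N, dist (φ n s) (φ₀ s) < δ :=
    (eventually_all_finite hfin).2 fun s hs => Metric.tendsto_nhds.1 (hlim s (hN hs)) δ hδ0
  filter_upwards [hev, hφ] with n hn hφn
  have hb : ∀ s ∈ uIoc 0 t, ‖φ n s - φ₀ s‖ ≤ 2 * δ := by
    intro s hs
    rw [uIoc_of_le ht] at hs
    have hs' : s ∈ Icc 0 t := ⟨hs.1.le, hs.2⟩
    obtain ⟨a, ha, has⟩ := mem_iUnion₂.1 (hcov hs')
    rw [Metric.mem_ball, Real.dist_eq] at has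
    have h1 := hφn s hs' a (hN ha)
    have h2 := hφ₀ a (hN ha) s hs'
    have h3 := hn a ha
    rw [dist_eq_norm] at h3
    rw [abs_sub_comm a s] at h2
    have h4 : L * |s - a| ≤ δ / 2 := by
      calc L * |s - a| ≤ (L + 1) * (δ / (2 * (L + 1))) := by gcongr; linarith
        _ = δ / 2 := by field_simp
    calc ‖φ n s - φ₀ s‖ = ‖(φ n s - φ n a) + (φ n a - φ₀ a) + (φ₀ a - φ₀ s)‖ := by
          congr 1; ring
      _ ≤ ‖φ n s - φ n a‖ + ‖φ n a - φ₀ a‖ + ‖φ₀ a - φ₀ s‖ := norm_add₃_le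
      _ ≤ 2 * δ := by linarith
  rw [dist_eq_norm, ← intervalIntegral.integral_sub (hi n) hi₀]
  have := intervalIntegral.norm_integral_le_of_norm_le_const hb
  rw [sub_zero, abs_of_nonneg ht] at this
  refine this.trans_lt ?_
  have : 3 * δ * (t + 1) = ε := by rw [hδ]; field_simp
  nlinarith

/-- Weak limits of the evolutions generated by bounded dissipative operators `A n` which converge
weakly on a separating set of functionals. -/
theorem exists_weak_evolution {A : ℕ → H →L[ℂ] H} (hA : ∀ n x, (inner ℂ x (A n x)).re ≤ 0)
    {S : Set (H →L[ℂ] ℂ)} (hsep : ∀ x, (∀ F ∈ S, F x = 0) → x = 0)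
    (hS : ∀ F ∈ S, ∃ F' : H →L[ℂ] ℂ, Tendsto (fun n => F.comp (A n)) atTop (𝓝 F')) (v : H) :
    ∃ W : ℝ → H, W 0 = v ∧ (∀ t, 0 ≤ t → ‖W t‖ ≤ ‖v‖) ∧
      (∀ G : H →L[ℂ] ℂ, ContinuousOn (fun t => G (W t)) (Ici 0)) ∧
      ∀ F ∈ S, ∀ F' : H →L[ℂ] ℂ, Tendsto (fun n => F.comp (A n)) atTop (𝓝 F') →
        ∀ t, 0 ≤ t → F (W t) = F v + ∫ s in (0 : ℝ)..t, F' (W s) := by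
  let 𝒰 : Ultrafilter ℕ := hyperfilter ℕ
  have h𝒰 : (𝒰 : Filter ℕ) ≤ atTop := by
    rw [← Nat.cofinite_eq_atTop]; exact hyperfilter_le_cofinite
  set y : ℕ → ℝ → H := fun n t => NormedSpace.exp ((t : ℂ) • A n) v with hydef
  have hyd : ∀ n t, HasDerivAt (y n) (A n (y n t)) t := fun n t => hasDerivAt_exp_smul_apply _ _ _
  have hyc : ∀ n, Continuous (y n) := fun n =>
    continuous_iff_continuousAt.2 fun t => (hyd n t).continuousAt
  have hyb : ∀ n t, 0 ≤ t → ‖y n t‖ ≤ ‖v‖ := fun n t ht => norm_exp_smul_apply_le (hA n) v ht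
  have hex : ∀ t : ℝ, ∃ w : H, 0 ≤ t → ‖w‖ ≤ ‖v‖ ∧
      ∀ G : H →L[ℂ] ℂ, Tendsto (fun n => G (y n t)) 𝒰 (𝓝 (G w)) := fun t => by
    by_cases ht : 0 ≤ t
    · obtain ⟨w, hw⟩ := exists_weak_ultralimit 𝒰 (fun n => y n t) fun n => hyb n t ht
      exact ⟨w, fun _ => hw⟩
    · exact ⟨0, fun h => absurd h ht⟩
  choose W hW using hex
  have hWb : ∀ t, 0 ≤ t → ‖W t‖ ≤ ‖v‖ := fun t ht => (hW t ht).1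
  have hWl : ∀ t, 0 ≤ t → ∀ G : H →L[ℂ] ℂ, Tendsto (fun n => G (y n t)) 𝒰 (𝓝 (G (W t))) :=
    fun t ht => (hW t ht).2
  have heq : ∀ (F : H →L[ℂ] ℂ) n t, F (y n t) = F v + ∫ s in (0 : ℝ)..t, F.comp (A n) (y n s) := by
    intro F n t
    have h1 : ∀ s ∈ uIcc 0 t, HasDerivAt (fun s => F (y n s)) (F.comp (A n) (y n s)) s := fun s _ =>
      (F.hasFDerivAt.restrictScalars ℝ).comp_hasDerivAt s (hyd n s)
    rw [intervalIntegral.integral_eq_sub_of_hasDerivAt h1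
      (((F.comp (A n)).continuous.comp (hyc n)).intervalIntegrable _ _)]
    simp [hydef]
  -- The functionals `F ∘ A n` converge in norm, so they are eventually bounded by `‖F'‖ + 1`.
  -- Applied to the contractive flow, this bounds the time derivative of `F (y n t)` uniformly in
  -- `n`.
  have hlip : ∀ F ∈ S, ∃ L : ℝ, 0 ≤ L ∧ ∀ᶠ n in (𝒰 : Filter ℕ), ∀ a, 0 ≤ a → ∀ b, 0 ≤ b →
      ‖F (y n a) - F (y n b)‖ ≤ L * |a - b| := by
    intro F hF
    obtain ⟨F', hF'⟩ := hS F hF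
    refine ⟨(‖F'‖ + 1) * ‖v‖, by positivity, ?_⟩
    have h1 : ∀ᶠ n in atTop, ‖F.comp (A n)‖ < ‖F'‖ + 1 :=
      hF'.norm.eventually_lt_const (lt_add_one _)
    filter_upwards [h𝒰 h1] with n hn a ha b hb
    have hd : ∀ s ∈ Ici (0 : ℝ), HasDerivWithinAt (fun s => F (y n s)) (F.comp (A n) (y n s))
        (Ici 0) s := fun s _ =>
      ((F.hasFDerivAt.restrictScalars ℝ).comp_hasDerivAt s (hyd n s)).hasDerivWithinAt
    have := Convex.norm_image_sub_le_of_norm_hasDerivWithin_le (C := (‖F'‖ + 1) * ‖v‖) hd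
      (fun s hs => by
        refine (ContinuousLinearMap.le_opNorm _ _).trans ?_
        exact mul_le_mul hn.le (hyb n s hs) (norm_nonneg _) (by positivity))
      (convex_Ici 0) (mem_Ici.2 hb) (mem_Ici.2 ha)
    rwa [Real.norm_eq_abs] at this
  have hlipW : ∀ F ∈ S, ∃ L : ℝ, 0 ≤ L ∧ (∀ᶠ n in (𝒰 : Filter ℕ), ∀ a, 0 ≤ a → ∀ b, 0 ≤ b →
      ‖F (y n a) - F (y n b)‖ ≤ L * |a - b|) ∧ ∀ a, 0 ≤ a → ∀ b, 0 ≤ b →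
      ‖F (W a) - F (W b)‖ ≤ L * |a - b| := by
    intro F hF
    obtain ⟨L, hL, h⟩ := hlip F hF
    refine ⟨L, hL, h, fun a ha b hb => ?_⟩
    exact le_of_tendsto ((hWl a ha F).sub (hWl b hb F)).norm (h.mono fun n hn => hn a ha b hb)
  have hWc : ∀ G : H →L[ℂ] ℂ, ContinuousOn (fun t => G (W t)) (Ici 0) := by
    refine continuousOn_of_separating hsep hWb fun F hF => ?_
    obtain ⟨L, hL, -, h⟩ := hlipW F hF
    refine LipschitzOnWith.continuousOn (K := ⟨L, hL⟩)
      (LipschitzOnWith.of_dist_le_mul fun a ha b hb => ?_)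
    rw [dist_eq_norm, Real.dist_eq]
    exact h a ha b hb
  have hWi : ∀ (G : H →L[ℂ] ℂ) t, 0 ≤ t → IntervalIntegrable (fun s => G (W s)) volume 0 t :=
    fun G t ht => ((hWc G).mono (by rw [uIcc_of_le ht]; exact Icc_subset_Ici_self)).intervalIntegrable
  have hyi : ∀ (G : H →L[ℂ] ℂ) n t, IntervalIntegrable (fun s => G (y n s)) volume 0 t :=
    fun G n t => (G.continuous.comp (hyc n)).intervalIntegrable _ _
  -- All functionals are needed here, since the limit `F'` need not belong to `S`. On `S` the
  -- equi-Lipschitz bound applies; the rest follows by density.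
  have hint : ∀ t, 0 ≤ t → ∀ G : H →L[ℂ] ℂ, Tendsto (fun n => ∫ s in (0 : ℝ)..t, G (y n s)) 𝒰
      (𝓝 (∫ s in (0 : ℝ)..t, G (W s))) := by
    intro t ht G
    refine dual_induction hsep (P := fun G => Tendsto (fun n => ∫ s in (0 : ℝ)..t, G (y n s)) 𝒰
      (𝓝 (∫ s in (0 : ℝ)..t, G (W s)))) ?_ ?_ ?_ ?_ ?_ G
    · intro F hF
      obtain ⟨L, hL, h1, h2⟩ := hlipW F hF
      exact tendsto_integral_of_equilipschitz ht hL
        (h1.mono fun n hn a ha b hb => hn a ha.1 b hb.1) (fun a ha b hb => h2 a ha.1 b hb.1)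
        (fun n => hyi F n t) (hWi F t ht) fun s hs => hWl s hs.1 F
    · simp
    · intro F G hF hG
      simp only [_root_.add_apply]
      rw [intervalIntegral.integral_add (hWi F t ht) (hWi G t ht)]
      refine (hF.add hG).congr fun n => ?_
      rw [intervalIntegral.integral_add (hyi F n t) (hyi G n t)]
    · intro c F hF
      simp only [_root_.smul_apply, intervalIntegral.integral_smul]
      exact hF.const_smul c
    · intro G hG
      rw [Metric.tendsto_nhds]
      intro ε hε
      set δ := ε / (3 * ((‖v‖ + 1) * (t + 1))) with hδ
      have hδε : 3 * δ * ((‖v‖ + 1) * (t + 1)) = ε := by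
        have := norm_nonneg v
        rw [hδ]; field_simp
      have hδ0 : 0 < δ := by have := norm_nonneg v; positivity
      obtain ⟨F, hF, hFG⟩ := hG δ hδ0
      have hbd : ∀ z : ℝ → H, (∀ s, 0 ≤ s → ‖z s‖ ≤ ‖v‖) →
          IntervalIntegrable (fun s => G (z s)) volume 0 t →
          IntervalIntegrable (fun s => F (z s)) volume 0 t →
          ‖(∫ s in (0 : ℝ)..t, G (z s)) - ∫ s in (0 : ℝ)..t, F (z s)‖ ≤ ε / 3 := by
        intro z hz hzG hzF
        rw [← intervalIntegral.integral_sub hzG hzF]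
        have := intervalIntegral.norm_integral_le_of_norm_le_const (a := 0) (b := t)
          (f := fun s => G (z s) - F (z s)) (C := δ * (‖v‖ + 1)) fun s hs => by
            rw [uIoc_of_le ht] at hs
            rw [← _root_.sub_apply]
            refine (ContinuousLinearMap.le_opNorm _ _).trans ?_
            exact mul_le_mul hFG.le ((hz s hs.1.le).trans (by linarith)) (norm_nonneg _) hδ0.le
        refine this.trans ?_
        rw [sub_zero, abs_of_nonneg ht]
        have h5 : δ * (‖v‖ + 1) * t ≤ δ * (‖v‖ + 1) * (t + 1) := by gcongr; linarith
        linarith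
      filter_upwards [Metric.tendsto_nhds.1 hF (ε / 3) (by positivity)] with n hn
      rw [dist_eq_norm] at hn ⊢
      have b1 := hbd (y n) (hyb n) (hyi G n t) (hyi F n t)
      have b2 := hbd W hWb (hWi G t ht) (hWi F t ht)
      rw [norm_sub_rev] at b2
      calc _ = ‖((∫ s in (0 : ℝ)..t, G (y n s)) - ∫ s in (0 : ℝ)..t, F (y n s)) +
            ((∫ s in (0 : ℝ)..t, F (y n s)) - ∫ s in (0 : ℝ)..t, F (W s)) +
            ((∫ s in (0 : ℝ)..t, F (W s)) - ∫ s in (0 : ℝ)..t, G (W s))‖ := by congr 1; ring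
        _ ≤ _ := norm_add₃_le
        _ < ε := by linarith
  refine ⟨W, ?_, hWb, hWc, fun F hF F' hF' t ht => ?_⟩
  · rw [← sub_eq_zero]
    refine hsep _ fun F _ => ?_
    have h1 := hWl 0 le_rfl F
    have h2 : ∀ n, F (y n 0) = F v := fun n => by simp [hydef]
    simp only [h2] at h1
    rw [map_sub, sub_eq_zero]
    exact tendsto_nhds_unique tendsto_const_nhds h1 |>.symm
  · have h1 : Tendsto (fun n => ∫ s in (0 : ℝ)..t, F.comp (A n) (y n s)) 𝒰
        (𝓝 (∫ s in (0 : ℝ)..t, F' (W s))) := by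
      -- Norm convergence of `F ∘ A n`, against curves bounded by `‖v‖`, allows `F'` to be inserted
      -- before the weak limit is taken.
      have h2 : Tendsto (fun n => (∫ s in (0 : ℝ)..t, F.comp (A n) (y n s)) -
          ∫ s in (0 : ℝ)..t, F' (y n s)) 𝒰 (𝓝 0) := by
        have h3 : Tendsto (fun n => ‖F.comp (A n) - F'‖ * ‖v‖ * t) 𝒰 (𝓝 0) := by
          have h4 : Tendsto (fun n => ‖F.comp (A n) - F'‖) atTop (𝓝 0) :=
            tendsto_iff_norm_sub_tendsto_zero.1 hF'
          have := ((h4.mono_left h𝒰).mul_const ‖v‖).mul_const t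
          simpa using this
        refine squeeze_zero_norm (fun n => ?_) h3
        rw [← intervalIntegral.integral_sub (hyi _ n t) (hyi F' n t)]
        have := intervalIntegral.norm_integral_le_of_norm_le_const (a := 0) (b := t)
          (f := fun s => F.comp (A n) (y n s) - F' (y n s)) (C := ‖F.comp (A n) - F'‖ * ‖v‖)
          fun s hs => by
            rw [uIoc_of_le ht] at hs
            rw [← _root_.sub_apply]
            refine (ContinuousLinearMap.le_opNorm _ _).trans ?_
            exact mul_le_mul_of_nonneg_left (hyb n s hs.1.le) (norm_nonneg _)
        rwa [sub_zero, abs_of_nonneg ht] at this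
      have h5 := h2.add (hint t ht F')
      simpa using h5
    have h6 := tendsto_nhds_unique (hWl t ht F)
      ((tendsto_const_nhds.add h1).congr fun n => (heq F n t).symm)
    exact h6

end Abstract

/-! ### Approximation of the generator by bounded dissipative operators -/

section Generator

variable {E : Type*} [NormedAddCommGroup E] [InnerProductSpace ℂ E]

/-- The coordinate with index `m` of a square summable sequence. -/
noncomputable def coordL (m : ℕ) : lp (fun _ : ℕ => E) 2 →L[ℂ] E :=
  LinearMap.mkContinuous
    { toFun := fun x => x m
      map_add' := fun _ _ => rfl
      map_smul' := fun _ _ => rfl } 1 fun x => by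
    rw [one_mul]; exact lp.norm_apply_le_norm two_ne_zero x m

theorem coordL_apply (m : ℕ) (x : lp (fun _ : ℕ => E) 2) : coordL m x = x m := rfl

/-- The inclusion of the coordinate with index `m`. -/
noncomputable def inclL (m : ℕ) : E →L[ℂ] lp (fun _ : ℕ => E) 2 :=
  LinearMap.mkContinuous
    { toFun := fun e => lp.single (E := fun _ : ℕ => E) 2 m e
      map_add' := fun e e' => lp.single_add (E := fun _ : ℕ => E) 2 m e e'
      map_smul' := fun c e => lp.single_smul (E := fun _ : ℕ => E) 2 m c e } 1 fun e => by
    rw [one_mul]; exact (lp.norm_single (E := fun _ : ℕ => E) two_pos m e).le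

theorem coordL_inclL (k m : ℕ) (e : E) :
    coordL k (inclL m e : lp (fun _ : ℕ => E) 2) = if k = m then e else 0 := by
  change (lp.single (E := fun _ : ℕ => E) 2 m e) k = _
  split_ifs with h
  · subst h; exact lp.single_apply_self (E := fun _ : ℕ => E) 2 k e
  · exact lp.single_apply_ne (E := fun _ : ℕ => E) 2 m e h

theorem inner_inclL (m : ℕ) (e : E) (x : lp (fun _ : ℕ => E) 2) :
    inner ℂ x (inclL m e) = inner ℂ (x m) e :=
  lp.inner_single_right (G := fun _ : ℕ => E) m e x

/-- Bounded approximation, with difference quotients `s m • (T - 1)` in place of derivatives and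
finitely many interactions, of the generator of the free evolution. -/
noncomputable def approxGen (s c : ℕ → ℝ) (T : E →L[ℂ] E) (n : ℕ) :
    lp (fun _ : ℕ => E) 2 →L[ℂ] lp (fun _ : ℕ => E) 2 :=
  ∑ m ∈ Finset.range n,
    ((s m : ℂ) • (inclL m).comp ((T - ContinuousLinearMap.id ℂ E).comp (coordL m)) +
      (c m : ℂ) • ((inclL (m + 1)).comp (coordL m) - (inclL m).comp (coordL (m + 1))))

theorem approxGen_apply (s c : ℕ → ℝ) (T : E →L[ℂ] E) (n : ℕ) (x : lp (fun _ : ℕ => E) 2) :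
    approxGen s c T n x = ∑ m ∈ Finset.range n,
      ((s m : ℂ) • inclL m (T (x m) - x m) +
        (c m : ℂ) • (inclL (m + 1) (x m) - inclL m (x (m + 1)))) := by
  rw [approxGen, _root_.sum_apply]
  rfl

/-- A contraction satisfies `Re ⟨x, T x - x⟩ ≤ 0`, and each interaction between neighbouring
coordinates is skew-symmetric, so that its contribution has vanishing real part. Truncation
preserves this because whole pairs are kept. -/
theorem approxGen_dissipative {s : ℕ → ℝ} (hs : ∀ m, 0 ≤ s m) (c : ℕ → ℝ) {T : E →L[ℂ] E}
    (hT : ∀ e, ‖T e‖ ≤ ‖e‖) (n : ℕ) (x : lp (fun _ : ℕ => E) 2) :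
    (inner ℂ x (approxGen s c T n x)).re ≤ 0 := by
  rw [approxGen_apply, inner_sum, Complex.re_sum]
  refine Finset.sum_nonpos fun m _ => ?_
  rw [inner_add_right, inner_smul_right, inner_smul_right, inner_sub_right, inner_inclL, inner_inclL,
    inner_inclL, inner_sub_right, Complex.add_re, Complex.re_ofReal_mul, Complex.re_ofReal_mul,
    Complex.sub_re, Complex.sub_re]
  have h1 : (inner ℂ (x (m + 1)) (x m)).re = (inner ℂ (x m) (x (m + 1))).re :=
    inner_re_symm (𝕜 := ℂ) _ _
  have h2 : (inner ℂ (x m) (T (x m))).re ≤ ‖x m‖ * ‖T (x m)‖ :=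
    re_inner_le_norm (𝕜 := ℂ) _ _
  have h3 : (inner ℂ (x m) (x m)).re = ‖x m‖ ^ 2 := inner_self_eq_norm_sq (𝕜 := ℂ) _
  have h4 := mul_le_mul_of_nonneg_left (hT (x m)) (norm_nonneg (x m))
  rw [h1, h3, sub_self, mul_zero, add_zero]
  exact mul_nonpos_of_nonneg_of_nonpos (hs m) (by nlinarith)

/-- The coordinate before `k`, or zero. -/
noncomputable def prevL (k : ℕ) : lp (fun _ : ℕ => E) 2 →L[ℂ] E :=
  if k = 0 then 0 else coordL (k - 1)

/-- Coordinate `k` is touched only by the interactions with indices `k - 1` and `k`, both kept when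
`k < n`. For `k = 0` the coefficient `c (k - 1)` is irrelevant because `prevL 0` is zero. -/
theorem coordL_approxGen (s c : ℕ → ℝ) (T : E →L[ℂ] E) {n k : ℕ} (hk : k < n)
    (x : lp (fun _ : ℕ => E) 2) :
    coordL k (approxGen s c T n x) = (s k : ℂ) • (T (x k) - x k) +
      ((c (k - 1) : ℂ) • prevL k x - (c k : ℂ) • x (k + 1)) := by
  rw [approxGen_apply, map_sum]
  have h1 : ∀ m, coordL k ((s m : ℂ) • (inclL m (T (x m) - x m) : lp (fun _ : ℕ => E) 2) +
        (c m : ℂ) • (inclL (m + 1) (x m) - inclL m (x (m + 1)))) =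
      (if k = m then (s k : ℂ) • (T (x k) - x k) - (c k : ℂ) • x (k + 1) else 0) +
        if k = m + 1 then (c (k - 1) : ℂ) • x (k - 1) else 0 := by
    intro m
    rw [map_add, map_smul, map_smul, map_sub (coordL k), coordL_inclL, coordL_inclL, coordL_inclL]
    by_cases h : k = m
    · subst h; simp [sub_eq_add_neg]
    · by_cases h' : k = m + 1
      · subst h'; simp
      · simp [h, h']
  simp only [h1]
  rw [Finset.sum_add_distrib, Finset.sum_ite_eq, if_pos (Finset.mem_range.2 hk)]
  have h2 : ∑ m ∈ Finset.range n, (if k = m + 1 then (c (k - 1) : ℂ) • x (k - 1) else 0) =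
      (c (k - 1) : ℂ) • prevL k x := by
    rcases Nat.eq_zero_or_pos k with rfl | hk0
    · simp [prevL]
    · rw [Finset.sum_eq_single (k - 1)]
      · rw [if_pos (by omega), prevL, if_neg hk0.ne', coordL_apply]
      · intro m _ hm; exact if_neg (by omega)
      · intro hm; exact absurd (Finset.mem_range.2 (by omega)) hm
  rw [h2]
  abel

theorem tendsto_comp_approxGen {c : ℕ → ℝ} {T : ℕ → E →L[ℂ] E} {s : ℕ → ℕ → ℝ} {k : ℕ}
    {Λ Λ' : E →L[ℂ] ℂ}
    (h : Tendsto (fun n => (s n k : ℂ) • (Λ.comp (T n) - Λ)) atTop (𝓝 Λ')) :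
    Tendsto (fun n => (Λ.comp (coordL k)).comp (approxGen (s n) c (T n) n)) atTop
      (𝓝 (Λ'.comp (coordL k) + ((c (k - 1) : ℂ) • Λ.comp (prevL k) -
        (c k : ℂ) • Λ.comp (coordL (k + 1))))) := by
  have h1 : Tendsto (fun n => ((s n k : ℂ) • (Λ.comp (T n) - Λ)).comp
      (coordL k : lp (fun _ : ℕ => E) 2 →L[ℂ] E)) atTop (𝓝 (Λ'.comp (coordL k))) :=
    ((ContinuousLinearMap.compL ℂ (lp (fun _ : ℕ => E) 2) E ℂ).flip (coordL k)).continuous.tendsto _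
      |>.comp h
  refine (h1.add tendsto_const_nhds).congr' ?_
  filter_upwards [eventually_gt_atTop k] with n hn
  ext x
  have := congrArg Λ (coordL_approxGen (s n) c (T n) hn x)
  rw [map_add, map_sub, map_smul, map_smul, map_smul, map_sub] at this
  exact this.symm

end Generator

/-- Difference quotients with step `1 / (n + 1)`, transferred to the test function. The sign is that
of integration by parts. -/
theorem tendsto_diffQuot {b : ℝ} (hb : 0 ≤ b) {ψ : ℝ → ℝ} (h : IsTest ψ) (a : ℝ) :
    Tendsto (fun n : ℕ => (((a * (n + 1) : ℝ)) : ℂ) •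
      ((testL hb h.continuous h.compact).comp
        (shiftL hb (by positivity : (0 : ℝ) ≤ 1 / ((n : ℝ) + 1))) -
          testL hb h.continuous h.compact)) atTop
      (𝓝 ((a : ℂ) • -testL hb h.deriv.continuous h.deriv.compact)) := by
  have h1 := (hasDerivAt_translateL hb h 0).tendsto_slope_zero
  rw [translateL_zero, translateL_zero] at h1
  have h2 : Tendsto (fun n : ℕ => 1 / ((n : ℝ) + 1)) atTop (𝓝[≠] 0) := by
    rw [tendsto_nhdsWithin_iff]
    exact ⟨tendsto_one_div_add_atTop_nhds_zero_nat,
      Eventually.of_forall fun n => (by positivity : (0 : ℝ) < 1 / ((n : ℝ) + 1)).ne'⟩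
  refine ((h1.comp h2).const_smul (a : ℂ)).congr fun n => ?_
  have e1 : (testL hb h.continuous h.compact).comp
      (shiftL hb (by positivity : (0 : ℝ) ≤ 1 / ((n : ℝ) + 1))) =
      translateL hb h.continuous h.compact (1 / ((n : ℝ) + 1)) := by
    ext e; exact testL_shiftL hb h _ e
  rw [e1]
  ext e
  simp only [Function.comp, zero_add, one_div, inv_inv, _root_.smul_apply, _root_.sub_apply,
    Complex.real_smul, smul_eq_mul]
  push_cast
  ring

/-- Interaction coefficients in the coordinates of the state space. -/
noncomputable def coef (K r : ℝ) (m : ℕ) : ℝ := K * r / 2 * (rt m * rt (m + 1))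

/-- The evolution generated by `(ℓ - 1) ∂_ξ` and the interactions. -/
theorem exists_reduced_evolution {b : ℝ} (hb : 0 ≤ b) (K r : ℝ) (v : StateSpace b) :
    ∃ W : ℝ → StateSpace b, W 0 = v ∧ (∀ t, 0 ≤ t → ‖W t‖ ≤ ‖v‖) ∧
      (∀ G : StateSpace b →L[ℂ] ℂ, ContinuousOn (fun t => G (W t)) (Ici 0)) ∧
      ∀ (k : ℕ) (ψ : ℝ → ℝ) (h : IsTest ψ) (t : ℝ), 0 ≤ t →
        testL hb h.continuous h.compact (W t k) = testL hb h.continuous h.compact (v k) +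
          ∫ s in (0 : ℝ)..t, ((k : ℂ) * -testL hb h.deriv.continuous h.deriv.compact (W s k) +
            ((coef K r (k - 1) : ℂ) * testL hb h.continuous h.compact (prevL k (W s)) -
              (coef K r k : ℂ) * testL hb h.continuous h.compact (W s (k + 1)))) := by
  let T : ℕ → ModeSpace b →L[ℂ] ModeSpace b := fun n =>
    shiftL hb (by positivity : (0 : ℝ) ≤ 1 / ((n : ℝ) + 1))
  -- Speed `k` divided by the step `1 / (n + 1)`. The mode `ℓ = k + 1` is transported at speed `ℓ -
  -- 1` only; the missing unit of speed is restored afterwards by a translation, and that is the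
  -- source of decay.
  let s : ℕ → ℕ → ℝ := fun n k => k * (n + 1)
  let S : Set (StateSpace b →L[ℂ] ℂ) := {F | ∃ (k : ℕ) (ψ : ℝ → ℝ) (h : IsTest ψ),
    F = (testL hb h.continuous h.compact).comp (coordL k)}
  have hlim : ∀ (k : ℕ) (ψ : ℝ → ℝ) (h : IsTest ψ),
      Tendsto (fun n => ((testL hb h.continuous h.compact).comp (coordL k)).comp
        (approxGen (s n) (coef K r) (T n) n)) atTop
      (𝓝 ((((k : ℝ) : ℂ) • -testL hb h.deriv.continuous h.deriv.compact).comp (coordL k) +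
        ((coef K r (k - 1) : ℂ) • (testL hb h.continuous h.compact).comp (prevL k) -
        (coef K r k : ℂ) • (testL hb h.continuous h.compact).comp (coordL (k + 1))))) :=
    fun k ψ h => tendsto_comp_approxGen (tendsto_diffQuot hb h k)
  obtain ⟨W, hW0, hWb, hWc, hWe⟩ := exists_weak_evolution
    (A := fun n => approxGen (s n) (coef K r) (T n) n)
    (fun n x => approxGen_dissipative (fun m => by positivity) _ (norm_shiftL_le hb _) n x)
    (S := S)
    (fun x hx => by
      ext1
      funext k
      exact eq_zero_of_testL hb (x k) fun ψ hψ => hx _ ⟨k, ψ, hψ, rfl⟩)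
    (by
      rintro F ⟨k, ψ, h, rfl⟩
      exact ⟨_, hlim k ψ h⟩) v
  refine ⟨W, hW0, hWb, hWc, fun k ψ h t ht => ?_⟩
  have := hWe _ ⟨k, ψ, h, rfl⟩ _ (hlim k ψ h) t ht
  rw [ContinuousLinearMap.comp_apply, ContinuousLinearMap.comp_apply, coordL_apply, coordL_apply]
    at this
  rw [this]
  congr 1

/-! ### Existence of weak solutions with decay -/

section WeakProduct

variable {H : Type*} [NormedAddCommGroup H] [NormedSpace ℂ H]

theorem hasDerivAt_mul_of_continuousAt {g : ℝ → ℂ} {t : ℝ} (hg : ContinuousAt g t) :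
    HasDerivAt (fun s => ((s - t : ℝ) : ℂ) * g s) (g t) t := by
  rw [hasDerivAt_iff_tendsto_slope]
  refine (hg.tendsto.mono_left nhdsWithin_le_nhds).congr' ?_
  filter_upwards [self_mem_nhdsWithin] with s hs
  have hs' : ((s : ℂ) - t) ≠ 0 := by
    rw [← Complex.ofReal_sub]; exact_mod_cast sub_ne_zero.2 hs
  rw [slope_def_module, Complex.real_smul]
  push_cast
  field_simp
  ring

/-- Product rule for a differentiable functional applied to a weakly differentiable curve. -/
theorem hasDerivAt_apply_weak {L : ℝ → H →L[ℂ] ℂ} {L' : H →L[ℂ] ℂ} {y : ℝ → H} {t C : ℝ} {d : ℂ}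
    (hL : HasDerivAt L L' t) (hy : ∀ᶠ s in 𝓝 t, ‖y s‖ ≤ C)
    (hc : ContinuousAt (fun s => L' (y s)) t) (hd : HasDerivAt (fun s => L t (y s)) d t) :
    HasDerivAt (fun s => L s (y s)) (L' (y t) + d) t := by
  -- The remainder of `L` is `o(s - t)` in norm and `y` is bounded, so its contribution is
  -- negligible. The two other pieces, `(s - t) L'(y s)` and `L t (y s)`, require only weak
  -- information on `y`.
  have h1 : HasDerivAt (fun s => (L s - L t - (s - t) • L') (y s)) 0 t := by
    rw [hasDerivAt_iff_isLittleO]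
    have h2 := hasDerivAt_iff_isLittleO.1 hL
    refine Asymptotics.IsBigO.trans_isLittleO (Asymptotics.IsBigO.of_bound C ?_) h2
    filter_upwards [hy] with s hs
    have : (L t - L t - (t - t) • L') (y t) = 0 := by simp
    rw [this, smul_zero, sub_zero, sub_zero, mul_comm]
    exact (ContinuousLinearMap.le_opNorm _ _).trans
      (mul_le_mul_of_nonneg_left hs (norm_nonneg _))
  have h2 := hasDerivAt_mul_of_continuousAt hc
  refine ((h1.add h2).add hd).congr_of_eventuallyEq (Eventually.of_forall fun s => ?_)
    |>.congr_deriv (by ring)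
  simp only [Pi.add_apply, _root_.sub_apply, _root_.smul_apply, Complex.real_smul]
  ring

theorem continuousOn_apply_weak {L : ℝ → H →L[ℂ] ℂ} {y : ℝ → H} {C : ℝ} (hL : Continuous L)
    (hy : ∀ t, 0 ≤ t → ‖y t‖ ≤ C) (hc : ∀ G : H →L[ℂ] ℂ, ContinuousOn (fun t => G (y t)) (Ici 0)) :
    ContinuousOn (fun t => L t (y t)) (Ici 0) := by
  intro t ht
  have h1 : Tendsto (fun s => (L s - L t) (y s)) (𝓝[Ici 0] t) (𝓝 0) := by
    have h2 : Tendsto (fun s => ‖L s - L t‖ * C) (𝓝[Ici 0] t) (𝓝 0) := by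
      have : Tendsto (fun s => ‖L s - L t‖) (𝓝 t) (𝓝 0) :=
        tendsto_iff_norm_sub_tendsto_zero.1 (hL.tendsto t)
      simpa using (this.mono_left nhdsWithin_le_nhds).mul_const C
    refine squeeze_zero_norm' ?_ h2
    filter_upwards [self_mem_nhdsWithin] with s hs
    exact (ContinuousLinearMap.le_opNorm _ _).trans
      (mul_le_mul_of_nonneg_left (hy s hs) (norm_nonneg _))
  have h3 := h1.add ((hc (L t)) t ht)
  rw [zero_add] at h3
  refine h3.congr fun s => ?_
  simp

end WeakProduct

theorem continuous_translateL {b : ℝ} (hb : 0 ≤ b) {ψ : ℝ → ℝ} (h : IsTest ψ) :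
    Continuous (translateL hb h.continuous h.compact) :=
  continuous_iff_continuousAt.2 fun t => (hasDerivAt_translateL hb h t).continuousAt

theorem translateL_eq_testL {b : ℝ} (hb : 0 ≤ b) {ψ : ℝ → ℝ} (h : IsTest ψ) {t : ℝ} (ht : 0 ≤ t) :
    translateL hb h.continuous h.compact t =
      testL hb (h.shift ht).continuous (h.shift ht).compact := rfl

theorem translateL_deriv_eq_testL {b : ℝ} (hb : 0 ≤ b) {ψ : ℝ → ℝ} (h : IsTest ψ) {t : ℝ}
    (ht : 0 ≤ t) : translateL hb h.deriv.continuous h.deriv.compact t =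
      testL hb (h.shift ht).deriv.continuous (h.shift ht).deriv.compact := by
  ext e
  rw [translateL_apply, testL_apply]
  refine integral_congr_ae (Eventually.of_forall fun x => ?_)
  simp only
  rw [deriv_comp_sub_const]

theorem IsState.integral_mul {b : ℝ} (hb : 0 ≤ b) {u : ℕ → ℝ → ℂ} {x : StateSpace b}
    (h : IsState b u x) (m : ℕ) {ψ : ℝ → ℝ} (hψ : Continuous ψ) (hc : HasCompactSupport ψ) :
    ∫ ξ in Ioi (0 : ℝ), u (m + 1) ξ * (ψ ξ : ℂ) = rt m * testL hb hψ hc (x m) := by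
  rw [testL_apply, ← integral_const_mul]
  refine setIntegral_congr_fun measurableSet_Ioi fun ξ hξ => ?_
  simp only [h.rep_eq m (le_of_lt hξ)]
  ring

theorem IsState.integrable_mul {b : ℝ} {u : ℕ → ℝ → ℂ} {x : StateSpace b}
    (h : IsState b u x) (m : ℕ) {ψ : ℝ → ℝ} (hψ : Continuous ψ) (hc : HasCompactSupport ψ) :
    Integrable (fun ξ => u (m + 1) ξ * (ψ ξ : ℂ)) halfLine := by
  refine ((integrable_rep_mul (x m) hψ hc).const_mul (rt m : ℂ)).congr ?_
  filter_upwards [ae_restrict_mem measurableSet_Ioi] with ξ hξ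
  rw [h.rep_eq m (le_of_lt hξ)]
  ring

/-- Writing `ℓ = √ℓ · √ℓ` and `u_{ℓ±1} = √(ℓ±1) x`, one factor `√ℓ` is pulled out and the other
completes the symmetric coefficient `coef`. -/
theorem IsState.integral_interaction {b : ℝ} (hb : 0 ≤ b) (K r : ℝ) {u : ℕ → ℝ → ℂ}
    {x : StateSpace b} (h : IsState b u x) (m : ℕ) {ψ : ℝ → ℝ} (hψ : Continuous ψ)
    (hc : HasCompactSupport ψ) :
    (K * ((m + 1 : ℕ) : ℂ) / 2 : ℂ) *
      ∫ ξ in Ioi (0 : ℝ), (r * lowerMode u (m + 1) ξ - r * u (m + 1 + 1) ξ) * (ψ ξ : ℂ) =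
    rt m * ((coef K r (m - 1) : ℂ) * testL hb hψ hc (prevL m x) -
      (coef K r m : ℂ) * testL hb hψ hc (x (m + 1))) := by
  have hrt : ((m + 1 : ℕ) : ℂ) = (rt m : ℂ) ^ 2 := by
    rw [← Complex.ofReal_pow, rt_sq]; push_cast; rfl
  have i2 := (h.integrable_mul (m + 1) hψ hc).const_mul (r : ℂ)
  have e2 := h.integral_mul hb (m + 1) hψ hc
  rcases m with _ | m
  · have : ∀ ξ, (r * lowerMode u (0 + 1) ξ - r * u (0 + 1 + 1) ξ) * (ψ ξ : ℂ) =
        -(r * (u (0 + 1 + 1) ξ * (ψ ξ : ℂ))) := fun ξ => by simp [lowerMode]; ring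
    simp only [this]
    rw [integral_neg, integral_const_mul, e2, hrt]
    simp only [prevL, coef, if_true, _root_.zero_apply, map_zero]
    push_cast
    ring
  · have i1 := (h.integrable_mul m hψ hc).const_mul (r : ℂ)
    have e1 := h.integral_mul hb m hψ hc
    have : ∀ ξ, (r * lowerMode u (m + 1 + 1) ξ - r * u (m + 1 + 1 + 1) ξ) * (ψ ξ : ℂ) =
        r * (u (m + 1) ξ * (ψ ξ : ℂ)) - r * (u (m + 1 + 1 + 1) ξ * (ψ ξ : ℂ)) := fun ξ => by
      simp [lowerMode]; ring
    simp only [this]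
    rw [integral_sub i1 i2, integral_const_mul, integral_const_mul, e1, e2, hrt]
    simp only [prevL, coef, Nat.add_sub_cancel, if_neg (Nat.succ_ne_zero m), coordL_apply]
    push_cast
    ring

/-- `∑_{ℓ ≥ 1} ∫_0^∞ |u_ℓ|² (1+ξ)^{2b} ℓ^{-1} dξ`. -/
noncomputable def l2NormSq (b : ℝ) (u : ℕ → ℝ → ℂ) : ℝ≥0∞ :=
  ∑' m : ℕ, ∫⁻ ξ in Ioi (0 : ℝ), ENNReal.ofReal (‖u (m + 1) ξ‖ ^ 2 * wt b ξ ^ 2 / ((m : ℝ) + 1))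

/-- A weak solution together with its decay in time. -/
structure IsDecayingSolution (K r b : ℝ) (v : ℕ → ℝ → ℂ) (w : ℝ → ℕ → ℝ → ℂ) (C : ℝ) : Prop where
  nonneg : 0 ≤ C
  weak : IsWeakSolution K r b v w
  norm_le : ∀ (m : ℕ) (t ξ : ℝ), 0 ≤ t → 0 ≤ ξ → ‖w t (m + 1) ξ‖ ≤ C * rt m * (1 + t) ^ (-b)
  l2NormSq_le : ∀ b' t, 0 ≤ b' → b' ≤ b → 0 ≤ t →
    l2NormSq b' (w t) ≤ ENNReal.ofReal (C * (1 + t) ^ (2 * (b' - b)))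

/-- The weight at `ξ + t` splits into exponents `b'` and `b - b'`. The first factor dominates the
weight at `ξ`, the second dominates `(1 + t)^{b - b'}`: surplus weight in frequency becomes decay in
time. -/
theorem wt_shift_le {b b' t ξ : ℝ} (hb' : 0 ≤ b') (hbb : b' ≤ b) (ht : 0 ≤ t) (hξ : 0 ≤ ξ) :
    wt b' ξ ^ 2 ≤ (1 + t) ^ (2 * (b' - b)) * wt b (ξ + t) ^ 2 := by
  have e1 : wt b (ξ + t) = wt b' (ξ + t) * wt (b - b') (ξ + t) := by
    unfold wt
    rw [← Real.rpow_add (by positivity)]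
    congr 1; ring
  have h2 : wt b' ξ ≤ wt b' (ξ + t) := wt_mono hb' hξ (by linarith)
  have h3 : (1 + t) ^ (b - b') ≤ wt (b - b') (ξ + t) := by
    unfold wt
    rw [abs_of_nonneg (by positivity)]
    exact Real.rpow_le_rpow (by positivity) (by linarith) (by linarith)
  have h4 : 0 < (1 + t) ^ (b - b') := Real.rpow_pos_of_pos (by positivity) _
  have e2 : (1 + t) ^ (2 * (b' - b)) = (((1 + t) ^ (b - b')) ^ 2)⁻¹ := by
    rw [← Real.rpow_natCast, ← Real.rpow_mul (by positivity), ← Real.rpow_neg (by positivity)]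
    congr 1
    push_cast
    ring
  rw [e2, e1, mul_pow, ← div_eq_inv_mul, le_div_iff₀ (by positivity)]
  exact mul_le_mul (pow_le_pow_left₀ (wt_pos _ _).le h2 2) (pow_le_pow_left₀ h4.le h3 2)
    (by positivity) (by positivity)

/-- The solution is the reduced evolution translated by `t`. The bounds follow from contractivity of
the reduced evolution, evaluated at `ξ + t` instead of `ξ`. -/
theorem exists_decaying_solution {b : ℝ} (hb : 0 ≤ b) (K r : ℝ) {v : ℕ → ℝ → ℂ} (hv : MemXp b v) :
    ∃ w C, IsDecayingSolution K r b v w C := by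
  obtain ⟨x, hx⟩ := hv.exists_isState
  obtain ⟨W, hW0, hWb, hWc, hWe⟩ := exists_reduced_evolution hb K r x
  have hWm : ∀ (m : ℕ) t, 0 ≤ t → ‖W t m‖ ≤ ‖x‖ := fun m t ht =>
    (lp.norm_apply_le_norm two_ne_zero (W t) m).trans (hWb t ht)
  have hWcm : ∀ (m : ℕ) (G : ModeSpace b →L[ℂ] ℂ), ContinuousOn (fun t => G (W t m)) (Ici 0) :=
    fun m G => hWc (G.comp (coordL m))
  have hYmem : ∀ t, 0 ≤ t → ∃ Y : StateSpace b, (∀ m, IsRep b (fun ξ => rep (W t m) (ξ + t)) (Y m)) ∧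
      ‖Y‖ ≤ ‖x‖ ∧ ∀ (m : ℕ) ψ (h : IsTest ψ), testL hb h.continuous h.compact (Y m) =
        translateL hb h.continuous h.compact t (W t m) := by
    intro t ht
    have hs := norm_sq_stateSpace (W t)
    have hle : ∀ m, ‖shiftL hb ht (W t m)‖ ^ 2 ≤ ‖W t m‖ ^ 2 := fun m =>
      pow_le_pow_left₀ (norm_nonneg _) (norm_shiftL_le hb ht _) 2
    have hs' : Summable fun m => ‖shiftL hb ht (W t m)‖ ^ 2 :=
      Summable.of_nonneg_of_le (fun _ => sq_nonneg _) hle hs.summable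
    let Y : StateSpace b := ⟨fun m => shiftL hb ht (W t m), memℓp_gen (by simpa using hs')⟩
    refine ⟨Y, fun m => isRep_shiftL hb ht _, ?_, fun m ψ h => testL_shiftL hb h ht _⟩
    refine le_trans ?_ (hWb t ht)
    rw [← sq_le_sq₀ (norm_nonneg _) (norm_nonneg _)]
    exact hasSum_le hle (norm_sq_stateSpace Y) hs
  choose! Y hYrep hYb hYt using hYmem
  set w : ℝ → ℕ → ℝ → ℂ := fun t ℓ ξ => rt (ℓ - 1) * rep (W t (ℓ - 1)) (ξ + t) with hw
  have hst : ∀ t, 0 ≤ t → IsState b (w t) (Y t) := fun t ht m => by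
    have : (rt m : ℂ)⁻¹ • w t (m + 1) = fun ξ => rep (W t m) (ξ + t) := by
      funext ξ
      simp only [hw, Pi.smul_apply, smul_eq_mul, Nat.add_sub_cancel]
      rw [inv_mul_cancel_left₀ (rt_ne_zero m)]
    rw [this]
    exact hYrep t ht m
  have hsep : ∀ z : StateSpace b, (∀ F ∈ {F : StateSpace b →L[ℂ] ℂ | ∃ (k : ℕ) (ψ : ℝ → ℝ)
      (h : IsTest ψ), F = (testL hb h.continuous h.compact).comp (coordL k)}, F z = 0) → z = 0 := by
    intro z hz
    ext1
    funext k
    exact eq_zero_of_testL hb (z k) fun ψ hψ => hz _ ⟨k, ψ, hψ, rfl⟩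
  have hYc : ∀ G : StateSpace b →L[ℂ] ℂ, ContinuousOn (fun t => G (Y t)) (Ici 0) := by
    refine continuousOn_of_separating hsep hYb ?_
    rintro F ⟨k, ψ, h, rfl⟩
    refine (continuousOn_apply_weak (continuous_translateL hb h) (hWm k) (hWcm k)).congr
      fun t ht => ?_
    exact hYt t ht k ψ h
  -- One constant for two estimates: `2 ‖x‖` is the Sobolev bound on values, `‖x‖²` the bound on
  -- squared norms.
  refine ⟨w, 2 * ‖x‖ + ‖x‖ ^ 2, by positivity, ⟨fun t ht => (hst t ht).memXp, fun T => ?_,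
    fun h hh => ?_, fun ℓ hℓ ξ hξ => ?_, ?_⟩, fun m t ξ ht hξ => ?_, fun b' t hb' hbb ht => ?_⟩
  · refine ⟨ENNReal.ofReal (‖x‖ ^ 2), ENNReal.ofReal_lt_top, fun t ht => ?_⟩
    rw [(hst t ht.1).xNormSq_eq]
    exact ENNReal.ofReal_le_ofReal (pow_le_pow_left₀ (norm_nonneg _) (hYb t ht.1) 2)
  · obtain ⟨y, hy⟩ := hh.exists_isState
    exact (hYc (innerSL ℂ y)).congr fun t ht => (hst t ht).xInner_eq hy
  · obtain ⟨m, rfl⟩ : ∃ m, ℓ = m + 1 := ⟨ℓ - 1, by omega⟩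
    rw [hx.rep_eq m hξ]
    simp [hw, hW0]
  · intro ℓ hℓ ψ h1 h2 h3 t ht
    obtain ⟨m, rfl⟩ : ∃ m, ℓ = m + 1 := ⟨ℓ - 1, by omega⟩
    have h : IsTest ψ := ⟨h1, h2, h3⟩
    let q : ℝ → ℂ := fun s =>
      -((m + 1 : ℕ) : ℂ) * translateL hb h.deriv.continuous h.deriv.compact s (W s m) +
        ((coef K r (m - 1) : ℂ) * translateL hb h.continuous h.compact s (prevL m (W s)) -
          (coef K r m : ℂ) * translateL hb h.continuous h.compact s (W s (m + 1)))
    have hcp : ∀ G : ModeSpace b →L[ℂ] ℂ, ContinuousOn (fun t => G (prevL m (W t))) (Ici 0) :=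
      fun G => hWc (G.comp (prevL m))
    have hprev : ∀ t, 0 ≤ t → ‖prevL m (W t)‖ ≤ ‖x‖ := fun t ht => by
      unfold prevL
      split_ifs
      · simp
      · exact hWm _ t ht
    have hqc : ContinuousOn q (Ici 0) :=
      (continuousOn_const.mul (continuousOn_apply_weak (continuous_translateL hb h.deriv)
        (hWm m) (hWcm m))).add ((continuousOn_const.mul (continuousOn_apply_weak
          (continuous_translateL hb h) hprev hcp)).sub (continuousOn_const.mul
            (continuousOn_apply_weak (continuous_translateL hb h) (hWm (m + 1)) (hWcm (m + 1)))))
    -- Product rule: moving the test function contributes one transport term, the reduced evolution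
    -- contributes `m` of them, in total the speed `ℓ = m + 1`.
    have hder : ∀ s, 0 < s →
        HasDerivAt (fun s => translateL hb h.continuous h.compact s (W s m)) (q s) s := by
      intro s hs
      have hT := h.shift hs.le
      let p : ℝ → ℂ := fun σ => (m : ℂ) * -testL hb hT.deriv.continuous hT.deriv.compact (W σ m) +
            ((coef K r (m - 1) : ℂ) * testL hb hT.continuous hT.compact (prevL m (W σ)) -
              (coef K r m : ℂ) * testL hb hT.continuous hT.compact (W σ (m + 1)))
      have hpc : ContinuousOn p (Ici 0) :=
        (continuousOn_const.mul (hWcm m _).neg).add ((continuousOn_const.mul (hcp _)).sub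
          (continuousOn_const.mul (hWcm (m + 1) _)))
      have hd : HasDerivAt (fun σ => translateL hb h.continuous h.compact s (W σ m)) (p s) s := by
        have h5 : HasDerivAt (fun σ => ∫ τ in (0 : ℝ)..σ, p τ) (p s) s := by
          refine intervalIntegral.integral_hasDerivAt_right ?_ ?_ ?_
          · exact (hpc.mono (by rw [uIcc_of_le hs.le]; exact Icc_subset_Ici_self)).intervalIntegrable
          · exact (hpc.mono Ioi_subset_Ici_self).stronglyMeasurableAtFilter isOpen_Ioi s hs
          · exact hpc.continuousAt (Ici_mem_nhds hs)
        refine (h5.const_add (testL hb hT.continuous hT.compact (x m))).congr_of_eventuallyEq ?_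
        filter_upwards [Ioi_mem_nhds hs] with σ hσ
        rw [translateL_eq_testL hb h hs.le]
        exact hWe m _ hT σ (le_of_lt hσ)
      have h6 := hasDerivAt_apply_weak (y := fun s => W s m) (hasDerivAt_translateL hb h s)
        (by filter_upwards [Ioi_mem_nhds hs] with σ hσ using hWm m σ (le_of_lt hσ))
        (((hWcm m _).neg.congr fun σ _ => rfl).continuousAt (Ici_mem_nhds hs)) hd
      refine h6.congr_deriv ?_
      simp only [q, p]
      rw [← translateL_deriv_eq_testL hb h hs.le, ← translateL_eq_testL hb h hs.le]
      simp only [_root_.neg_apply]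
      push_cast
      ring
    have hftc := intervalIntegral.integral_eq_sub_of_hasDerivAt_of_le ht
      ((continuousOn_apply_weak (continuous_translateL hb h) (hWm m) (hWcm m)).mono
        Icc_subset_Ici_self) (fun s hs => hder s hs.1)
      ((hqc.mono (by rw [uIcc_of_le ht]; exact Icc_subset_Ici_self)).intervalIntegrable)
    have e0 : ∫ ξ in Ioi (0 : ℝ), v (m + 1) ξ * (ψ ξ : ℂ) =
        rt m * translateL hb h.continuous h.compact 0 (W 0 m) := by
      rw [hx.integral_mul hb m h.continuous h.compact, hW0, translateL_zero]
    rw [(hst t ht).integral_mul hb m h.continuous h.compact, hYt t ht m ψ h, e0]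
    have e1 : ∀ s ∈ uIcc 0 t, (-((m + 1 : ℕ) : ℂ) * (∫ ξ in Ioi (0 : ℝ), w s (m + 1) ξ *
        ((deriv ψ ξ : ℝ) : ℂ)) + (K * ((m + 1 : ℕ) : ℂ) / 2 : ℂ) *
          ∫ ξ in Ioi (0 : ℝ), (r * lowerMode (w s) (m + 1) ξ - r * w s (m + 1 + 1) ξ) *
            (ψ ξ : ℂ)) = rt m * q s := by
      intro s hs
      rw [uIcc_of_le ht] at hs
      rw [(hst s hs.1).integral_mul hb m h.deriv.continuous h.deriv.compact,
        (hst s hs.1).integral_interaction hb K r m h.continuous h.compact,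
        hYt s hs.1 m _ h.deriv, hYt s hs.1 (m + 1) _ h]
      have e3 : testL hb h.continuous h.compact (prevL m (Y s)) =
          translateL hb h.continuous h.compact s (prevL m (W s)) := by
        unfold prevL
        split_ifs
        · simp
        · exact hYt s hs.1 (m - 1) ψ h
      rw [e3]
      simp only [q]
      ring
    rw [intervalIntegral.integral_congr e1, intervalIntegral.integral_const_mul, hftc]
    ring
  · simp only [hw, Nat.add_sub_cancel]
    have h1 := (isRep_rep (W t m)).norm_le hb (add_nonneg hξ ht)
    have h2 : (1 + t) ^ b ≤ wt b (ξ + t) := by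
      unfold wt
      rw [abs_of_nonneg (by positivity)]
      exact Real.rpow_le_rpow (by positivity) (by linarith) hb
    have h3 : 0 < (1 + t) ^ b := Real.rpow_pos_of_pos (by positivity) _
    rw [norm_mul, Complex.norm_real, Real.norm_of_nonneg (rt_pos m).le,
      Real.rpow_neg (by positivity), ← div_eq_mul_inv, le_div_iff₀ h3]
    have h4 : ‖rep (W t m) (ξ + t)‖ * (1 + t) ^ b ≤ 2 * ‖x‖ + ‖x‖ ^ 2 := by
      have := mul_le_mul_of_nonneg_right h2 (norm_nonneg (rep (W t m) (ξ + t)))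
      nlinarith [hWm m t ht, norm_nonneg x]
    calc rt m * ‖rep (W t m) (ξ + t)‖ * (1 + t) ^ b
        = rt m * (‖rep (W t m) (ξ + t)‖ * (1 + t) ^ b) := by ring
      _ ≤ rt m * (2 * ‖x‖ + ‖x‖ ^ 2) := mul_le_mul_of_nonneg_left h4 (rt_pos m).le
      _ = _ := by ring
  · have hp : 0 < (1 + t) ^ (2 * (b' - b)) := Real.rpow_pos_of_pos (by positivity) _
    have h1 : ∀ m : ℕ, ∫⁻ ξ in Ioi (0 : ℝ), ENNReal.ofReal (‖w t (m + 1) ξ‖ ^ 2 * wt b' ξ ^ 2 /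
        ((m : ℝ) + 1)) ≤ ENNReal.ofReal ((1 + t) ^ (2 * (b' - b))) *
          ENNReal.ofReal (‖W t m‖ ^ 2) := by
      intro m
      rw [(isRep_rep (W t m)).ofReal_norm_sq, ← lintegral_const_mul' _ _ ENNReal.ofReal_ne_top]
      calc _ ≤ ∫⁻ ξ in Ioi (0 : ℝ), ENNReal.ofReal ((1 + t) ^ (2 * (b' - b))) *
            ENNReal.ofReal ((‖rep (W t m) (ξ + t)‖ ^ 2 + ‖deriv (rep (W t m)) (ξ + t)‖ ^ 2) *
              wt b (ξ + t) ^ 2) := by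
            refine setLIntegral_mono' measurableSet_Ioi fun ξ hξ => ?_
            rw [← ENNReal.ofReal_mul hp.le]
            refine ENNReal.ofReal_le_ofReal ?_
            simp only [hw, Nat.add_sub_cancel]
            rw [norm_mul, Complex.norm_real, Real.norm_of_nonneg (rt_pos m).le, mul_pow, rt_sq]
            have h2 := wt_shift_le hb' hbb ht (le_of_lt hξ)
            have h3 := sq_nonneg ‖rep (W t m) (ξ + t)‖
            have h4 := mul_le_mul_of_nonneg_left h2 h3
            have h5 : 0 ≤ (1 + t) ^ (2 * (b' - b)) * (‖deriv (rep (W t m)) (ξ + t)‖ ^ 2 *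
              wt b (ξ + t) ^ 2) := by positivity
            rw [mul_assoc, mul_div_cancel_left₀]
            · nlinarith
            · positivity
        _ = ∫⁻ ξ in Ioi t, ENNReal.ofReal ((1 + t) ^ (2 * (b' - b))) *
            ENNReal.ofReal ((‖rep (W t m) ξ‖ ^ 2 + ‖deriv (rep (W t m)) ξ‖ ^ 2) *
              wt b ξ ^ 2) :=
            (measurePreserving_add_Ioi t).lintegral_comp_emb (measurableEmbedding_addRight t)
              (fun ξ => ENNReal.ofReal ((1 + t) ^ (2 * (b' - b))) *
                ENNReal.ofReal ((‖rep (W t m) ξ‖ ^ 2 + ‖deriv (rep (W t m)) ξ‖ ^ 2) * wt b ξ ^ 2))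
        _ ≤ _ := lintegral_mono_set (Ioi_subset_Ioi ht)
    calc l2NormSq b' (w t) ≤ ∑' m : ℕ, ENNReal.ofReal ((1 + t) ^ (2 * (b' - b))) *
          ENNReal.ofReal (‖W t m‖ ^ 2) := ENNReal.tsum_le_tsum h1
      _ = ENNReal.ofReal ((1 + t) ^ (2 * (b' - b))) * ENNReal.ofReal (‖W t‖ ^ 2) := by
          rw [ENNReal.tsum_mul_left, ← (norm_sq_stateSpace (W t)).tsum_eq,
            ENNReal.ofReal_tsum_of_nonneg (fun m => sq_nonneg _)
              (norm_sq_stateSpace (W t)).summable]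
      _ ≤ _ := by
          rw [← ENNReal.ofReal_mul hp.le, mul_comm]
          refine ENNReal.ofReal_le_ofReal (mul_le_mul_of_nonneg_right ?_ hp.le)
          have := pow_le_pow_left₀ (norm_nonneg _) (hWb t ht) 2
          linarith [norm_nonneg x]

/-! ### Superpositions in time -/

theorem lintegral_mul_sq_le {α : Type*} [MeasurableSpace α] {μ : Measure α} {f g : α → ℝ≥0∞}
    (hf : AEMeasurable f μ) (hg : AEMeasurable g μ) :
    (∫⁻ a, f a * g a ∂μ) ^ 2 ≤ (∫⁻ a, f a ^ 2 ∂μ) * ∫⁻ a, g a ^ 2 ∂μ := by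
  have h := ENNReal.lintegral_mul_le_Lp_mul_Lq μ Real.HolderConjugate.two_two hf hg
  have h2 := pow_le_pow_left₀ (zero_le) h 2
  refine h2.trans_eq ?_
  rw [mul_pow, ← ENNReal.rpow_natCast, ← ENNReal.rpow_natCast, ← ENNReal.rpow_mul,
    ← ENNReal.rpow_mul]
  norm_num

/-- A time-dependent family of continuous functions that is dominated uniformly in space. -/
structure IsDominated (μ : Measure ℝ) (f : ℝ → ℝ → ℂ) (G : ℝ → ℝ) : Prop where
  measurable : StronglyMeasurable (Function.uncurry f)
  continuous : ∀ s, Continuous (f s)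
  integrable : Integrable G μ
  bound : ∀ᵐ s ∂μ, ∀ ξ, ‖f s ξ‖ ≤ G s

namespace IsDominated

variable {μ : Measure ℝ} {f : ℝ → ℝ → ℂ} {G : ℝ → ℝ}

theorem aestronglyMeasurable (h : IsDominated μ f G) (ξ : ℝ) :
    AEStronglyMeasurable (fun s => f s ξ) μ :=
  (h.measurable.comp_measurable (measurable_id.prodMk measurable_const)).aestronglyMeasurable

theorem integrable_apply (h : IsDominated μ f G) (ξ : ℝ) : Integrable (fun s => f s ξ) μ :=
  h.integrable.mono' (h.aestronglyMeasurable ξ) (h.bound.mono fun _ hs => hs ξ)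

theorem continuous_integral (h : IsDominated μ f G) : Continuous fun ξ => ∫ s, f s ξ ∂μ :=
  continuous_of_dominated h.aestronglyMeasurable (fun ξ => h.bound.mono fun _ hs => hs ξ)
    h.integrable (Eventually.of_forall h.continuous)

theorem integrable_prod (h : IsDominated μ f G) {φ : ℝ → ℂ} (hφ : Integrable φ halfLine) :
    Integrable (Function.uncurry fun s ξ => f s ξ * φ ξ) (μ.prod halfLine) := by
  refine (h.integrable.mul_prod hφ.norm).mono'
    (h.measurable.aestronglyMeasurable.mul hφ.aestronglyMeasurable.comp_snd) ?_
  filter_upwards [Measure.quasiMeasurePreserving_fst.ae h.bound] with z hz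
  simp only [Function.uncurry, norm_mul]
  exact mul_le_mul_of_nonneg_right (hz _) (norm_nonneg _)

theorem integral_swap [SFinite μ] (h : IsDominated μ f G) {φ : ℝ → ℂ} (hφ : Integrable φ halfLine) :
    ∫ ξ in Ioi (0 : ℝ), (∫ s, f s ξ ∂μ) * φ ξ = ∫ s, (∫ ξ in Ioi (0 : ℝ), f s ξ * φ ξ) ∂μ := by
  rw [integral_integral_swap (h.integrable_prod hφ)]
  simp only [integral_mul_const]

theorem integrable_integral (h : IsDominated μ f G) {φ : ℝ → ℂ} (hφ : Integrable φ halfLine) :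
    Integrable (fun s => ∫ ξ in Ioi (0 : ℝ), f s ξ * φ ξ) μ :=
  (h.integrable_prod hφ).integral_prod_left

end IsDominated

theorem ofReal_l2_term (b : ℝ) (z : ℂ) (m : ℕ) (ξ : ℝ) :
    ENNReal.ofReal (‖z‖ ^ 2 * wt b ξ ^ 2 / ((m : ℝ) + 1)) =
      ENNReal.ofReal (wt b ξ ^ 2 / ((m : ℝ) + 1)) * ‖z‖ₑ ^ 2 := by
  rw [mul_div_assoc, ENNReal.ofReal_mul (by positivity), ENNReal.ofReal_pow (norm_nonneg _),
    ofReal_norm, mul_comm]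

theorem l2NormSq_eq (b : ℝ) (u : ℕ → ℝ → ℂ) :
    l2NormSq b u = ∑' m : ℕ, ∫⁻ ξ in Ioi (0 : ℝ),
      ENNReal.ofReal (wt b ξ ^ 2 / ((m : ℝ) + 1)) * ‖u (m + 1) ξ‖ₑ ^ 2 := by
  unfold l2NormSq
  simp only [ofReal_l2_term]

theorem measurable_l2_weight (b : ℝ) (m : ℕ) :
    Measurable fun ξ => ENNReal.ofReal (wt b ξ ^ 2 / ((m : ℝ) + 1)) :=
  ((((continuous_wt b).pow 2).div_const _).measurable).ennreal_ofReal

/-- Minkowski's inequality, in the form of a weighted Cauchy-Schwarz inequality in time. -/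
theorem lintegral_weight_integral_sq_le {μ : Measure ℝ} [SFinite μ] {f w : ℝ → ℝ → ℂ}
    {α β c : ℝ → ℝ≥0∞} (hα : Measurable α) (hβ : Measurable β) (hc : Measurable c)
    (hw : StronglyMeasurable (Function.uncurry w))
    (h : ∀ᵐ s ∂μ, ∀ ξ, ‖f s ξ‖ₑ ≤ α s * (β s * ‖w s ξ‖ₑ)) :
    ∫⁻ ξ in Ioi (0 : ℝ), c ξ * ‖∫ s, f s ξ ∂μ‖ₑ ^ 2 ≤
      (∫⁻ s, α s ^ 2 ∂μ) * ∫⁻ s, β s ^ 2 * (∫⁻ ξ in Ioi (0 : ℝ), c ξ * ‖w s ξ‖ₑ ^ 2) ∂μ := by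
  have hwm : Measurable fun p : ℝ × ℝ => ‖w p.1 p.2‖ₑ := hw.measurable.enorm
  have hwξ : ∀ ξ, Measurable fun s => ‖w s ξ‖ₑ := fun ξ =>
    hwm.comp (measurable_id.prodMk measurable_const)
  have hB : Measurable fun p : ℝ × ℝ => c p.2 * ‖w p.1 p.2‖ₑ ^ 2 :=
    (hc.comp measurable_snd).mul (hwm.pow_const 2)
  have hA : Measurable (Function.uncurry fun ξ s => β s ^ 2 * (c ξ * ‖w s ξ‖ₑ ^ 2)) :=
    ((hβ.comp measurable_snd).pow_const 2).mul (hB.comp measurable_swap)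
  -- Cauchy-Schwarz in time at fixed frequency, with the majorant split as `α` times `β |w|`. The
  -- weight in `ξ` enters only afterwards, through Tonelli.
  have h1 : ∀ ξ, ‖∫ s, f s ξ ∂μ‖ₑ ^ 2 ≤
      (∫⁻ s, α s ^ 2 ∂μ) * ∫⁻ s, β s ^ 2 * ‖w s ξ‖ₑ ^ 2 ∂μ := by
    intro ξ
    have h2 : ‖∫ s, f s ξ ∂μ‖ₑ ≤ ∫⁻ s, α s * (β s * ‖w s ξ‖ₑ) ∂μ :=
      (enorm_integral_le_lintegral_enorm _).trans (lintegral_mono_ae (h.mono fun s hs => hs ξ))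
    refine (pow_le_pow_left₀ (zero_le) h2 2).trans
      ((lintegral_mul_sq_le hα.aemeasurable (hβ.mul (hwξ ξ)).aemeasurable).trans_eq ?_)
    congr 1
    exact lintegral_congr fun s => mul_pow _ _ 2
  have h2 : ∀ ξ, c ξ * ‖∫ s, f s ξ ∂μ‖ₑ ^ 2 ≤
      (∫⁻ s, α s ^ 2 ∂μ) * ∫⁻ s, β s ^ 2 * (c ξ * ‖w s ξ‖ₑ ^ 2) ∂μ := by
    intro ξ
    refine (mul_le_mul_right (h1 ξ) _).trans_eq ?_
    rw [mul_left_comm, ← lintegral_const_mul (f := fun s => β s ^ 2 * ‖w s ξ‖ₑ ^ 2) _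
      ((hβ.pow_const 2).mul ((hwξ ξ).pow_const 2))]
    congr 1
    exact lintegral_congr fun s => mul_left_comm _ _ _
  refine (lintegral_mono h2).trans_eq ?_
  have hs' : Measurable fun ξ => ∫⁻ s, β s ^ 2 * (c ξ * ‖w s ξ‖ₑ ^ 2) ∂μ :=
    hA.lintegral_prod_right
  rw [lintegral_const_mul _ hs']
  congr 1
  rw [lintegral_lintegral_swap hA.aemeasurable]
  refine lintegral_congr fun s => ?_
  have hs2 : Measurable fun ξ => c ξ * ‖w s ξ‖ₑ ^ 2 :=
    hB.comp (measurable_const.prodMk measurable_id)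
  rw [lintegral_const_mul _ hs2]

/-- The time weights `α` and `β` do not depend on the mode, so the estimates for single modes can be
summed. -/
theorem l2NormSq_integral_le {μ : Measure ℝ} [SFinite μ] (b : ℝ) {f w : ℝ → ℕ → ℝ → ℂ}
    {α β : ℝ → ℝ≥0∞} (hα : Measurable α) (hβ : Measurable β)
    (hw : ∀ ℓ, StronglyMeasurable (Function.uncurry fun s ξ => w s ℓ ξ))
    (h : ∀ᵐ s ∂μ, ∀ ℓ ξ, ‖f s ℓ ξ‖ₑ ≤ α s * (β s * ‖w s ℓ ξ‖ₑ)) :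
    l2NormSq b (fun ℓ ξ => ∫ s, f s ℓ ξ ∂μ) ≤
      (∫⁻ s, α s ^ 2 ∂μ) * ∫⁻ s, β s ^ 2 * l2NormSq b (w s) ∂μ := by
  have hs : ∀ m : ℕ, Measurable fun s => β s ^ 2 * ∫⁻ ξ in Ioi (0 : ℝ),
      ENNReal.ofReal (wt b ξ ^ 2 / ((m : ℝ) + 1)) * ‖w s (m + 1) ξ‖ₑ ^ 2 := fun m => by
    have hB : Measurable fun p : ℝ × ℝ =>
        ENNReal.ofReal (wt b p.2 ^ 2 / ((m : ℝ) + 1)) * ‖w p.1 (m + 1) p.2‖ₑ ^ 2 :=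
      ((measurable_l2_weight b m).comp measurable_snd).mul
        ((hw (m + 1)).measurable.enorm.pow_const 2)
    exact (hβ.pow_const 2).mul hB.lintegral_prod_right'
  have h1 : ∀ m : ℕ, _ := fun m => lintegral_weight_integral_sq_le (f := fun s => f s (m + 1))
    hα hβ (measurable_l2_weight b m) (hw (m + 1)) (h.mono fun s hs ξ => hs (m + 1) ξ)
  rw [l2NormSq_eq]
  refine (ENNReal.tsum_le_tsum h1).trans_eq ?_
  rw [ENNReal.tsum_mul_left, ← lintegral_tsum fun m => (hs m).aemeasurable]
  congr 1
  refine lintegral_congr fun s => ?_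
  rw [l2NormSq_eq, ENNReal.tsum_mul_left]

/-! ### Regularity of weak solutions -/

/-- Continuous extension of a solution to all times and frequencies. -/
def normalize (w : ℝ → ℕ → ℝ → ℂ) (t : ℝ) (ℓ : ℕ) (ξ : ℝ) : ℂ :=
  if ℓ = 0 then 0 else w (max t 0) ℓ (max ξ 0)

theorem normalize_succ (w : ℝ → ℕ → ℝ → ℂ) {t ξ : ℝ} (m : ℕ) (ht : 0 ≤ t) (hξ : 0 ≤ ξ) :
    normalize w t (m + 1) ξ = w t (m + 1) ξ := by
  simp [normalize, ht, hξ]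

theorem lowerMode_eq_normalize (w : ℝ → ℕ → ℝ → ℂ) {t ξ : ℝ} (m : ℕ) (ht : 0 ≤ t) (hξ : 0 ≤ ξ) :
    lowerMode (w t) (m + 1) ξ = normalize w t m ξ := by
  rcases m with _ | m
  · simp [normalize, lowerMode]
  · rw [normalize_succ w m ht hξ]; simp [lowerMode]

/-- Weak solutions that are separately continuous. -/
structure IsRegularSolution (K r : ℝ) (u : ℝ → ℕ → ℝ → ℂ) : Prop where
  zero : ∀ t ξ, u t 0 ξ = 0
  continuous_time : ∀ ℓ ξ, Continuous fun t => u t ℓ ξ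
  continuous : ∀ t ℓ, Continuous (u t ℓ)
  bound : ∀ T : ℝ, ∃ C : ℝ, 0 ≤ C ∧ ∀ t ≤ T, ∀ m ξ, ‖u t m ξ‖ ≤ C * rt m
  l2NormSq_le : ∀ T : ℝ, ∃ C : ℝ≥0∞, C < ⊤ ∧ ∀ t ≤ T, l2NormSq 0 (u t) ≤ C
  equation : ∀ (m : ℕ) ψ, IsTest ψ → ∀ t : ℝ, 0 ≤ t →
    ∫ ξ in Ioi (0 : ℝ), u t (m + 1) ξ * (ψ ξ : ℂ) =
      (∫ ξ in Ioi (0 : ℝ), u 0 (m + 1) ξ * (ψ ξ : ℂ)) +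
        ∫ s in (0 : ℝ)..t,
          (-((m : ℂ) + 1) * (∫ ξ in Ioi (0 : ℝ), u s (m + 1) ξ * ((deriv ψ ξ : ℝ) : ℂ)) +
            (K * r / 2 * ((m : ℂ) + 1)) * ((∫ ξ in Ioi (0 : ℝ), u s m ξ * (ψ ξ : ℂ)) -
              ∫ ξ in Ioi (0 : ℝ), u s (m + 2) ξ * (ψ ξ : ℂ)))

theorem IsRegularSolution.stronglyMeasurable {K r : ℝ} {u : ℝ → ℕ → ℝ → ℂ}
    (h : IsRegularSolution K r u) (ℓ : ℕ) :
    StronglyMeasurable (Function.uncurry fun s ξ => u s ℓ ξ) :=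
  stronglyMeasurable_uncurry_of_continuous_of_stronglyMeasurable (h.continuous_time ℓ)
    fun t => (h.continuous t ℓ).stronglyMeasurable

theorem rt_le_rt_succ (m : ℕ) : rt m ≤ rt (m + 1) := by
  unfold rt
  exact Real.sqrt_le_sqrt (by push_cast; linarith)

theorem l2NormSq_le_xNormSq {b : ℝ} (hb : 0 ≤ b) (u : ℕ → ℝ → ℂ) :
    l2NormSq 0 u ≤ xNormSq (weight b) (-1 / 2) u := by
  refine ENNReal.tsum_le_tsum fun m => setLIntegral_mono' measurableSet_Ioi fun ξ hξ => ?_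
  refine ENNReal.ofReal_le_ofReal ?_
  have e : ((m : ℝ) + 1) ^ (2 * (-1 / 2) : ℝ) = ((m : ℝ) + 1)⁻¹ := by
    rw [show (2 * (-1 / 2) : ℝ) = -1 by norm_num, Real.rpow_neg_one]
  rw [e, ← wt_eq_weight (le_of_lt hξ), ← div_eq_mul_inv]
  have h0 : wt 0 ξ = 1 := by simp [wt]
  rw [h0]
  refine div_le_div_of_nonneg_right ?_ (by positivity)
  have := one_le_pow₀ (one_le_wt hb ξ) (n := 2)
  nlinarith [sq_nonneg ‖u (m + 1) ξ‖, sq_nonneg ‖deriv (u (m + 1)) ξ‖]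

/-- Evaluation at a frequency is a bounded functional on the state space. Its Riesz representative
is itself a state, against which weak continuity is assumed. -/
theorem IsWeakSolution.continuousOn_time {K r b : ℝ} (hb : 0 ≤ b) {v : ℕ → ℝ → ℂ}
    {w : ℝ → ℕ → ℝ → ℂ} (h : IsWeakSolution K r b v w) (m : ℕ) {ξ : ℝ} (hξ : 0 ≤ ξ) :
    ContinuousOn (fun t => w t (m + 1) ξ) (Ici 0) := by
  set F : StateSpace b →L[ℂ] ℂ := (evalL hb hξ).comp (coordL m) with hF
  obtain ⟨f, hf⟩ := exists_isState_of_stateSpace ((InnerProductSpace.toDual ℂ (StateSpace b)).symm F)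
  refine ((h.weakly_continuous f hf.memXp).const_smul (rt m : ℂ)).congr fun t ht => ?_
  obtain ⟨x, hx⟩ := (h.mem t ht).exists_isState
  change _ = (rt m : ℂ) * xInner _ _ _ _
  rw [hx.xInner_eq hf, InnerProductSpace.toDual_symm_apply, hx.rep_eq m hξ]
  rfl

theorem IsWeakSolution.isRegularSolution {K r b : ℝ} (hb : 0 ≤ b) {v : ℕ → ℝ → ℂ}
    {w : ℝ → ℕ → ℝ → ℂ} (h : IsWeakSolution K r b v w) : IsRegularSolution K r (normalize w) where
  zero t ξ := by simp [normalize]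
  continuous_time ℓ ξ := by
    rcases ℓ with _ | m
    · simpa [normalize] using continuous_const
    · have h1 := (h.continuousOn_time hb m (le_max_right ξ 0)).comp_continuous
        (continuous_id.max continuous_const) (fun t => le_max_right t 0)
      exact h1.congr fun t => by simp [normalize]
  continuous t ℓ := by
    rcases ℓ with _ | m
    · exact (continuous_const (y := (0 : ℂ))).congr fun ξ => by simp [normalize]
    · obtain ⟨x, hx⟩ := (h.mem _ (le_max_right t 0)).exists_isState
      have h1 := (hx.prim m).continuousOn.comp_continuous
        (continuous_id.max continuous_const) (fun t => le_max_right t 0)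
      exact h1.congr fun ξ => by simp [normalize]
  bound T := by
    obtain ⟨C, hC, hb1⟩ := h.locally_bounded (max T 0)
    refine ⟨2 * Real.sqrt C.toReal, by positivity, fun t ht m ξ => ?_⟩
    rcases m with _ | m
    · simp only [normalize, if_true, norm_zero]
      exact mul_nonneg (by positivity) (rt_pos 0).le
    have ht' : max t 0 ∈ Icc 0 (max T 0) := ⟨le_max_right _ _, max_le_max_right _ ht⟩
    obtain ⟨x, hx⟩ := (h.mem _ ht'.1).exists_isState
    have h2 := hb1 _ ht'
    rw [hx.xNormSq_eq] at h2
    have h3 : ‖x‖ ≤ Real.sqrt C.toReal := Real.le_sqrt_of_sq_le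
      ((ENNReal.ofReal_le_iff_le_toReal hC.ne).1 h2)
    have h4 : ‖x m‖ ≤ ‖x‖ := lp.norm_apply_le_norm two_ne_zero x m
    have h5 := norm_rep_le hb (x m) (le_max_right ξ 0)
    simp only [normalize, Nat.succ_ne_zero, if_false]
    rw [hx.rep_eq m (le_max_right ξ 0), norm_mul, Complex.norm_real,
      Real.norm_of_nonneg (rt_pos m).le, mul_comm]
    exact mul_le_mul (by linarith) (rt_le_rt_succ m) (rt_pos m).le (by positivity)
  l2NormSq_le T := by
    obtain ⟨C, hC, hb1⟩ := h.locally_bounded (max T 0)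
    refine ⟨C, hC, fun t ht => ?_⟩
    have ht' : max t 0 ∈ Icc 0 (max T 0) := ⟨le_max_right _ _, max_le_max_right _ ht⟩
    refine le_trans (le_of_eq ?_) ((l2NormSq_le_xNormSq hb _).trans (hb1 _ ht'))
    refine tsum_congr fun m => setLIntegral_congr_fun measurableSet_Ioi fun ξ hξ => ?_
    simp [normalize, le_of_lt (mem_Ioi.1 hξ)]
  equation m ψ hψ t ht := by
    have e : ∀ (φ : ℝ → ℝ) (k : ℕ) (s : ℝ), 0 ≤ s →
        ∫ ξ in Ioi (0 : ℝ), normalize w s (k + 1) ξ * (φ ξ : ℂ) =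
          ∫ ξ in Ioi (0 : ℝ), w s (k + 1) ξ * (φ ξ : ℂ) := fun φ k s hs =>
      setIntegral_congr_fun measurableSet_Ioi fun ξ hξ => by
        simp only [normalize_succ w k hs (le_of_lt hξ)]
    have h1 := h.equation (m + 1) (by omega) ψ hψ.smooth hψ.compact hψ.supp t ht
    have e0 : ∫ ξ in Ioi (0 : ℝ), v (m + 1) ξ * (ψ ξ : ℂ) =
        ∫ ξ in Ioi (0 : ℝ), w 0 (m + 1) ξ * (ψ ξ : ℂ) :=
      setIntegral_congr_fun measurableSet_Ioi fun ξ hξ => by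
        simp only [h.initial (m + 1) (by omega) ξ (le_of_lt hξ)]
    rw [e _ m t ht, e _ m 0 le_rfl, h1, e0]
    congr 1
    refine intervalIntegral.integral_congr fun s hs => ?_
    rw [uIcc_of_le ht] at hs
    obtain ⟨x, hx⟩ := (h.mem s hs.1).exists_isState
    rw [e _ m s hs.1, e _ (m + 1) s hs.1]
    have i2 := (hx.integrable_mul (m + 1) hψ.continuous hψ.compact)
    have i1 : Integrable (fun ξ => normalize w s m ξ * (ψ ξ : ℂ)) halfLine := by
      rcases m with _ | m
      · simp [normalize]
      · refine (hx.integrable_mul m hψ.continuous hψ.compact).congr ?_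
        filter_upwards [ae_restrict_mem measurableSet_Ioi] with ξ hξ
        rw [normalize_succ w m hs.1 (le_of_lt hξ)]
    have e3 : ∫ ξ in Ioi (0 : ℝ), (r * lowerMode (w s) (m + 1) ξ - r * w s (m + 1 + 1) ξ) *
        (ψ ξ : ℂ) = r * ((∫ ξ in Ioi (0 : ℝ), normalize w s m ξ * (ψ ξ : ℂ)) -
          ∫ ξ in Ioi (0 : ℝ), w s (m + 1 + 1) ξ * (ψ ξ : ℂ)) := by
      rw [← integral_sub i1 i2, ← integral_const_mul]
      refine setIntegral_congr_fun measurableSet_Ioi fun ξ hξ => ?_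
      simp only [lowerMode_eq_normalize w m hs.1 (le_of_lt hξ)]
      ring
    rw [e3]
    push_cast
    ring

/-! ### Uniqueness of weak solutions -/

theorem integrable_continuous_mul {f : ℝ → ℂ} (hf : Continuous f) {ψ : ℝ → ℝ} (hψ : Continuous ψ)
    (hc : HasCompactSupport ψ) : Integrable (fun ξ => f ξ * (ψ ξ : ℂ)) halfLine := by
  have h : Continuous fun ξ => f ξ * (ψ ξ : ℂ) := hf.mul (Complex.continuous_ofReal.comp hψ)
  refine (h.integrable_of_hasCompactSupport ?_).integrableOn
  exact (hc.comp_left (g := fun x : ℝ => (x : ℂ)) Complex.ofReal_zero).mul_left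

theorem integrable_ofReal_test {ψ : ℝ → ℝ} (hψ : Continuous ψ) (hc : HasCompactSupport ψ) :
    Integrable (fun ξ => (ψ ξ : ℂ)) halfLine :=
  ((hψ.integrable_of_hasCompactSupport hc).integrableOn (s := Ioi 0)).ofReal

theorem isDominated_Ioc {f : ℝ → ℝ → ℂ} (hf : StronglyMeasurable (Function.uncurry f))
    (hc : ∀ s, Continuous (f s)) {t C : ℝ} (hC : ∀ s ≤ t, ∀ ξ, ‖f s ξ‖ ≤ C) :
    IsDominated (volume.restrict (Ioc 0 t)) f fun _ => C :=
  ⟨hf, hc, integrable_const C, by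
    filter_upwards [ae_restrict_mem measurableSet_Ioc] with s hs ξ using hC s hs.2 ξ⟩

theorem memLp_of_l2NormSq_lt_top {u : ℕ → ℝ → ℂ} {m : ℕ} (hc : Continuous (u (m + 1)))
    (h : l2NormSq 0 u < ⊤) : MemLp (u (m + 1)) 2 halfLine := by
  have h1 : ∫⁻ ξ in Ioi (0 : ℝ), ENNReal.ofReal (‖u (m + 1) ξ‖ ^ 2 * wt 0 ξ ^ 2 / ((m : ℝ) + 1)) <
      ⊤ := (ENNReal.le_tsum m).trans_lt h
  have h2 := memLp_two_of_lintegral (b := 0) (f := ((rt m : ℂ)⁻¹ • u (m + 1)))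
    (G := fun ξ => ‖u (m + 1) ξ‖ ^ 2 * wt 0 ξ ^ 2 / ((m : ℝ) + 1))
    (hc.const_smul _).aestronglyMeasurable (fun ξ => by
      simp only [Pi.smul_apply, norm_smul, norm_inv, Complex.norm_real,
        Real.norm_of_nonneg (rt_pos m).le, mul_pow, inv_pow, rt_sq]
      exact le_of_eq (by ring)) h1
  refine (h2.const_smul (rt m : ℂ)).ae_eq (Eventually.of_forall fun ξ => ?_)
  have := rt_ne_zero m
  simp [wt, this]

theorem l2NormSq_le_of_norm_le (b : ℝ) {f g h : ℕ → ℝ → ℂ} (hg : ∀ ℓ, Measurable (g ℓ))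
    (hle : ∀ m ξ, ‖f (m + 1) ξ‖ ≤ ‖g (m + 1) ξ‖ + ‖h (m + 1) ξ‖) :
    l2NormSq b f ≤ 2 * l2NormSq b g + 2 * l2NormSq b h := by
  unfold l2NormSq
  rw [← ENNReal.tsum_mul_left, ← ENNReal.tsum_mul_left, ← ENNReal.tsum_add]
  refine ENNReal.tsum_le_tsum fun m => ?_
  rw [← lintegral_const_mul' _ _ (by simp), ← lintegral_const_mul' _ _ (by simp),
    ← lintegral_add_left (by
      have := ((hg (m + 1)).norm.pow_const 2).mul ((continuous_wt b).pow 2).measurable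
      exact ((this.div_const _).ennreal_ofReal).const_mul 2)]
  refine lintegral_mono fun ξ => ?_
  have e2 : (2 : ℝ≥0∞) = ENNReal.ofReal 2 := by simp
  rw [e2, ← ENNReal.ofReal_mul (by norm_num), ← ENNReal.ofReal_mul (by norm_num),
    ← ENNReal.ofReal_add (by positivity) (by positivity)]
  refine ENNReal.ofReal_le_ofReal ?_
  rw [← mul_div_assoc, ← mul_div_assoc, ← add_div]
  refine div_le_div_of_nonneg_right ?_ (by positivity)
  have h4 : ‖f (m + 1) ξ‖ ^ 2 ≤ 2 * ‖g (m + 1) ξ‖ ^ 2 + 2 * ‖h (m + 1) ξ‖ ^ 2 := by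
    nlinarith [hle m ξ, norm_nonneg (f (m + 1) ξ), sq_nonneg (‖g (m + 1) ξ‖ - ‖h (m + 1) ξ‖)]
  nlinarith [sq_nonneg (wt b ξ)]

/-- `∫_0^∞ |f|²`. -/
noncomputable def energy (f : ℝ → ℂ) : ℝ := ∫ ξ in Ioi (0 : ℝ), ‖f ξ‖ ^ 2

theorem energy_nonneg (f : ℝ → ℂ) : 0 ≤ energy f := integral_nonneg fun _ => sq_nonneg _

theorem sum_energy_le {u : ℕ → ℝ → ℂ} (hc : ∀ ℓ, Continuous (u ℓ)) {C : ℝ≥0∞} (hC : C < ⊤)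
    (h : l2NormSq 0 u ≤ C) (N : ℕ) :
    ∑ m ∈ Finset.range N, energy (u (m + 1)) / ((m : ℝ) + 1) ≤ C.toReal := by
  have h1 : ∀ m : ℕ, ENNReal.ofReal (energy (u (m + 1)) / ((m : ℝ) + 1)) =
      ∫⁻ ξ in Ioi (0 : ℝ), ENNReal.ofReal (‖u (m + 1) ξ‖ ^ 2 * wt 0 ξ ^ 2 / ((m : ℝ) + 1)) := by
    intro m
    have hm := memLp_of_l2NormSq_lt_top (hc (m + 1)) (h.trans_lt hC)
    have hi := ((memLp_two_iff_integrable_sq_norm hm.aestronglyMeasurable).1 hm).div_const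
      ((m : ℝ) + 1)
    unfold energy
    rw [← integral_div, ofReal_integral_eq_lintegral_ofReal hi
      (Eventually.of_forall fun ξ => by positivity)]
    refine lintegral_congr fun ξ => ?_
    simp [wt]
  rw [← ENNReal.ofReal_le_iff_le_toReal hC.ne, ENNReal.ofReal_sum_of_nonneg
    (fun m _ => div_nonneg (energy_nonneg _) (by positivity))]
  simp only [h1]
  exact (ENNReal.sum_le_tsum _).trans h

/-- A bounded curve in `L²` that is jointly measurable is square integrable in space-time. -/
theorem memLp_prod_of_le {f : ℝ → ℝ → ℂ} (hf : StronglyMeasurable (Function.uncurry f)) {t C : ℝ}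
    (hL : ∀ s ∈ Ioc 0 t, MemLp (f s) 2 halfLine) (h : ∀ s ∈ Ioc 0 t, energy (f s) ≤ C) :
    MemLp (Function.uncurry f) 2 ((volume.restrict (Ioc 0 t)).prod halfLine) := by
  rw [memLp_two_iff_integrable_sq_norm hf.aestronglyMeasurable]
  refine (integrable_prod_iff (hf.norm.pow 2).aestronglyMeasurable).2 ⟨?_, ?_⟩
  · filter_upwards [ae_restrict_mem measurableSet_Ioc] with s hs
    exact (memLp_two_iff_integrable_sq_norm (hL s hs).aestronglyMeasurable).1 (hL s hs)
  · refine (integrable_const C).mono' ?_ ?_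
    · exact (hf.norm.pow 2).norm.aestronglyMeasurable.integral_prod_right'
    · filter_upwards [ae_restrict_mem measurableSet_Ioc] with s hs
      have e : ∫ y in Ioi (0 : ℝ), ‖((fun x => ‖Function.uncurry f x‖) ^ 2) (s, y)‖ =
          energy (f s) := by
        simp [energy, Function.uncurry]
      rw [e, Real.norm_of_nonneg (energy_nonneg _)]
      exact h s hs

/-- A fixed `e m` is below every `c n` with `n ≥ m`. If it were positive, summability of `c n / (n +
1)` would contradict divergence of the harmonic series. -/
theorem eq_zero_of_sum_le {e : ℕ → ℝ} {c : ℕ → ℝ} (he : ∀ m, 0 ≤ e m) {B : ℝ}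
    (hc : ∀ N, ∑ n ∈ Finset.range N, c n / ((n : ℝ) + 1) ≤ B) (hc0 : ∀ n, 0 ≤ c n)
    (h : ∀ n, ∑ m ∈ Finset.range (n + 1), e m ≤ c n) (m : ℕ) : e m = 0 := by
  have hs : Summable fun n : ℕ => c n / ((n : ℝ) + 1) :=
    summable_of_sum_range_le (fun n => div_nonneg (hc0 n) (by positivity)) hc
  by_contra hne
  have hs2 : Summable fun n : ℕ => e m / ((n : ℝ) + 1) := by
    refine Summable.of_norm_bounded_eventually_nat hs ?_
    filter_upwards [eventually_ge_atTop m] with n hn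
    rw [Real.norm_of_nonneg (div_nonneg (he m) (by positivity))]
    refine div_le_div_of_nonneg_right (le_trans ?_ (h n)) (by positivity)
    exact Finset.single_le_sum (fun i _ => he i) (Finset.mem_range.2 (by omega))
  have hs3 : Summable fun n : ℕ => 1 / (((n + 1 : ℕ) : ℝ)) := by
    refine (hs2.mul_left (e m)⁻¹).congr fun n => ?_
    push_cast
    field_simp
  exact Real.not_summable_one_div_natCast ((summable_nat_add_iff 1).1 hs3)

/-- The energy of a decaying primitive does not increase. -/
theorem integral_re_deriv_mul_conj_le {f d : ℝ → ℂ} (hf : IsPrim f d) (hd : Continuous d)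
    (hf2 : MemLp f 2 halfLine) (hd2 : MemLp d 2 halfLine) :
    ∫ ξ in Ioi (0 : ℝ), 2 * (d ξ * conj (f ξ)).re ≤ 0 := by
  have hder : ∀ x ∈ Ioi (0 : ℝ), HasDerivAt f (d x) x := by
    intro x hx
    have h1 : HasDerivAt (fun y => f 0 + ∫ t in (0 : ℝ)..y, d t) (d x) x :=
      (intervalIntegral.integral_hasDerivAt_right (hd.intervalIntegrable _ _)
        hd.stronglyMeasurable.stronglyMeasurableAtFilter hd.continuousAt).const_add _
    refine h1.congr_of_eventuallyEq ?_
    filter_upwards [Ioi_mem_nhds hx] with y hy using hf.eq y (le_of_lt hy)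
  have hder2 : ∀ x ∈ Ioi (0 : ℝ),
      HasDerivAt (fun x => ‖f x‖ ^ 2) (2 * (d x * conj (f x)).re) x := by
    intro x hx
    have := (hder x hx).norm_sq
    refine this.congr_deriv ?_
    rw [Complex.inner]
  have hi : IntegrableOn (fun ξ => ‖f ξ‖ ^ 2) (Ioi 0) :=
    (memLp_two_iff_integrable_sq_norm hf2.aestronglyMeasurable).1 hf2
  have hi' : IntegrableOn (fun ξ => 2 * (d ξ * conj (f ξ)).re) (Ioi 0) := by
    have h1 : Integrable (fun ξ => d ξ * conj (f ξ)) halfLine := hd2.integrable_mul hf2.star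
    exact h1.re.const_mul 2
  have hlim := tendsto_zero_of_hasDerivAt_of_integrableOn_Ioi hder2 hi' hi
  -- The integral equals `-|f(0)|²`: transport is directed to the left, so the boundary at `0` can
  -- only lose energy.
  rw [integral_Ioi_of_hasDerivAt_of_tendsto (f := fun x => ‖f x‖ ^ 2) ?_ hder2 hi' hlim]
  · simp
  · exact ((hf.continuousOn 0 self_mem_Ici).norm).pow 2

/-- `∫_0^t u ds`. -/
noncomputable def timeIntegral (u : ℝ → ℕ → ℝ → ℂ) (t : ℝ) (ℓ : ℕ) (ξ : ℝ) : ℂ :=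
  ∫ s in (0 : ℝ)..t, u s ℓ ξ

namespace IsRegularSolution

variable {K r : ℝ} {u : ℝ → ℕ → ℝ → ℂ}

theorem exists_isDominated (h : IsRegularSolution K r u) (t : ℝ) (ℓ : ℕ) :
    ∃ C, 0 ≤ C ∧ (∀ s ≤ t, ∀ ξ, ‖u s ℓ ξ‖ ≤ C) ∧
      IsDominated (volume.restrict (Ioc 0 t)) (fun s => u s ℓ) fun _ => C := by
  obtain ⟨C, hC, h1⟩ := h.bound t
  exact ⟨C * rt ℓ, mul_nonneg hC (rt_pos ℓ).le, fun s hs ξ => h1 s hs ℓ ξ,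
    isDominated_Ioc (h.stronglyMeasurable ℓ) (fun s => h.continuous s ℓ) fun s hs ξ => h1 s hs ℓ ξ⟩

theorem continuous_timeIntegral (h : IsRegularSolution K r u) (t : ℝ) (ℓ : ℕ) :
    Continuous (timeIntegral u t ℓ) := by
  obtain ⟨C, -, hC, -⟩ := h.exists_isDominated (max 0 t) ℓ
  refine intervalIntegral.continuous_of_dominated_interval (bound := fun _ => C)
    (fun ξ => (h.continuous_time ℓ ξ).aestronglyMeasurable) (fun ξ => ?_) (by simp)
    (Eventually.of_forall fun s _ => h.continuous s ℓ)
  exact Eventually.of_forall fun s hs => hC s (mem_uIoc.1 hs |>.elim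
    (fun h => h.2.trans (le_max_right _ _)) (fun h => h.2.trans (le_max_left _ _))) ξ

theorem hasDerivAt_timeIntegral (h : IsRegularSolution K r u) (t : ℝ) (ℓ : ℕ) (ξ : ℝ) :
    HasDerivAt (fun t => timeIntegral u t ℓ ξ) (u t ℓ ξ) t :=
  (h.continuous_time ℓ ξ).integral_hasStrictDerivAt 0 t |>.hasDerivAt

theorem stronglyMeasurable_timeIntegral (h : IsRegularSolution K r u) (ℓ : ℕ) :
    StronglyMeasurable (Function.uncurry fun s ξ => timeIntegral u s ℓ ξ) :=
  stronglyMeasurable_uncurry_of_continuous_of_stronglyMeasurable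
    (fun ξ => continuous_iff_continuousAt.2 fun t =>
      (h.hasDerivAt_timeIntegral t ℓ ξ).continuousAt)
    fun t => (h.continuous_timeIntegral t ℓ).stronglyMeasurable

theorem timeIntegral_zero_mode (h : IsRegularSolution K r u) (t ξ : ℝ) :
    timeIntegral u t 0 ξ = 0 := by
  simp [timeIntegral, h.zero]

theorem intervalIntegrable_test (h : IsRegularSolution K r u) (ℓ : ℕ) {t : ℝ} (ht : 0 ≤ t)
    {ψ : ℝ → ℝ} (hψ : Continuous ψ) (hc : HasCompactSupport ψ) :
    IntervalIntegrable (fun s => ∫ ξ in Ioi (0 : ℝ), u s ℓ ξ * (ψ ξ : ℂ)) volume 0 t := by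
  obtain ⟨C, -, -, hD⟩ := h.exists_isDominated t ℓ
  rw [intervalIntegrable_iff_integrableOn_Ioc_of_le ht]
  exact hD.integrable_integral (integrable_ofReal_test hψ hc)

theorem integral_timeIntegral_mul (h : IsRegularSolution K r u) (ℓ : ℕ) {t : ℝ} (ht : 0 ≤ t)
    {ψ : ℝ → ℝ} (hψ : Continuous ψ) (hc : HasCompactSupport ψ) :
    ∫ ξ in Ioi (0 : ℝ), timeIntegral u t ℓ ξ * (ψ ξ : ℂ) =
      ∫ s in (0 : ℝ)..t, ∫ ξ in Ioi (0 : ℝ), u s ℓ ξ * (ψ ξ : ℂ) := by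
  obtain ⟨C, -, -, hD⟩ := h.exists_isDominated t ℓ
  simp only [timeIntegral, intervalIntegral.integral_of_le ht]
  exact hD.integral_swap (integrable_ofReal_test hψ hc)

theorem l2NormSq_timeIntegral_le (_h : IsRegularSolution K r u) {t : ℝ} (ht : 0 ≤ t) {C : ℝ≥0∞}
    (hC : ∀ s ≤ t, l2NormSq 0 (u s) ≤ C) :
    l2NormSq 0 (timeIntegral u t) ≤ ENNReal.ofReal t * (C * ENNReal.ofReal t) := by
  have e : timeIntegral u t = fun ℓ ξ => ∫ s in Ioc 0 t, u s ℓ ξ := by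
    funext ℓ ξ
    exact intervalIntegral.integral_of_le ht
  rw [e]
  refine (l2NormSq_integral_le (μ := volume.restrict (Ioc 0 t)) 0 (α := fun _ => 1)
    (β := fun _ => 1) (w := u) measurable_const measurable_const _h.stronglyMeasurable
    (Eventually.of_forall fun s ℓ ξ => by simp)).trans ?_
  simp only [one_pow, one_mul]
  refine mul_le_mul' (by simp) ?_
  refine (setLIntegral_mono' measurableSet_Ioc fun s hs => hC s hs.2).trans ?_
  simp

/-- Integrated over time, the weak equation expresses the frequency derivative of `∫ u ds` by
continuous quantities. The time integral is thus regular enough for energy estimates although no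
frequency derivative of `u` is assumed. -/
theorem isPrim_timeIntegral (h : IsRegularSolution K r u) (m : ℕ) {t : ℝ} (ht : 0 ≤ t) :
    IsPrim (timeIntegral u t (m + 1)) fun ξ =>
      (u t (m + 1) ξ - u 0 (m + 1) ξ) / ((m : ℂ) + 1) -
        K * r / 2 * (timeIntegral u t m ξ - timeIntegral u t (m + 2) ξ) := by
  have hm : ((m : ℂ) + 1) ≠ 0 := Nat.cast_add_one_ne_zero m
  have hcd : Continuous fun ξ => (u t (m + 1) ξ - u 0 (m + 1) ξ) / ((m : ℂ) + 1) -
        K * r / 2 * (timeIntegral u t m ξ - timeIntegral u t (m + 2) ξ) :=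
    (((h.continuous t _).sub (h.continuous 0 _)).div_const _).sub
      (continuous_const.mul ((h.continuous_timeIntegral t _).sub (h.continuous_timeIntegral t _)))
  have hcW := h.continuous_timeIntegral t (m + 1)
  obtain ⟨f, hf, hWf⟩ := exists_isPrim_of_weak_deriv (u := timeIntegral u t (m + 1))
    (fun R _ => hcW.intervalIntegrable _ _) (fun R _ => hcd.intervalIntegrable _ _) (by
      intro ψ hψ
      have e1 := h.integral_timeIntegral_mul (m + 1) ht hψ.deriv.continuous hψ.deriv.compact
      have e2 := h.integral_timeIntegral_mul m ht hψ.continuous hψ.compact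
      have e3 := h.integral_timeIntegral_mul (m + 2) ht hψ.continuous hψ.compact
      have e4 := h.equation m ψ hψ t ht
      have j1 := (h.intervalIntegrable_test (m + 1) ht hψ.deriv.continuous
        hψ.deriv.compact).const_mul (-((m : ℂ) + 1))
      have j2 := h.intervalIntegrable_test m ht hψ.continuous hψ.compact
      have j3 := h.intervalIntegrable_test (m + 2) ht hψ.continuous hψ.compact
      rw [intervalIntegral.integral_add j1 ((j2.sub j3).const_mul _),
        intervalIntegral.integral_const_mul, intervalIntegral.integral_const_mul,
        intervalIntegral.integral_sub j2 j3, ← e1, ← e2, ← e3] at e4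
      have i1 := integrable_continuous_mul (h.continuous t (m + 1)) hψ.continuous hψ.compact
      have i2 := integrable_continuous_mul (h.continuous 0 (m + 1)) hψ.continuous hψ.compact
      have i3 := integrable_continuous_mul (h.continuous_timeIntegral t m)
        hψ.continuous hψ.compact
      have i4 := integrable_continuous_mul (h.continuous_timeIntegral t (m + 2))
        hψ.continuous hψ.compact
      have e5 : ∀ ξ, ((u t (m + 1) ξ - u 0 (m + 1) ξ) / ((m : ℂ) + 1) -
          K * r / 2 * (timeIntegral u t m ξ - timeIntegral u t (m + 2) ξ)) * (ψ ξ : ℂ) =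
          ((m : ℂ) + 1)⁻¹ * (u t (m + 1) ξ * (ψ ξ : ℂ) - u 0 (m + 1) ξ * (ψ ξ : ℂ)) -
          K * r / 2 * (timeIntegral u t m ξ * (ψ ξ : ℂ) -
            timeIntegral u t (m + 2) ξ * (ψ ξ : ℂ)) := fun ξ => by ring
      simp only [e5]
      have i12 : Integrable (fun ξ => u t (m + 1) ξ * (ψ ξ : ℂ) - u 0 (m + 1) ξ * (ψ ξ : ℂ))
        halfLine := i1.sub i2
      have i34 : Integrable (fun ξ => timeIntegral u t m ξ * (ψ ξ : ℂ) -
        timeIntegral u t (m + 2) ξ * (ψ ξ : ℂ)) halfLine := i3.sub i4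
      rw [integral_sub (i12.const_mul _) (i34.const_mul _), integral_const_mul,
        integral_const_mul, integral_sub i1 i2, integral_sub i3 i4, e4]
      field_simp
      ring)
  have heq := eqOn_of_ae_eq_halfLine hcW.continuousOn hf.continuousOn hWf
  exact ⟨hf.integrable, fun x hx => by
    rw [heq (mem_Ici.2 hx), heq (mem_Ici.2 le_rfl)]; exact hf.eq x hx⟩

theorem sub {u' : ℝ → ℕ → ℝ → ℂ} (h : IsRegularSolution K r u) (h' : IsRegularSolution K r u') :
    IsRegularSolution K r fun t ℓ ξ => u t ℓ ξ - u' t ℓ ξ where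
  zero t ξ := by rw [h.zero, h'.zero, sub_zero]
  continuous_time ℓ ξ := (h.continuous_time ℓ ξ).sub (h'.continuous_time ℓ ξ)
  continuous t ℓ := (h.continuous t ℓ).sub (h'.continuous t ℓ)
  bound T := by
    obtain ⟨C, hC, h1⟩ := h.bound T
    obtain ⟨C', hC', h2⟩ := h'.bound T
    refine ⟨C + C', by positivity, fun t ht m ξ => (norm_sub_le _ _).trans ?_⟩
    rw [add_mul]
    exact add_le_add (h1 t ht m ξ) (h2 t ht m ξ)
  l2NormSq_le T := by
    obtain ⟨C, hC, h1⟩ := h.l2NormSq_le T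
    obtain ⟨C', hC', h2⟩ := h'.l2NormSq_le T
    refine ⟨2 * C + 2 * C', ENNReal.add_lt_top.2 ⟨ENNReal.mul_lt_top (by simp) hC,
      ENNReal.mul_lt_top (by simp) hC'⟩, fun t ht => ?_⟩
    refine le_trans ?_ (add_le_add (mul_le_mul_right (h1 t ht) 2) (mul_le_mul_right (h2 t ht) 2))
    exact l2NormSq_le_of_norm_le 0 (fun ℓ => (h.continuous t ℓ).measurable)
      fun m ξ => norm_sub_le _ _
  equation m ψ hψ t ht := by
    have c := hψ.continuous
    have k := hψ.compact
    have c' := hψ.deriv.continuous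
    have k' := hψ.deriv.compact
    have e : ∀ (ℓ : ℕ) (s : ℝ) (φ : ℝ → ℝ), Continuous φ → HasCompactSupport φ →
        ∫ ξ in Ioi (0 : ℝ), (u s ℓ ξ - u' s ℓ ξ) * (φ ξ : ℂ) =
          (∫ ξ in Ioi (0 : ℝ), u s ℓ ξ * (φ ξ : ℂ)) - ∫ ξ in Ioi (0 : ℝ), u' s ℓ ξ * (φ ξ : ℂ) := by
      intro ℓ s φ hφ hφc
      rw [← integral_sub (integrable_continuous_mul (h.continuous s ℓ) hφ hφc)
        (integrable_continuous_mul (h'.continuous s ℓ) hφ hφc)]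
      simp only [sub_mul]
    simp only [e _ _ ψ c k, e _ _ (deriv ψ) c' k']
    rw [h.equation m ψ hψ t ht, h'.equation m ψ hψ t ht, add_sub_add_comm,
      ← intervalIntegral.integral_sub]
    · congr 1
      refine intervalIntegral.integral_congr fun s _ => ?_
      ring
    · exact ((h.intervalIntegrable_test _ ht c' k').const_mul _).add
        (((h.intervalIntegrable_test _ ht c k).sub (h.intervalIntegrable_test _ ht c k)).const_mul _)
    · exact ((h'.intervalIntegrable_test _ ht c' k').const_mul _).add
        (((h'.intervalIntegrable_test _ ht c k).sub
          (h'.intervalIntegrable_test _ ht c k)).const_mul _)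

/-- The time-integrated equation is tested against its own solution. After division by `ℓ` the
interaction is a difference of fluxes between neighbouring modes, which telescopes in `m`; the
transport term has a favourable sign and is dropped. -/
theorem integral_flux_le (h : IsRegularSolution K r u) (h0 : ∀ ℓ ξ, u 0 ℓ ξ = 0) {t : ℝ}
    (ht : 0 ≤ t) (m : ℕ) (hu2 : ∀ ℓ, MemLp (u t ℓ) 2 halfLine)
    (hW2 : ∀ ℓ, MemLp (timeIntegral u t ℓ) 2 halfLine) :
    (∫ ξ in Ioi (0 : ℝ), 2 * (u t (m + 1) ξ * conj (timeIntegral u t (m + 1) ξ)).re) /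
        ((m : ℝ) + 1) ≤
      K * r * (∫ ξ in Ioi (0 : ℝ), (timeIntegral u t m ξ * conj (timeIntegral u t (m + 1) ξ)).re) -
      K * r * ∫ ξ in Ioi (0 : ℝ),
        (timeIntegral u t (m + 1) ξ * conj (timeIntegral u t (m + 2) ξ)).re := by
  set W := timeIntegral u t with hW
  have hmC : ((m : ℂ) + 1) ≠ 0 := Nat.cast_add_one_ne_zero m
  have hm : (0 : ℝ) < (m : ℝ) + 1 := by positivity
  have hp := h.isPrim_timeIntegral m ht
  simp only [h0, sub_zero] at hp
  set d : ℝ → ℂ := fun ξ => u t (m + 1) ξ / ((m : ℂ) + 1) -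
    K * r / 2 * (W m ξ - W (m + 2) ξ) with hd
  have hdc : Continuous d := ((h.continuous t _).div_const _).sub (continuous_const.mul
    ((h.continuous_timeIntegral t _).sub (h.continuous_timeIntegral t _)))
  have hd2 : MemLp d 2 halfLine := by
    have := ((hu2 (m + 1)).const_mul ((m : ℂ) + 1)⁻¹).sub
      (((hW2 m).sub (hW2 (m + 2))).const_mul (K * r / 2 : ℂ))
    refine this.ae_eq (Eventually.of_forall fun ξ => ?_)
    simp only [hd, Pi.sub_apply]
    ring
  have hle := integral_re_deriv_mul_conj_le hp hdc (hW2 (m + 1)) hd2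
  have hI : ∀ {f g : ℝ → ℂ}, MemLp f 2 halfLine → MemLp g 2 halfLine →
      Integrable (fun ξ => (f ξ * conj (g ξ)).re) halfLine := fun hf hg =>
    (hf.integrable_mul hg.star).re
  have i1 := hI hd2 (hW2 (m + 1))
  have i2 := hI (hW2 m) (hW2 (m + 1))
  have i3 := hI (hW2 (m + 1)) (hW2 (m + 2))
  have e : ∀ ξ, 2 * (u t (m + 1) ξ * conj (W (m + 1) ξ)).re =
      ((m : ℝ) + 1) * (2 * (d ξ * conj (W (m + 1) ξ)).re + (K * r *
        (W m ξ * conj (W (m + 1) ξ)).re - K * r * (W (m + 1) ξ * conj (W (m + 2) ξ)).re)) := by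
    intro ξ
    have e1 : u t (m + 1) ξ = ((m + 1 : ℝ) : ℂ) * (d ξ + ((K * r / 2 : ℝ) : ℂ) *
        (W m ξ - W (m + 2) ξ)) := by
      simp only [hd]
      push_cast
      field_simp
      ring
    rw [e1]
    simp only [Complex.mul_re, Complex.mul_im, Complex.add_re, Complex.add_im, Complex.sub_re,
      Complex.sub_im, Complex.ofReal_re, Complex.ofReal_im, Complex.conj_re, Complex.conj_im]
    ring
  have i23 : Integrable (fun ξ => K * r * (W m ξ * conj (W (m + 1) ξ)).re -
      K * r * (W (m + 1) ξ * conj (W (m + 2) ξ)).re) halfLine :=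
    (i2.const_mul _).sub (i3.const_mul _)
  simp only [e]
  rw [integral_const_mul, integral_add (i1.const_mul 2) i23, integral_sub (i2.const_mul _)
    (i3.const_mul _), integral_const_mul (K * r), integral_const_mul (K * r),
    mul_div_cancel_left₀ _ hm.ne']
  linarith

/-- Summing the flux inequality over the modes up to `n + 1` leaves only the flux out of the last
one, as mode `0` vanishes. This flux is bounded by the energies of modes `n + 1` and `n + 2`,
integrated over time. The norm with weights `1 / ℓ` makes these bounds divided by `n + 1` summable,
so `eq_zero_of_sum_le` applies. -/
theorem eq_zero (h : IsRegularSolution K r u) (h0 : ∀ ℓ ξ, u 0 ℓ ξ = 0) {t : ℝ} (ht : 0 ≤ t)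
    (m : ℕ) {ξ : ℝ} (hξ : 0 ≤ ξ) : timeIntegral u t (m + 1) ξ = 0 := by
  obtain ⟨C, hC, hl⟩ := h.l2NormSq_le t
  set W := timeIntegral u with hW
  set B : ℝ≥0∞ := ENNReal.ofReal t * (C * ENNReal.ofReal t) with hB
  have hBt : B < ⊤ := ENNReal.mul_lt_top ENNReal.ofReal_lt_top
    (ENNReal.mul_lt_top hC ENNReal.ofReal_lt_top)
  have hWl : ∀ s, 0 ≤ s → s ≤ t → l2NormSq 0 (W s) ≤ B := fun s hs hst =>
    (h.l2NormSq_timeIntegral_le hs fun σ hσ => hl σ (hσ.trans hst)).trans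
      (mul_le_mul' (ENNReal.ofReal_le_ofReal hst) (mul_le_mul' le_rfl
        (ENNReal.ofReal_le_ofReal hst)))
  have hu2 : ∀ s ≤ t, ∀ ℓ, MemLp (u s ℓ) 2 halfLine := fun s hs ℓ => by
    rcases ℓ with _ | m
    · refine (MemLp.zero (p := 2)).ae_eq (Eventually.of_forall fun ξ => ?_)
      simp [h.zero]
    · exact memLp_of_l2NormSq_lt_top (h.continuous s _) ((hl s hs).trans_lt hC)
  have hW2 : ∀ s, 0 ≤ s → s ≤ t → ∀ ℓ, MemLp (W s ℓ) 2 halfLine := fun s hs hst ℓ => by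
    rcases ℓ with _ | m
    · refine (MemLp.zero (p := 2)).ae_eq (Eventually.of_forall fun ξ => ?_)
      simp [hW, h.timeIntegral_zero_mode]
    · exact memLp_of_l2NormSq_lt_top (h.continuous_timeIntegral s _) ((hWl s hs hst).trans_lt hBt)
  have hle_of_sum : ∀ (v : ℕ → ℝ → ℂ), (∀ ℓ, Continuous (v ℓ)) → ∀ D : ℝ≥0∞, D < ⊤ →
      l2NormSq 0 v ≤ D → ∀ m : ℕ, energy (v (m + 1)) ≤ ((m : ℝ) + 1) * D.toReal := by
    intro v hv D hD hvD m
    have h1 := sum_energy_le hv hD hvD (m + 1)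
    have h2 := Finset.single_le_sum (f := fun m : ℕ => energy (v (m + 1)) / ((m : ℝ) + 1))
      (fun i _ => div_nonneg (energy_nonneg _) (by positivity)) (Finset.self_mem_range_succ m)
    have h3 := h2.trans h1
    rw [div_le_iff₀ (by positivity)] at h3
    linarith
  have huP : ∀ m : ℕ, MemLp (Function.uncurry fun s ξ => u s (m + 1) ξ) 2
      ((volume.restrict (Ioc 0 t)).prod halfLine) := fun m =>
    memLp_prod_of_le (h.stronglyMeasurable _) (fun s hs => hu2 s hs.2 _)
      fun s hs => hle_of_sum _ (h.continuous s) C hC (hl s hs.2) m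
  have hWP : ∀ m : ℕ, MemLp (Function.uncurry fun s ξ => W s (m + 1) ξ) 2
      ((volume.restrict (Ioc 0 t)).prod halfLine) := fun m =>
    memLp_prod_of_le (h.stronglyMeasurable_timeIntegral _) (fun s hs => hW2 s hs.1.le hs.2 _)
      fun s hs => hle_of_sum _ (h.continuous_timeIntegral s) B hBt (hWl s hs.1.le hs.2) m
  let P : ℕ → ℝ → ℝ := fun m s =>
    ∫ ξ in Ioi (0 : ℝ), 2 * (u s (m + 1) ξ * conj (W s (m + 1) ξ)).re
  have hProd : ∀ m : ℕ, Integrable (Function.uncurry fun s ξ =>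
      2 * (u s (m + 1) ξ * conj (W s (m + 1) ξ)).re)
      ((volume.restrict (Ioc 0 t)).prod halfLine) := fun m =>
    (((huP m).integrable_mul (hWP m).star).re).const_mul 2
  have hPint : ∀ m, IntervalIntegrable (P m) volume 0 t := fun m => by
    rw [intervalIntegrable_iff_integrableOn_Ioc_of_le ht]
    exact (hProd m).integral_prod_left
  have hEint : ∀ m : ℕ, IntervalIntegrable (fun s => energy (W s (m + 1))) volume 0 t := fun m => by
    rw [intervalIntegrable_iff_integrableOn_Ioc_of_le ht]
    exact ((memLp_two_iff_integrable_sq_norm (hWP m).aestronglyMeasurable).1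
      (hWP m)).integral_prod_left
  -- Pointwise in frequency, `d/ds |W|² = 2 Re (u · conj W)` with `W = 0` at time `0`; Fubini then
  -- exchanges the integrals.
  have hEP : ∀ m : ℕ, energy (W t (m + 1)) = ∫ s in (0 : ℝ)..t, P m s := by
    intro m
    rw [intervalIntegral.integral_of_le ht]
    simp only [P]
    rw [integral_integral_swap (hProd m)]
    refine setIntegral_congr_fun measurableSet_Ioi fun ξ _ => ?_
    rw [← intervalIntegral.integral_of_le ht]
    have hd : ∀ s ∈ uIcc 0 t, HasDerivAt (fun s => ‖W s (m + 1) ξ‖ ^ 2)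
        (2 * (u s (m + 1) ξ * conj (W s (m + 1) ξ)).re) s := fun s _ => by
      refine (h.hasDerivAt_timeIntegral s (m + 1) ξ).norm_sq.congr_deriv ?_
      rw [Complex.inner]
    have hc : Continuous fun s => 2 * (u s (m + 1) ξ * conj (W s (m + 1) ξ)).re :=
      continuous_const.mul (Complex.continuous_re.comp ((h.continuous_time (m + 1) ξ).mul
        (Complex.continuous_conj.comp (continuous_iff_continuousAt.2 fun s =>
          (h.hasDerivAt_timeIntegral s (m + 1) ξ).continuousAt))))
    rw [intervalIntegral.integral_eq_sub_of_hasDerivAt hd (hc.intervalIntegrable _ _)]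
    simp [hW, timeIntegral]
  let c : ℕ → ℝ := fun n => |K * r| * ∫ s in (0 : ℝ)..t, (energy (W s (n + 1)) + energy (W s (n + 2)))
  have hflux : ∀ n : ℕ, ∀ s ∈ Icc 0 t, ∑ m ∈ Finset.range (n + 1), P m s / ((m : ℝ) + 1) ≤
      |K * r| * (energy (W s (n + 1)) + energy (W s (n + 2))) := by
    intro n s hs
    let a : ℕ → ℝ := fun k => K * r * ∫ ξ in Ioi (0 : ℝ), (W s k ξ * conj (W s (k + 1) ξ)).re
    have h1 : ∀ m, P m s / ((m : ℝ) + 1) ≤ a m - a (m + 1) := fun m =>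
      h.integral_flux_le h0 hs.1 m (hu2 s hs.2) (hW2 s hs.1 hs.2)
    refine (Finset.sum_le_sum fun m _ => h1 m).trans ?_
    rw [Finset.sum_range_sub']
    have ha0 : a 0 = 0 := by simp [a, hW, h.timeIntegral_zero_mode]
    rw [ha0, zero_sub]
    refine (neg_le_abs _).trans ?_
    simp only [a]
    rw [abs_mul]
    refine mul_le_mul_of_nonneg_left ?_ (abs_nonneg _)
    have hi : ∀ ℓ, Integrable (fun ξ => ‖W s ℓ ξ‖ ^ 2) halfLine := fun ℓ =>
      (memLp_two_iff_integrable_sq_norm (hW2 s hs.1 hs.2 ℓ).aestronglyMeasurable).1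
        (hW2 s hs.1 hs.2 ℓ)
    unfold energy
    rw [← integral_add (hi _) (hi _), ← Real.norm_eq_abs]
    refine norm_integral_le_of_norm_le ((hi _).add (hi _)) (Eventually.of_forall fun ξ => ?_)
    have h2 : ‖(W s (n + 1) ξ * conj (W s (n + 1 + 1) ξ)).re‖ ≤
        ‖W s (n + 1) ξ‖ * ‖W s (n + 2) ξ‖ := by
      refine (Complex.abs_re_le_norm _).trans_eq ?_
      rw [norm_mul, RCLike.norm_conj]
    refine h2.trans ?_
    nlinarith [sq_nonneg (‖W s (n + 1) ξ‖ - ‖W s (n + 2) ξ‖), sq_nonneg ‖W s (n + 1) ξ‖,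
      sq_nonneg ‖W s (n + 2) ξ‖]
  have hsum : ∀ n : ℕ, ∑ m ∈ Finset.range (n + 1), energy (W t (m + 1)) / ((m : ℝ) + 1) ≤ c n := by
    intro n
    have h1 : ∑ m ∈ Finset.range (n + 1), energy (W t (m + 1)) / ((m : ℝ) + 1) =
        ∫ s in (0 : ℝ)..t, ∑ m ∈ Finset.range (n + 1), P m s / ((m : ℝ) + 1) := by
      rw [intervalIntegral.integral_finsetSum fun m _ => (hPint m).div_const _]
      refine Finset.sum_congr rfl fun m _ => ?_
      rw [hEP, intervalIntegral.integral_div]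
    rw [h1]
    simp only [c]
    rw [← intervalIntegral.integral_const_mul]
    refine intervalIntegral.integral_mono_on ht ?_ (((hEint n).add (hEint (n + 1))).const_mul _)
      (hflux n)
    have h2 := IntervalIntegrable.sum (Finset.range (n + 1)) (μ := volume) (a := 0) (b := t)
      (f := fun m s => P m s / ((m : ℝ) + 1)) fun m _ => (hPint m).div_const _
    exact h2.congr fun s _ => by simp
  have hc0 : ∀ n, 0 ≤ c n := fun n => mul_nonneg (abs_nonneg _)
    (intervalIntegral.integral_nonneg ht fun s _ => add_nonneg (energy_nonneg _) (energy_nonneg _))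
  have hcB : ∀ N, ∑ n ∈ Finset.range N, c n / ((n : ℝ) + 1) ≤ |K * r| * (t * (3 * B.toReal)) := by
    intro N
    have h1 : ∑ n ∈ Finset.range N, c n / ((n : ℝ) + 1) = |K * r| * ∫ s in (0 : ℝ)..t,
        ∑ n ∈ Finset.range N, (energy (W s (n + 1)) + energy (W s (n + 2))) / ((n : ℝ) + 1) := by
      rw [intervalIntegral.integral_finsetSum fun n _ =>
        ((hEint n).add (hEint (n + 1))).div_const _, Finset.mul_sum]
      refine Finset.sum_congr rfl fun n _ => ?_
      rw [intervalIntegral.integral_div, mul_div_assoc]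
    rw [h1]
    refine mul_le_mul_of_nonneg_left ?_ (abs_nonneg _)
    have h2 : ∀ s ∈ Icc 0 t, ∑ n ∈ Finset.range N, (energy (W s (n + 1)) + energy (W s (n + 2))) /
        ((n : ℝ) + 1) ≤ 3 * B.toReal := by
      intro s hs
      have h3 := sum_energy_le (h.continuous_timeIntegral s) hBt (hWl s hs.1 hs.2) N
      have h4 := sum_energy_le (h.continuous_timeIntegral s) hBt (hWl s hs.1 hs.2) (N + 1)
      rw [Finset.sum_range_succ'] at h4
      -- The shifted energy carries the weight `1 / (n + 2)` in the norm, and `1 / (n + 1) ≤ 2 / (n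
      -- + 2)`; hence the total factor `1 + 2 = 3`.
      have h5 : ∀ n : ℕ, (energy (W s (n + 1)) + energy (W s (n + 2))) / ((n : ℝ) + 1) ≤
          energy (W s (n + 1)) / ((n : ℝ) + 1) +
            2 * (energy (W s (n + 1 + 1)) / (((n + 1 : ℕ) : ℝ) + 1)) := by
        intro n
        rw [add_div]
        refine add_le_add le_rfl ?_
        rw [← mul_div_assoc, div_le_div_iff₀ (by positivity) (by positivity)]
        push_cast
        have := energy_nonneg (W s (n + 2))
        have hn : (0 : ℝ) ≤ n := by positivity
        nlinarith
      refine (Finset.sum_le_sum fun n _ => h5 n).trans ?_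
      rw [Finset.sum_add_distrib, ← Finset.mul_sum]
      have h6 : 0 ≤ energy (W s (0 + 1)) / (((0 : ℕ) : ℝ) + 1) :=
        div_nonneg (energy_nonneg _) (by positivity)
      linarith
    have h3 := intervalIntegral.norm_integral_le_of_norm_le_const (a := 0) (b := t)
      (C := 3 * B.toReal) (f := fun s => ∑ n ∈ Finset.range N, (energy (W s (n + 1)) +
        energy (W s (n + 2))) / ((n : ℝ) + 1)) (fun s hs => by
        rw [uIoc_of_le ht] at hs
        rw [Real.norm_of_nonneg (Finset.sum_nonneg fun n _ => div_nonneg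
          (add_nonneg (energy_nonneg _) (energy_nonneg _)) (by positivity))]
        exact h2 s ⟨hs.1.le, hs.2⟩)
    rw [sub_zero, abs_of_nonneg ht] at h3
    linarith [Real.le_norm_self (∫ s in (0 : ℝ)..t, ∑ n ∈ Finset.range N, (energy (W s (n + 1)) +
        energy (W s (n + 2))) / ((n : ℝ) + 1))]
  have hE := eq_zero_of_sum_le (fun m => div_nonneg (energy_nonneg (W t (m + 1))) (by positivity))
    hcB hc0 hsum m
  have hE0 : energy (W t (m + 1)) = 0 := by
    rcases div_eq_zero_iff.1 hE with h1 | h1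
    · exact h1
    · exact absurd h1 (by positivity)
  have hi := (memLp_two_iff_integrable_sq_norm (hW2 t ht le_rfl (m + 1)).aestronglyMeasurable).1
    (hW2 t ht le_rfl (m + 1))
  unfold energy at hE0
  rw [integral_eq_zero_iff_of_nonneg (fun _ => sq_nonneg _) hi] at hE0
  have hae : W t (m + 1) =ᵐ[halfLine] fun _ => 0 := by
    filter_upwards [hE0] with ξ hξ
    simpa using hξ
  exact eqOn_of_ae_eq_halfLine (h.continuous_timeIntegral t (m + 1)).continuousOn
    continuousOn_const hae hξ

end IsRegularSolution

/-- Uniqueness of weak solutions. -/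
theorem IsWeakSolution.unique {K r b : ℝ} (hb : 0 ≤ b) {v : ℕ → ℝ → ℂ} {w w' : ℝ → ℕ → ℝ → ℂ}
    (h : IsWeakSolution K r b v w) (h' : IsWeakSolution K r b v w') {t ξ : ℝ} (m : ℕ) (ht : 0 ≤ t)
    (hξ : 0 ≤ ξ) : w t (m + 1) ξ = w' t (m + 1) ξ := by
  have hU := (h.isRegularSolution hb).sub (h'.isRegularSolution hb)
  set U : ℝ → ℕ → ℝ → ℂ := fun t ℓ ξ => normalize w t ℓ ξ - normalize w' t ℓ ξ with hUdef
  have h0 : ∀ ℓ ξ, U 0 ℓ ξ = 0 := by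
    intro ℓ ξ
    rcases ℓ with _ | m
    · simp [hUdef, normalize]
    · simp only [hUdef, normalize, Nat.succ_ne_zero, if_false, max_self]
      rw [h.initial _ (by omega) _ (le_max_right _ _), h'.initial _ (by omega) _ (le_max_right _ _),
        sub_self]
  -- The time integral vanishes for all nonnegative times, and the difference of the solutions is
  -- its time derivative.
  have hz : ∀ s, 0 < s → U s (m + 1) ξ = 0 := by
    intro s hs
    refine (hU.hasDerivAt_timeIntegral s (m + 1) ξ).unique ?_
    refine (hasDerivAt_const s (0 : ℂ)).congr_of_eventuallyEq ?_
    filter_upwards [Ioi_mem_nhds hs] with σ hσ using hU.eq_zero h0 (le_of_lt hσ) m hξ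
  have hz' : U t (m + 1) ξ = 0 := by
    rcases ht.eq_or_lt with rfl | ht'
    · exact h0 _ _
    · exact hz t ht'
  simp only [hUdef] at hz'
  rw [normalize_succ w m ht hξ, normalize_succ w' m ht hξ] at hz'
  exact sub_eq_zero.1 hz'

/-- By uniqueness the solution selected in the definition of `expL1` is irrelevant, and bounds for
one weak solution become bounds for the semigroup. -/
theorem IsWeakSolution.expL1_eq {K r b : ℝ} (hb : 0 ≤ b) {v : ℕ → ℝ → ℂ} {w : ℝ → ℕ → ℝ → ℂ}
    (h : IsWeakSolution K r b v w) {t ξ : ℝ} (m : ℕ) (ht : 0 ≤ t) (hξ : 0 ≤ ξ) :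
    expL1 K r b t v (m + 1) ξ = w t (m + 1) ξ := by
  have hex : ∃ w, IsWeakSolution K r b v w := ⟨w, h⟩
  rw [expL1, dif_pos hex]
  exact hex.choose_spec.unique hb h m ht hξ

/-! ### The resolvent as a superposition in time -/

theorem wt_mul_wt (a b x : ℝ) : wt a x * wt b x = wt (a + b) x :=
  (Real.rpow_add (by positivity) a b).symm

theorem wt_sq (a x : ℝ) : wt a x ^ 2 = wt (2 * a) x := by
  rw [sq, wt_mul_wt, two_mul]

theorem integrable_wt {q : ℝ} (hq : 1 < q) : Integrable (wt (-q)) := by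
  have := integrable_one_add_norm (E := ℝ) (μ := volume) (r := q) (by simpa using hq)
  simp only [Real.norm_eq_abs] at this
  exact this

theorem tendsto_wt_atTop {q : ℝ} (hq : 0 < q) : Tendsto (wt (-q)) atTop (𝓝 0) := by
  have h1 : Tendsto (fun x : ℝ => 1 + |x|) atTop atTop :=
    tendsto_atTop_add_const_left _ _ tendsto_abs_atTop_atTop
  exact (tendsto_rpow_neg_atTop hq).comp h1

theorem wt_le_one {q : ℝ} (hq : 0 ≤ q) (x : ℝ) : wt (-q) x ≤ 1 :=
  Real.rpow_le_one_of_one_le_of_nonpos (by linarith [abs_nonneg x]) (by linarith)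

theorem l2NormSq_const_mul (b : ℝ) (c : ℂ) (f : ℕ → ℝ → ℂ) :
    l2NormSq b (fun ℓ ξ => c * f ℓ ξ) = ‖c‖ₑ ^ 2 * l2NormSq b f := by
  rw [l2NormSq_eq, l2NormSq_eq, ← ENNReal.tsum_mul_left]
  refine tsum_congr fun m => ?_
  rw [← lintegral_const_mul' _ _ (by finiteness)]
  refine lintegral_congr fun ξ => ?_
  rw [enorm_mul, mul_pow, mul_left_comm]

theorem l2NormSq_pred_le (b : ℝ) {f : ℕ → ℝ → ℂ} (h0 : ∀ ξ, f 0 ξ = 0) :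
    l2NormSq b (fun ℓ => f (ℓ - 1)) ≤ l2NormSq b f := by
  unfold l2NormSq
  rw [tsum_eq_zero_add' ENNReal.summable]
  have e : ∫⁻ ξ in Ioi (0 : ℝ), ENNReal.ofReal (‖f (0 + 1 - 1) ξ‖ ^ 2 * wt b ξ ^ 2 /
      (((0 : ℕ) : ℝ) + 1)) = 0 := by simp [h0]
  rw [e, zero_add]
  refine ENNReal.tsum_le_tsum fun m => lintegral_mono fun ξ => ENNReal.ofReal_le_ofReal ?_
  simp only [Nat.add_sub_cancel]
  refine div_le_div_of_nonneg_left (by positivity) (by positivity) ?_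
  push_cast
  linarith

/-- The factor comes from `1 / (m + 1) ≤ 2 / (m + 2)`. -/
theorem l2NormSq_succ_le (b : ℝ) (f : ℕ → ℝ → ℂ) :
    l2NormSq b (fun ℓ => f (ℓ + 1)) ≤ 2 * l2NormSq b f := by
  unfold l2NormSq
  rw [tsum_eq_zero_add' (f := fun m : ℕ => ∫⁻ ξ in Ioi (0 : ℝ), ENNReal.ofReal
    (‖f (m + 1) ξ‖ ^ 2 * wt b ξ ^ 2 / ((m : ℝ) + 1))) ENNReal.summable, mul_add,
    ← ENNReal.tsum_mul_left]
  refine le_trans ?_ (self_le_add_left _ _)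
  refine ENNReal.tsum_le_tsum fun m => ?_
  rw [← lintegral_const_mul' _ _ (by simp)]
  refine lintegral_mono fun ξ => ?_
  have e2 : (2 : ℝ≥0∞) = ENNReal.ofReal 2 := by simp
  rw [e2, ← ENNReal.ofReal_mul (by norm_num)]
  refine ENNReal.ofReal_le_ofReal ?_
  rw [← mul_div_assoc, div_le_div_iff₀ (by positivity) (by positivity)]
  have hn : (0 : ℝ) ≤ m := by positivity
  have hp : 0 ≤ ‖f (m + 1 + 1) ξ‖ ^ 2 * wt b ξ ^ 2 := by positivity
  push_cast
  nlinarith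

/-- Membership in the weighted Sobolev space from separate bounds for a state and its derivative. -/
theorem memXp_of_isPrim {b : ℝ} {u d : ℕ → ℝ → ℂ} (hp : ∀ m, IsPrim (u (m + 1)) (d (m + 1)))
    (hc : ∀ ℓ, Measurable (u ℓ)) (hu : l2NormSq b u < ⊤) (hd : l2NormSq b d < ⊤) : MemXp b u := by
  refine ⟨fun ℓ hℓ R hR => ?_, ?_⟩
  · obtain ⟨m, rfl⟩ : ∃ m, ℓ = m + 1 := ⟨ℓ - 1, by omega⟩
    exact (hp m).ac R hR
  · refine lt_of_le_of_lt (le_of_eq ?_) (ENNReal.add_lt_top.2 ⟨hu, hd⟩)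
    unfold l2NormSq
    rw [xNormSq, ← ENNReal.tsum_add]
    refine tsum_congr fun m => ?_
    rw [← lintegral_add_left]
    · refine lintegral_congr_ae ?_
      filter_upwards [(hp m).deriv_ae, ae_restrict_mem measurableSet_Ioi] with ξ hξ hpos
      have e : ((m : ℝ) + 1) ^ (2 * (-1 / 2) : ℝ) = ((m : ℝ) + 1)⁻¹ := by
        rw [show (2 * (-1 / 2) : ℝ) = -1 by norm_num, Real.rpow_neg_one]
      rw [hξ, e, ← wt_eq_weight (le_of_lt hpos), ← ENNReal.ofReal_add (by positivity)
        (by positivity)]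
      congr 1
      ring
    · exact ((((hc (m + 1)).norm.pow_const 2).mul
        ((continuous_wt b).pow 2).measurable).div_const _).ennreal_ofReal

/-- A separately continuous version of `e^{t L₁} v` with its decay. -/
structure IsPropagator (K r br : ℝ) (v : ℕ → ℝ → ℂ) (u : ℝ → ℕ → ℝ → ℂ) (C : ℝ) : Prop where
  nonneg : 0 ≤ C
  regular : IsRegularSolution K r u
  initial : ∀ m ξ, 0 ≤ ξ → u 0 (m + 1) ξ = v (m + 1) ξ
  norm_le' : ∀ t m ξ, ‖u t m ξ‖ ≤ C * rt m
  norm_le : ∀ t m ξ, 0 ≤ t → ‖u t m ξ‖ ≤ C * rt m * wt (-br) t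
  l2NormSq_le : ∀ b t, 0 ≤ b → b ≤ br → 0 ≤ t →
    l2NormSq b (u t) ≤ ENNReal.ofReal (C * wt (2 * (b - br)) t)
  expL1_eq : ∀ t, 0 ≤ t → expL1 K r br t v 1 0 = u t 1 0

theorem exists_isPropagator {br : ℝ} (hbr : 0 ≤ br) (K r : ℝ) {v : ℕ → ℝ → ℂ} (hv : MemXp br v) :
    ∃ u C, IsPropagator K r br v u C := by
  obtain ⟨w, C, h⟩ := exists_decaying_solution hbr K r hv
  have hwt : ∀ {a t : ℝ}, 0 ≤ t → wt a t = (1 + t) ^ a := fun ht => by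
    rw [wt, abs_of_nonneg ht]
  have hn : ∀ t m ξ, ‖normalize w t m ξ‖ ≤ C * rt m * wt (-br) (max t 0) := by
    intro t m ξ
    rcases m with _ | m
    · simp only [normalize, if_true, norm_zero]
      exact mul_nonneg (mul_nonneg h.nonneg (rt_pos 0).le) (wt_pos _ _).le
    · simp only [normalize, Nat.succ_ne_zero, if_false]
      rw [hwt (le_max_right _ _)]
      refine (h.norm_le m _ _ (le_max_right _ _) (le_max_right _ _)).trans ?_
      exact mul_le_mul_of_nonneg_right (mul_le_mul_of_nonneg_left (rt_le_rt_succ m) h.nonneg)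
        (Real.rpow_nonneg (by positivity) _)
  refine ⟨normalize w, C, h.nonneg, h.weak.isRegularSolution hbr, fun m ξ hξ => ?_,
    fun t m ξ => (hn t m ξ).trans ?_, fun t m ξ ht => ?_, fun b t hb hbb ht => ?_, fun t ht => ?_⟩
  · rw [normalize_succ w m le_rfl hξ, h.weak.initial _ (by omega) _ hξ]
  · exact mul_le_of_le_one_right (mul_nonneg h.nonneg (rt_pos m).le) (wt_le_one hbr _)
  · simpa [ht] using hn t m ξ
  · rw [hwt ht]
    refine le_trans (le_of_eq ?_) (h.l2NormSq_le b t hb hbb ht)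
    refine tsum_congr fun m => setLIntegral_congr_fun measurableSet_Ioi fun ξ hξ => ?_
    rw [normalize_succ w m ht (le_of_lt hξ)]
  · rw [normalize_succ w 0 ht le_rfl]
    exact h.weak.expL1_eq hbr 0 ht le_rfl

/-- A continuous kernel of order `(1 + t)^{-j}`. -/
structure IsKernel (j : ℝ) (κ : ℝ → ℝ) (A : ℝ) : Prop where
  nonneg : 0 ≤ A
  continuous : Continuous κ
  bound : ∀ t, 0 ≤ t → |κ t| ≤ A * wt (-j) t

/-- `∫_0^∞ κ(t) u(t) dt`. -/
noncomputable def superpose (κ : ℝ → ℝ) (u : ℝ → ℕ → ℝ → ℂ) (ℓ : ℕ) (ξ : ℝ) : ℂ :=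
  ∫ t in Ioi (0 : ℝ), (κ t : ℂ) * u t ℓ ξ

namespace IsPropagator

variable {K r br C : ℝ} {v : ℕ → ℝ → ℂ} {u : ℝ → ℕ → ℝ → ℂ}

theorem isDominated (h : IsPropagator K r br v u C) {j A : ℝ} {κ : ℝ → ℝ} (hκ : IsKernel j κ A)
    (hj : 1 < br + j) (ℓ : ℕ) :
    IsDominated halfLine (fun s ξ => (κ s : ℂ) * u s ℓ ξ)
      fun s => A * (C * rt ℓ) * wt (-(br + j)) s where
  measurable := (Complex.continuous_ofReal.comp
    (hκ.continuous.comp continuous_fst)).stronglyMeasurable.mul (h.regular.stronglyMeasurable ℓ)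
  continuous s := continuous_const.mul (h.regular.continuous s ℓ)
  integrable := (integrable_wt hj).integrableOn.const_mul _
  bound := by
    filter_upwards [ae_restrict_mem measurableSet_Ioi] with s hs ξ
    have hs' : 0 ≤ s := le_of_lt hs
    rw [norm_mul, Complex.norm_real, Real.norm_eq_abs]
    refine (mul_le_mul (hκ.bound s hs') (h.norm_le s ℓ ξ hs') (norm_nonneg _)
      (mul_nonneg hκ.nonneg (wt_pos _ _).le)).trans_eq ?_
    rw [show -(br + j) = -j + -br by ring, ← wt_mul_wt]
    ring

theorem continuous_superpose (h : IsPropagator K r br v u C) {j A : ℝ} {κ : ℝ → ℝ}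
    (hκ : IsKernel j κ A) (hj : 1 < br + j) (ℓ : ℕ) : Continuous (superpose κ u ℓ) :=
  (h.isDominated hκ hj ℓ).continuous_integral

theorem superpose_zero_mode (h : IsPropagator K r br v u C) (κ : ℝ → ℝ) (ξ : ℝ) :
    superpose κ u 0 ξ = 0 := by
  simp [superpose, h.regular.zero]

/-- With `q = br - b + j`, the majorant `(1 + t)^{-j}` is split into exponents `-q / 2` and `q / 2 -
j`. The first squares to `-q`. The second squares to `q - 2j`, which the decay exponent `2(b - br)`
of the squared norm also turns into `-q`. Both time integrals converge since `q > 1`. -/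
theorem l2NormSq_superpose_lt_top (h : IsPropagator K r br v u C) {j A b : ℝ} {κ : ℝ → ℝ}
    (hκ : IsKernel j κ A) (hb : 0 ≤ b) (hbb : b ≤ br) (hj : 1 < br - b + j) :
    l2NormSq b (superpose κ u) < ⊤ := by
  set q := br - b + j with hq
  have hm : ∀ a : ℝ, Measurable fun s => ENNReal.ofReal (wt a s) := fun a =>
    (continuous_wt a).measurable.ennreal_ofReal
  have hfin : ∀ D : ℝ, ∫⁻ s in Ioi (0 : ℝ), ENNReal.ofReal (D * wt (-q) s) < ⊤ := fun D =>
    (((integrable_wt hj).integrableOn (s := Ioi 0)).const_mul D).lintegral_lt_top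
  have h1 := l2NormSq_integral_le (μ := halfLine) b (f := fun s ℓ ξ => (κ s : ℂ) * u s ℓ ξ)
    (w := u) (α := fun s => ENNReal.ofReal (wt (-q / 2) s))
    (β := fun s => ENNReal.ofReal (A * wt (q / 2 - j) s)) (hm _)
    (((continuous_wt _).const_mul A).measurable.ennreal_ofReal)
    h.regular.stronglyMeasurable (by
      filter_upwards [ae_restrict_mem measurableSet_Ioi] with s hs ℓ ξ
      rw [enorm_mul, ← mul_assoc, ← ENNReal.ofReal_mul (wt_pos _ _).le]
      refine mul_le_mul' ?_ le_rfl
      rw [← ofReal_norm, Complex.norm_real, Real.norm_eq_abs]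
      refine ENNReal.ofReal_le_ofReal ((hκ.bound s (le_of_lt hs)).trans_eq ?_)
      rw [mul_left_comm, wt_mul_wt]
      congr 2
      ring)
  refine h1.trans_lt (ENNReal.mul_lt_top ?_ ?_)
  · refine lt_of_le_of_lt (le_of_eq ?_) (hfin 1)
    refine lintegral_congr fun s => ?_
    rw [← ENNReal.ofReal_pow (wt_pos _ _).le, wt_sq, one_mul]
    congr 2
    ring
  · refine lt_of_le_of_lt ?_ (hfin (A ^ 2 * C))
    refine setLIntegral_mono' measurableSet_Ioi fun s hs => ?_
    refine (mul_le_mul' le_rfl (h.l2NormSq_le b s hb hbb (le_of_lt hs))).trans_eq ?_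
    rw [← ENNReal.ofReal_pow (mul_nonneg hκ.nonneg (wt_pos _ _).le),
      ← ENNReal.ofReal_mul (by positivity), mul_pow, wt_sq]
    congr 1
    have : -q = 2 * (q / 2 - j) + 2 * (b - br) := by rw [hq]; ring
    rw [this, ← wt_mul_wt]
    ring

theorem continuous_integral_test (h : IsPropagator K r br v u C) (ℓ : ℕ) {φ : ℝ → ℂ}
    (hφ : Integrable φ halfLine) : Continuous fun s => ∫ ξ in Ioi (0 : ℝ), u s ℓ ξ * φ ξ := by
  refine continuous_of_dominated (bound := fun ξ => C * rt ℓ * ‖φ ξ‖)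
    (fun s => (h.regular.continuous s ℓ).aestronglyMeasurable.mul hφ.aestronglyMeasurable)
    (fun s => Eventually.of_forall fun ξ => ?_) (hφ.norm.const_mul _)
    (Eventually.of_forall fun ξ => (h.regular.continuous_time ℓ ξ).mul continuous_const)
  rw [norm_mul]
  exact mul_le_mul_of_nonneg_right (h.norm_le' s ℓ ξ) (norm_nonneg _)

theorem norm_integral_test_le (h : IsPropagator K r br v u C) (ℓ : ℕ) {φ : ℝ → ℂ}
    (hφ : Integrable φ halfLine) {s : ℝ} (hs : 0 ≤ s) :
    ‖∫ ξ in Ioi (0 : ℝ), u s ℓ ξ * φ ξ‖ ≤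
      C * rt ℓ * wt (-br) s * ∫ ξ in Ioi (0 : ℝ), ‖φ ξ‖ := by
  rw [← integral_const_mul]
  refine norm_integral_le_of_norm_le (hφ.norm.const_mul _) (Eventually.of_forall fun ξ => ?_)
  rw [norm_mul]
  exact mul_le_mul_of_nonneg_right (h.norm_le s ℓ ξ hs) (norm_nonneg _)

theorem integrable_mul_integral_test (h : IsPropagator K r br v u C) {j A : ℝ} {κ : ℝ → ℝ}
    (hκ : IsKernel j κ A) (hj : 1 < br + j) (ℓ : ℕ) {φ : ℝ → ℂ} (hφ : Integrable φ halfLine) :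
    Integrable (fun s => (κ s : ℂ) * ∫ ξ in Ioi (0 : ℝ), u s ℓ ξ * φ ξ) halfLine := by
  have := (h.isDominated hκ hj ℓ).integrable_integral hφ
  simpa only [mul_assoc, integral_const_mul] using this

theorem integral_superpose_mul (h : IsPropagator K r br v u C) {j A : ℝ} {κ : ℝ → ℝ}
    (hκ : IsKernel j κ A) (hj : 1 < br + j) (ℓ : ℕ) {φ : ℝ → ℂ} (hφ : Integrable φ halfLine) :
    ∫ ξ in Ioi (0 : ℝ), superpose κ u ℓ ξ * φ ξ =
      ∫ s in Ioi (0 : ℝ), (κ s : ℂ) * ∫ ξ in Ioi (0 : ℝ), u s ℓ ξ * φ ξ := by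
  have := (h.isDominated hκ hj ℓ).integral_swap hφ
  simp only [mul_assoc, integral_const_mul] at this
  exact this

/-- `L₁ ∫ κ e^{tL₁} v = -κ(0) v - ∫ κ' e^{tL₁} v`. -/
theorem isPrim_superpose (h : IsPropagator K r br v u C) {j A A' : ℝ} {κ κ' : ℝ → ℝ}
    (hκ : IsKernel j κ A) (hκ' : IsKernel j κ' A') (hd : ∀ t, HasDerivAt κ (κ' t) t)
    (hj : 1 < br + j) (m : ℕ) :
    IsPrim (superpose κ u (m + 1)) fun ξ =>
      (-(κ 0 * u 0 (m + 1) ξ) - superpose κ' u (m + 1) ξ) / ((m : ℂ) + 1) -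
        K * r / 2 * (superpose κ u m ξ - superpose κ u (m + 2) ξ) := by
  have hm : ((m : ℂ) + 1) ≠ 0 := Nat.cast_add_one_ne_zero m
  have hcV : ∀ ℓ, Continuous (superpose κ u ℓ) := h.continuous_superpose hκ hj
  have hcV' : ∀ ℓ, Continuous (superpose κ' u ℓ) := h.continuous_superpose hκ' hj
  have hcd : Continuous fun ξ =>
      (-(κ 0 * u 0 (m + 1) ξ) - superpose κ' u (m + 1) ξ) / ((m : ℂ) + 1) -
        K * r / 2 * (superpose κ u m ξ - superpose κ u (m + 2) ξ) :=
    (((continuous_const.mul (h.regular.continuous 0 _)).neg.sub (hcV' _)).div_const _).sub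
      (continuous_const.mul ((hcV _).sub (hcV _)))
  obtain ⟨f, hf, hWf⟩ := exists_isPrim_of_weak_deriv (u := superpose κ u (m + 1))
    (fun R _ => (hcV _).intervalIntegrable _ _) (fun R _ => hcd.intervalIntegrable _ _) (by
      intro ψ hψ
      have hφ := integrable_ofReal_test hψ.continuous hψ.compact
      have hφ' := integrable_ofReal_test hψ.deriv.continuous hψ.deriv.compact
      let G : ℕ → ℝ → ℂ := fun ℓ s => ∫ ξ in Ioi (0 : ℝ), u s ℓ ξ * (ψ ξ : ℂ)
      let G' : ℝ → ℂ := fun s => ∫ ξ in Ioi (0 : ℝ), u s (m + 1) ξ * ((deriv ψ ξ : ℝ) : ℂ)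
      -- The time derivative of `G (m + 1)`, by the weak equation.
      let H : ℝ → ℂ := fun s => -((m : ℂ) + 1) * G' s +
        (K * r / 2 * ((m : ℂ) + 1)) * (G m s - G (m + 2) s)
      have hG : ∀ ℓ, Continuous (G ℓ) := fun ℓ => h.continuous_integral_test ℓ hφ
      have hG' : Continuous G' := h.continuous_integral_test (m + 1) hφ'
      have hH : Continuous H :=
        (continuous_const.mul hG').add (continuous_const.mul ((hG m).sub (hG (m + 2))))
      have hGd : ∀ s ∈ Ioi (0 : ℝ), HasDerivAt (G (m + 1)) (H s) s := by
        intro s hs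
        have h1 : HasDerivAt (fun t => G (m + 1) 0 + ∫ σ in (0 : ℝ)..t, H σ) (H s) s :=
          (hH.integral_hasStrictDerivAt 0 s).hasDerivAt.const_add _
        refine h1.congr_of_eventuallyEq ?_
        filter_upwards [Ioi_mem_nhds hs] with t ht
        exact h.regular.equation m ψ hψ t (le_of_lt ht)
      have hκd : ∀ s ∈ Ioi (0 : ℝ), HasDerivAt (fun t => (κ t : ℂ)) (κ' s) s := fun s _ =>
        (hd s).ofReal_comp
      have i1 := h.integrable_mul_integral_test hκ hj (m + 1) hφ'
      have i2 := h.integrable_mul_integral_test hκ hj m hφ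
      have i3 := h.integrable_mul_integral_test hκ hj (m + 2) hφ
      have i4 := h.integrable_mul_integral_test hκ' hj (m + 1) hφ
      have i23 : Integrable (fun s => (κ s : ℂ) * G m s - κ s * G (m + 2) s) halfLine := i2.sub i3
      have eH : ∀ s, (κ s : ℂ) * H s = -((m : ℂ) + 1) * (κ s * G' s) +
          (K * r / 2 * ((m : ℂ) + 1)) * (κ s * G m s - κ s * G (m + 2) s) := fun s => by
        simp only [H]; ring
      have iH : IntegrableOn (fun s => (κ s : ℂ) * H s) (Ioi 0) := by
        simp only [eH]
        exact (i1.const_mul _).add (i23.const_mul _)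
      have hlim0 : Tendsto (fun s => (κ s : ℂ) * G (m + 1) s) (𝓝[>] 0)
          (𝓝 (κ 0 * G (m + 1) 0)) :=
        (((Complex.continuous_ofReal.comp hκ.continuous).mul (hG (m + 1))).tendsto 0).mono_left
          nhdsWithin_le_nhds
      have hlim : Tendsto (fun s => (κ s : ℂ) * G (m + 1) s) atTop (𝓝 0) := by
        have h1 := (tendsto_wt_atTop (q := br + j) (by linarith)).const_mul
          (A * (C * rt (m + 1)) * ∫ ξ in Ioi (0 : ℝ), ‖(ψ ξ : ℂ)‖)
        rw [mul_zero] at h1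
        refine squeeze_zero_norm' ?_ h1
        filter_upwards [eventually_ge_atTop 0] with s hs
        rw [norm_mul, Complex.norm_real, Real.norm_eq_abs]
        refine (mul_le_mul (hκ.bound s hs) (h.norm_integral_test_le (m + 1) hφ hs) (norm_nonneg _)
          (mul_nonneg hκ.nonneg (wt_pos _ _).le)).trans_eq ?_
        rw [show -(br + j) = -j + -br by ring, ← wt_mul_wt]
        ring
      -- The boundary term at infinity vanishes because `κ G` is of order `(1 + s)^{-(br + j)}`; the
      -- one at `0` produces the initial value.
      have hparts := integral_Ioi_mul_deriv_eq_deriv_mul hκd hGd iH i4 hlim0 hlim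
      simp only [eH] at hparts
      rw [integral_add (i1.const_mul _) (i23.const_mul _), integral_const_mul, integral_const_mul,
        integral_sub i2 i3, ← h.integral_superpose_mul hκ hj (m + 1) hφ',
        ← h.integral_superpose_mul hκ hj m hφ, ← h.integral_superpose_mul hκ hj (m + 2) hφ,
        ← h.integral_superpose_mul hκ' hj (m + 1) hφ] at hparts
      have c := hψ.continuous
      have k := hψ.compact
      have k1 := integrable_continuous_mul (h.regular.continuous 0 (m + 1)) c k
      have k2 := integrable_continuous_mul (hcV' (m + 1)) c k
      have k3 := integrable_continuous_mul (hcV m) c k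
      have k4 := integrable_continuous_mul (hcV (m + 2)) c k
      have e5 : ∀ ξ, ((-(κ 0 * u 0 (m + 1) ξ) - superpose κ' u (m + 1) ξ) / ((m : ℂ) + 1) -
          K * r / 2 * (superpose κ u m ξ - superpose κ u (m + 2) ξ)) * (ψ ξ : ℂ) =
          ((m : ℂ) + 1)⁻¹ * (-κ 0 * (u 0 (m + 1) ξ * (ψ ξ : ℂ)) -
            superpose κ' u (m + 1) ξ * (ψ ξ : ℂ)) -
          K * r / 2 * (superpose κ u m ξ * (ψ ξ : ℂ) -
            superpose κ u (m + 2) ξ * (ψ ξ : ℂ)) := fun ξ => by ring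
      have k12 : Integrable (fun ξ => -κ 0 * (u 0 (m + 1) ξ * (ψ ξ : ℂ)) -
            superpose κ' u (m + 1) ξ * (ψ ξ : ℂ)) halfLine := (k1.const_mul _).sub k2
      have k34 : Integrable (fun ξ => superpose κ u m ξ * (ψ ξ : ℂ) -
            superpose κ u (m + 2) ξ * (ψ ξ : ℂ)) halfLine := k3.sub k4
      simp only [e5]
      rw [integral_sub (k12.const_mul _) (k34.const_mul _), integral_const_mul,
        integral_const_mul, integral_sub (k1.const_mul _) k2, integral_sub k3 k4,
        integral_const_mul]
      have hA : (κ 0 : ℂ) * G (m + 1) 0 = κ 0 * ∫ ξ in Ioi (0 : ℝ), u 0 (m + 1) ξ * (ψ ξ : ℂ) := rfl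
      rw [hA] at hparts
      field_simp
      linear_combination -2 * hparts)
  have heq := eqOn_of_ae_eq_halfLine (hcV _).continuousOn hf.continuousOn hWf
  exact ⟨hf.integrable, fun x hx => by
    rw [heq (mem_Ici.2 hx), heq (mem_Ici.2 le_rfl)]; exact hf.eq x hx⟩

/-- The frequency derivative is recovered from the resolvent equation. Dividing that equation by `ℓ`
cancels the linear growth of the interaction, so the derivative is a combination of the initial
state, the superposition for `κ'` and the neighbouring modes, all in the weighted `L²` space. -/
theorem memXp_superpose (h : IsPropagator K r br v u C) {j A A' b : ℝ} {κ κ' : ℝ → ℝ}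
    (hκ : IsKernel j κ A) (hκ' : IsKernel j κ' A') (hd : ∀ t, HasDerivAt κ (κ' t) t)
    (hb : 0 ≤ b) (hbb : b ≤ br) (hj : 1 < br - b + j) : MemXp b (superpose κ u) := by
  have hj' : 1 < br + j := by linarith
  have hV := h.l2NormSq_superpose_lt_top hκ hb hbb hj
  have hV' := h.l2NormSq_superpose_lt_top hκ' hb hbb hj
  have hcV : ∀ ℓ, Continuous (superpose κ u ℓ) := h.continuous_superpose hκ hj'
  have hu0 : l2NormSq b (u 0) < ⊤ :=
    (h.l2NormSq_le b 0 hb hbb le_rfl).trans_lt ENNReal.ofReal_lt_top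
  have fin : ∀ {x y z : ℝ≥0∞}, x ≤ 2 * y + 2 * z → y < ⊤ → z < ⊤ → x < ⊤ := fun hx hy hz =>
    hx.trans_lt (ENNReal.add_lt_top.2 ⟨ENNReal.mul_lt_top (by simp) hy,
      ENNReal.mul_lt_top (by simp) hz⟩)
  have hg : l2NormSq b (fun ℓ ξ => -(κ 0 * u 0 ℓ ξ) - superpose κ' u ℓ ξ) < ⊤ := by
    refine fin (l2NormSq_le_of_norm_le b (g := fun ℓ ξ => κ 0 * u 0 ℓ ξ) (h := superpose κ' u)
      (fun ℓ => (continuous_const.mul (h.regular.continuous 0 ℓ)).measurable)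
      fun m ξ => (norm_sub_le _ _).trans_eq (by rw [norm_neg])) ?_ hV'
    rw [l2NormSq_const_mul]
    exact ENNReal.mul_lt_top (by finiteness) hu0
  have hh : l2NormSq b (fun ℓ ξ => (K * r / 2 : ℂ) * (superpose κ u (ℓ - 1) ξ -
      superpose κ u (ℓ + 1) ξ)) < ⊤ := by
    rw [l2NormSq_const_mul]
    refine ENNReal.mul_lt_top (by finiteness) (fin (l2NormSq_le_of_norm_le b
      (g := fun ℓ => superpose κ u (ℓ - 1)) (h := fun ℓ => superpose κ u (ℓ + 1))
      (fun ℓ => (hcV _).measurable) fun m ξ => norm_sub_le _ _) ?_ ?_)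
    · exact (l2NormSq_pred_le b (h.superpose_zero_mode κ)).trans_lt hV
    · exact (l2NormSq_succ_le b _).trans_lt (ENNReal.mul_lt_top (by simp) hV)
  refine memXp_of_isPrim (d := fun ℓ ξ => (-(κ 0 * u 0 ℓ ξ) - superpose κ' u ℓ ξ) / (ℓ : ℂ) -
    K * r / 2 * (superpose κ u (ℓ - 1) ξ - superpose κ u (ℓ + 1) ξ)) (fun m => ?_)
    (fun ℓ => (hcV ℓ).measurable) hV (fin (l2NormSq_le_of_norm_le b (fun ℓ => ?_)
      fun m ξ => (norm_sub_le _ _).trans (add_le_add ?_ le_rfl)) hg hh)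
  · have := h.isPrim_superpose hκ hκ' hd hj' m
    push_cast
    exact this
  · exact ((continuous_const.mul (h.regular.continuous 0 ℓ)).neg.sub
      (h.continuous_superpose hκ' hj' ℓ)).measurable
  · rw [norm_div]
    refine div_le_self (norm_nonneg _) ?_
    rw [Complex.norm_natCast]
    push_cast
    linarith [show (0 : ℝ) ≤ m by positivity]

/-- The resolvent equation for superpositions. -/
theorem modeEq_opL1_superpose (h : IsPropagator K r br v u C) {j A A' : ℝ} {κ κ' : ℝ → ℝ}
    (hκ : IsKernel j κ A) (hκ' : IsKernel j κ' A') (hd : ∀ t, HasDerivAt κ (κ' t) t)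
    (hj : 1 < br + j) :
    ModeEq (opL1 K r (superpose κ u)) (-(κ 0 • v) - superpose κ' u) := by
  intro ℓ hℓ
  obtain ⟨m, rfl⟩ : ∃ m, ℓ = m + 1 := ⟨ℓ - 1, by omega⟩
  filter_upwards [(h.isPrim_superpose hκ hκ' hd hj m).deriv_ae,
    ae_restrict_mem measurableSet_Ioi] with ξ hξ hpos
  have hm : ((m : ℂ) + 1) ≠ 0 := Nat.cast_add_one_ne_zero m
  have hl : lowerMode (superpose κ u) (m + 1) ξ = superpose κ u m ξ := by
    rcases m with _ | m
    · simp [lowerMode, h.superpose_zero_mode]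
    · simp [lowerMode]
  simp only [opL1, hξ, hl, Pi.sub_apply, Pi.neg_apply, Pi.smul_apply, Complex.real_smul]
  rw [h.initial m ξ (le_of_lt hpos)]
  push_cast
  field_simp
  ring

end IsPropagator

/-! ### Modes of the linearised operator -/

theorem MemXp.add {b : ℝ} {u v : ℕ → ℝ → ℂ} (hu : MemXp b u) (hv : MemXp b v) :
    MemXp b (u + v) := by
  obtain ⟨x, hx⟩ := hu.exists_isState
  obtain ⟨y, hy⟩ := hv.exists_isState
  have h : IsState b (u + v) (x + y) := fun m => by
    have := (hx m).add (hy m)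
    rw [← smul_add] at this
    exact this
  exact h.memXp

theorem IsKernel.mul {j j' A A' : ℝ} {κ κ' : ℝ → ℝ} (h : IsKernel j κ A) (h' : IsKernel j' κ' A') :
    IsKernel (j + j') (fun t => κ t * κ' t) (A * A') where
  nonneg := mul_nonneg h.nonneg h'.nonneg
  continuous := h.continuous.mul h'.continuous
  bound t ht := by
    rw [abs_mul]
    refine (mul_le_mul (h.bound t ht) (h'.bound t ht) (abs_nonneg _)
      (mul_nonneg h.nonneg (wt_pos _ _).le)).trans_eq ?_
    rw [show -(j + j') = -j + -j' by ring, ← wt_mul_wt]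
    ring

theorem IsKernel.integrable {j A : ℝ} {κ : ℝ → ℝ} (h : IsKernel j κ A) (hj : 1 < j) :
    Integrable κ halfLine := by
  refine ((integrable_wt hj).integrableOn.const_mul A).mono'
    h.continuous.aestronglyMeasurable ?_
  filter_upwards [ae_restrict_mem measurableSet_Ioi] with t ht using h.bound t (le_of_lt ht)

theorem IsPropagator.superpose_linear {K r br C : ℝ} {v : ℕ → ℝ → ℂ} {u : ℝ → ℕ → ℝ → ℂ}
    (h : IsPropagator K r br v u C) {j A A' : ℝ} {κ κ' : ℝ → ℝ} (hκ : IsKernel j κ A)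
    (hκ' : IsKernel j κ' A') (hj : 1 < br + j) (x y : ℝ) :
    superpose (fun t => x * κ t + y * κ' t) u = x • superpose κ u + y • superpose κ' u := by
  funext ℓ ξ
  have i1 := (h.isDominated hκ hj ℓ).integrable_apply ξ
  have i2 := (h.isDominated hκ' hj ℓ).integrable_apply ξ
  simp only [superpose, Pi.add_apply, Pi.smul_apply, Complex.real_smul]
  rw [← integral_const_mul, ← integral_const_mul,
    ← integral_add (i1.const_mul _) (i2.const_mul _)]
  refine integral_congr_ae (Eventually.of_forall fun t => ?_)
  simp only
  push_cast
  ring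

/-- The vector `(r_r, r_i)`. -/
noncomputable def driving (K r : ℝ) (g : Measure ℝ) : Fin 2 → ℕ → ℝ → ℂ := ![rR K r g, rI K r g]

/-- `U = (e^{tL₁} r_r, e^{tL₁} r_i)`. -/
def IsFundamental (K r br : ℝ) (g : Measure ℝ) (U : Fin 2 → ℝ → ℕ → ℝ → ℂ) : Prop :=
  ∀ i, ∃ C, IsPropagator K r br (driving K r g i) (U i) C

theorem exists_isFundamental {K r br : ℝ} {g : Measure ℝ} (hbr : 0 ≤ br)
    (hr : MemXp br (rR K r g)) (hi : MemXp br (rI K r g)) : ∃ U, IsFundamental K r br g U := by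
  obtain ⟨u, C, h⟩ := exists_isPropagator hbr K r hr
  obtain ⟨uI, CI, hI⟩ := exists_isPropagator hbr K r hi
  refine ⟨![u, uI], fun i => ?_⟩
  fin_cases i
  · exact ⟨C, h⟩
  · exact ⟨CI, hI⟩

/-- A pair of kernels of order `(1 + t)^{-j}` with its derivative. -/
structure IsKernelPair (j : ℝ) (κ κ' : Fin 2 → ℝ → ℝ) : Prop where
  kernel : ∀ i, ∃ A, IsKernel j (κ i) A
  kernel_deriv : ∀ i, ∃ A, IsKernel j (κ' i) A
  hasDerivAt : ∀ i t, HasDerivAt (κ i) (κ' i t) t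

/-- `∫_0^∞ κ_0(t) e^{tL₁} r_r + κ_1(t) e^{tL₁} r_i dt`. -/
noncomputable def modeOf (U : Fin 2 → ℝ → ℕ → ℝ → ℂ) (κ : Fin 2 → ℝ → ℝ) : ℕ → ℝ → ℂ :=
  superpose (κ 0) (U 0) + superpose (κ 1) (U 1)

/-- The value of the mode that makes it an eigenmode. -/
def IsBalanced (U : Fin 2 → ℝ → ℕ → ℝ → ℂ) (κ : Fin 2 → ℝ → ℝ) : Prop :=
  (modeOf U κ 1 0).re = κ 0 0 ∧ (modeOf U κ 1 0).im = κ 1 0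

/-- This exhibits `L₂` as an operator of real rank at most two, which reduces the eigenvalue problem
to a two by two system. -/
theorem opL2_eq (K r : ℝ) (g : Measure ℝ) (u : ℕ → ℝ → ℂ) (ℓ : ℕ) (ξ : ℝ) :
    opL2 K r g u ℓ ξ = (u 1 0).re * rR K r g ℓ ξ + (u 1 0).im * rI K r g ℓ ξ := by
  have h1 : u 1 0 = (u 1 0).re + (u 1 0).im * Complex.I := (Complex.re_add_im _).symm
  have h2 : conj (u 1 0) = (u 1 0).re - (u 1 0).im * Complex.I := by
    apply Complex.ext <;> simp
  unfold opL2 rR rI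
  rw [h2]
  nth_rewrite 1 [h1]
  ring

theorem opL1_add {K r : ℝ} {u v : ℕ → ℝ → ℂ} {ℓ : ℕ} {ξ : ℝ} (hu : DifferentiableAt ℝ (u ℓ) ξ)
    (hv : DifferentiableAt ℝ (v ℓ) ξ) :
    opL1 K r (u + v) ℓ ξ = opL1 K r u ℓ ξ + opL1 K r v ℓ ξ := by
  have hl : lowerMode (u + v) ℓ ξ = lowerMode u ℓ ξ + lowerMode v ℓ ξ := by
    unfold lowerMode
    split_ifs <;> simp
  have hd : deriv ((u + v) ℓ) ξ = deriv (u ℓ) ξ + deriv (v ℓ) ξ := deriv_add hu hv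
  unfold opL1
  rw [hl, hd]
  simp only [Pi.add_apply]
  ring

/-- `ModeEq` ignores null sets, while `L` involves a derivative and the value at frequency `0`;
vanishing at every `ξ ≥ 0` is therefore required. -/
theorem modeEq_opL_of_eq_zero {K r : ℝ} {g : Measure ℝ} {w : ℕ → ℝ → ℂ}
    (h : ∀ m ξ, 0 ≤ ξ → w (m + 1) ξ = 0) : ModeEq (opL K r g w) 0 := by
  intro ℓ hℓ
  obtain ⟨m, rfl⟩ : ∃ m, ℓ = m + 1 := ⟨ℓ - 1, by omega⟩
  filter_upwards [ae_restrict_mem measurableSet_Ioi] with ξ hξ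
  have hξ' : 0 ≤ ξ := le_of_lt hξ
  have hd : deriv (w (m + 1)) ξ = 0 := by
    have : w (m + 1) =ᶠ[𝓝 ξ] fun _ => 0 := by
      filter_upwards [Ioi_mem_nhds hξ] with x hx using h m x (le_of_lt hx)
    rw [this.deriv_eq, deriv_const]
  have hl : lowerMode w (m + 1) ξ = 0 := by
    rcases m with _ | m
    · simp [lowerMode]
    · simpa [lowerMode] using h m ξ hξ'
  simp [opL, opL1, opL2, hd, hl, h (m + 1) ξ hξ', h 0 0 le_rfl]

namespace IsFundamental

variable {K r br j : ℝ} {g : Measure ℝ} {U : Fin 2 → ℝ → ℕ → ℝ → ℂ} {κ κ' : Fin 2 → ℝ → ℝ}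

theorem continuous_modeOf (h : IsFundamental K r br g U) (hκ : ∀ i, ∃ A, IsKernel j (κ i) A)
    (hj : 1 < br + j) (ℓ : ℕ) : Continuous (modeOf U κ ℓ) := by
  obtain ⟨C0, h0⟩ := h 0
  obtain ⟨C1, h1⟩ := h 1
  obtain ⟨A0, k0⟩ := hκ 0
  obtain ⟨A1, k1⟩ := hκ 1
  exact (h0.continuous_superpose k0 hj ℓ).add (h1.continuous_superpose k1 hj ℓ)

theorem eq_zero_of_modeEq (h : IsFundamental K r br g U) (hκ : ∀ i, ∃ A, IsKernel j (κ i) A)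
    (hj : 1 < br + j) (h0 : ModeEq (modeOf U κ) 0) (m : ℕ) (ξ : ℝ) (hξ : 0 ≤ ξ) :
    modeOf U κ (m + 1) ξ = 0 :=
  eqOn_of_ae_eq_halfLine (g := fun _ => 0) (h.continuous_modeOf hκ hj (m + 1)).continuousOn
    continuousOn_const (h0 (m + 1) (by omega)) hξ

theorem memXp_modeOf (h : IsFundamental K r br g U) (hκ : IsKernelPair j κ κ') {b : ℝ}
    (hb : 0 ≤ b) (hbb : b ≤ br) (hj : 1 < br - b + j) : MemXp b (modeOf U κ) := by
  obtain ⟨C0, h0⟩ := h 0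
  obtain ⟨C1, h1⟩ := h 1
  obtain ⟨A0, k0⟩ := hκ.kernel 0
  obtain ⟨A1, k1⟩ := hκ.kernel 1
  obtain ⟨A0', k0'⟩ := hκ.kernel_deriv 0
  obtain ⟨A1', k1'⟩ := hκ.kernel_deriv 1
  exact (h0.memXp_superpose k0 k0' (hκ.hasDerivAt 0) hb hbb hj).add
    (h1.memXp_superpose k1 k1' (hκ.hasDerivAt 1) hb hbb hj)

/-- The source terms `-κ i 0` times `r_r`, `r_i` left by `L₁` are cancelled by `L₂`, whose
coefficients are the real and imaginary parts of the value of the mode, equal to `κ i 0` by balance.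
-/
theorem modeEq_opL_modeOf (h : IsFundamental K r br g U) (hκ : IsKernelPair j κ κ')
    (hj : 1 < br + j) (hbal : IsBalanced U κ) :
    ModeEq (opL K r g (modeOf U κ)) (-modeOf U κ') := by
  obtain ⟨C0, h0⟩ := h 0
  obtain ⟨C1, h1⟩ := h 1
  obtain ⟨A0, k0⟩ := hκ.kernel 0
  obtain ⟨A1, k1⟩ := hκ.kernel 1
  obtain ⟨A0', k0'⟩ := hκ.kernel_deriv 0
  obtain ⟨A1', k1'⟩ := hκ.kernel_deriv 1
  intro ℓ hℓ
  obtain ⟨m, rfl⟩ : ∃ m, ℓ = m + 1 := ⟨ℓ - 1, by omega⟩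
  filter_upwards [h0.modeEq_opL1_superpose k0 k0' (hκ.hasDerivAt 0) hj (m + 1) hℓ,
    h1.modeEq_opL1_superpose k1 k1' (hκ.hasDerivAt 1) hj (m + 1) hℓ,
    (h0.isPrim_superpose k0 k0' (hκ.hasDerivAt 0) hj m).ae_hasDerivAt,
    (h1.isPrim_superpose k1 k1' (hκ.hasDerivAt 1) hj m).ae_hasDerivAt] with ξ e0 e1 d0 d1
  simp only [opL, Pi.add_apply]
  rw [opL2_eq, hbal.1, hbal.2]
  unfold modeOf
  rw [opL1_add d0.differentiableAt d1.differentiableAt, e0, e1]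
  simp only [driving, Matrix.cons_val_zero, Matrix.cons_val_one, Pi.sub_apply, Pi.neg_apply,
    Pi.add_apply, Pi.smul_apply, Complex.real_smul]
  ring

theorem modeOf_linear (h : IsFundamental K r br g U) (hκ : ∀ i, ∃ A, IsKernel j (κ i) A)
    (hκ' : ∀ i, ∃ A, IsKernel j (κ' i) A) (hj : 1 < br + j) (x y : ℝ) :
    modeOf U (fun i t => x * κ i t + y * κ' i t) = x • modeOf U κ + y • modeOf U κ' := by
  obtain ⟨C0, h0⟩ := h 0
  obtain ⟨C1, h1⟩ := h 1
  obtain ⟨A0, k0⟩ := hκ 0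
  obtain ⟨A1, k1⟩ := hκ 1
  obtain ⟨A0', k0'⟩ := hκ' 0
  obtain ⟨A1', k1'⟩ := hκ' 1
  unfold modeOf
  rw [h0.superpose_linear k0 k0' hj, h1.superpose_linear k1 k1' hj]
  simp only [smul_add]
  abel

/-- The Volterra kernel is a continuous kernel of order `(1 + t)^{-b_r}`. -/
theorem exists_kLc_eq (h : IsFundamental K r br g U) : ∃ k : Fin 2 → Fin 2 → ℝ → ℝ,
    (∀ i i', ∃ A, IsKernel br (k i i') A) ∧
    (∀ i i' t, 0 ≤ t → kLc K r g br t i i' = k i i' t) ∧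
    (∀ i' t, U i' t 1 0 = -(k 0 i' t + k 1 i' t * Complex.I)) := by
  have key : ∀ i' : Fin 2, ∃ A, IsKernel br (fun t => -(U i' t 1 0).re) A ∧
      IsKernel br (fun t => -(U i' t 1 0).im) A := by
    intro i'
    obtain ⟨C, hC⟩ := h i'
    have hc : Continuous fun t => U i' t 1 0 := hC.regular.continuous_time 1 0
    refine ⟨C * rt 1, ⟨mul_nonneg hC.nonneg (rt_pos 1).le, (Complex.continuous_re.comp hc).neg,
      fun t ht => ?_⟩, ⟨mul_nonneg hC.nonneg (rt_pos 1).le, (Complex.continuous_im.comp hc).neg,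
      fun t ht => ?_⟩⟩
    · rw [abs_neg]
      exact (Complex.abs_re_le_norm _).trans (hC.norm_le t 1 0 ht)
    · rw [abs_neg]
      exact (Complex.abs_im_le_norm _).trans (hC.norm_le t 1 0 ht)
  obtain ⟨C0, h0⟩ := h 0
  obtain ⟨C1, h1⟩ := h 1
  -- Defined through the separately continuous propagators, so that the kernel is continuous on the
  -- whole line; only nonnegative times are compared with `kLc`.
  refine ⟨fun i i' t => if i = 0 then -(U i' t 1 0).re else -(U i' t 1 0).im, fun i i' => ?_,
    fun i i' t ht => ?_, fun i' t => ?_⟩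
  · obtain ⟨A, hA⟩ := key i'
    refine ⟨A, ?_⟩
    by_cases hi : i = 0
    · simpa only [hi, if_true] using hA.1
    · simpa only [hi, if_false] using hA.2
  · have e0 := h0.expL1_eq t ht
    have e1 := h1.expL1_eq t ht
    simp only [driving, Matrix.cons_val_zero, Matrix.cons_val_one] at e0 e1
    fin_cases i <;> fin_cases i' <;> simp [kLc, e0, e1]
  · apply Complex.ext <;> simp

end IsFundamental

/-- Turns the balance condition into the linear condition `κ(0) + ∫ k κ = 0`, which for exponential
kernels is the characteristic equation. -/
theorem modeOf_one_zero {br j : ℝ} {U : Fin 2 → ℝ → ℕ → ℝ → ℂ} {κ : Fin 2 → ℝ → ℝ}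
    (hκ : ∀ i, ∃ A, IsKernel j (κ i) A)
    (hj : 1 < br + j) {k : Fin 2 → Fin 2 → ℝ → ℝ} (hk : ∀ i i', ∃ A, IsKernel br (k i i') A)
    (hU : ∀ i' t, U i' t 1 0 = -(k 0 i' t + k 1 i' t * Complex.I)) :
    (modeOf U κ 1 0).re = -∑ i, ∫ t in Ioi (0 : ℝ), k 0 i t * κ i t ∧
      (modeOf U κ 1 0).im = -∑ i, ∫ t in Ioi (0 : ℝ), k 1 i t * κ i t := by
  have hint : ∀ i i', Integrable (fun t => k i i' t * κ i' t) halfLine := fun i i' => by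
    obtain ⟨A, hA⟩ := hk i i'
    obtain ⟨A', hA'⟩ := hκ i'
    exact (hA.mul hA').integrable hj
  have e : ∀ i, superpose (κ i) (U i) 1 0 = -(((∫ t in Ioi (0 : ℝ), k 0 i t * κ i t : ℝ) : ℂ) +
      ((∫ t in Ioi (0 : ℝ), k 1 i t * κ i t : ℝ) : ℂ) * Complex.I) := by
    intro i
    rw [← integral_complex_ofReal, ← integral_complex_ofReal, ← integral_mul_const,
      ← integral_add (hint 0 i).ofReal ((hint 1 i).ofReal.mul_const _), ← integral_neg]
    refine integral_congr_ae (Eventually.of_forall fun t => ?_)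
    simp only [hU]
    push_cast
    ring
  simp only [modeOf, Pi.add_apply, e, Fin.sum_univ_two]
  constructor <;> simp <;> ring

/-! ### Exponential modes -/

/-- `Re (γ e^{-zt} c)`. -/
noncomputable def expKernel (z : ℂ) (c : Fin 2 → ℂ) (γ : ℂ) (i : Fin 2) (t : ℝ) : ℝ :=
  (γ * Complex.exp (-z * t) * c i).re

theorem hasDerivAt_expKernel (z : ℂ) (c : Fin 2 → ℂ) (γ : ℂ) (i : Fin 2) (t : ℝ) :
    HasDerivAt (expKernel z c γ i) (expKernel z c (-z * γ) i t) t := by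
  have h1 : HasDerivAt (fun t : ℝ => Complex.exp (-z * t)) (Complex.exp (-z * t) * (-z)) t := by
    have h2 : HasDerivAt (fun t : ℝ => -z * (t : ℂ)) (-z) t := by
      simpa using (Complex.ofRealCLM.hasDerivAt (x := t)).const_mul (-z)
    exact h2.cexp
  have h3 := (h1.const_mul γ).mul_const (c i)
  have h4 := Complex.reCLM.hasFDerivAt.comp_hasDerivAt t h3
  refine h4.congr_deriv ?_
  simp only [expKernel, Complex.reCLM_apply]
  congr 1
  ring

theorem isKernel_expKernel {z : ℂ} {j A : ℝ} (hA : 0 ≤ A)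
    (h : ∀ t : ℝ, 0 ≤ t → Real.exp (-z.re * t) ≤ A * wt (-j) t) (c : Fin 2 → ℂ) (γ : ℂ)
    (i : Fin 2) : IsKernel j (expKernel z c γ i) (‖γ‖ * ‖c i‖ * A) where
  nonneg := by positivity
  continuous := continuous_iff_continuousAt.2 fun t =>
    (hasDerivAt_expKernel z c γ i t).continuousAt
  bound t ht := by
    refine (Complex.abs_re_le_norm _).trans ?_
    rw [norm_mul, norm_mul, Complex.norm_exp]
    have e : (-z * t).re = -z.re * t := by simp
    rw [e]
    have := mul_le_mul_of_nonneg_left (h t ht) (by positivity : 0 ≤ ‖γ‖ * ‖c i‖)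
    linarith

theorem isKernelPair_expKernel {z : ℂ} {j A : ℝ} (hA : 0 ≤ A)
    (h : ∀ t : ℝ, 0 ≤ t → Real.exp (-z.re * t) ≤ A * wt (-j) t) (c : Fin 2 → ℂ) (γ : ℂ) :
    IsKernelPair j (expKernel z c γ) (expKernel z c (-z * γ)) where
  kernel i := ⟨_, isKernel_expKernel hA h c γ i⟩
  kernel_deriv i := ⟨_, isKernel_expKernel hA h c _ i⟩
  hasDerivAt i t := hasDerivAt_expKernel z c γ i t

/-- Order `2` suffices because `br - b + 2 > 1` even for `b = br`. The constant comes from `(1 + t)²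
≤ 2 + 2 t²` and the quadratic lower bound for `e^{at}`, whose last term times `4 / a²` is `2 t²`. -/
theorem exp_neg_le_wt {a : ℝ} (ha : 0 < a) {t : ℝ} (ht : 0 ≤ t) :
    Real.exp (-a * t) ≤ (2 + 4 / a ^ 2) * wt (-2) t := by
  have h1 := Real.quadratic_le_exp_of_nonneg (mul_nonneg ha.le ht)
  have h2 : wt (-2) t = ((1 + t) ^ 2)⁻¹ := by
    rw [wt, abs_of_nonneg ht, Real.rpow_neg (by positivity)]
    norm_num
  rw [h2, neg_mul, Real.exp_neg, ← div_eq_mul_inv, le_div_iff₀ (by positivity), inv_mul_le_iff₀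
    (Real.exp_pos _)]
  have h3 : (2 + 4 / a ^ 2) * (1 + a * t + (a * t) ^ 2 / 2) ≤
      Real.exp (a * t) * (2 + 4 / a ^ 2) := by
    rw [mul_comm]
    exact mul_le_mul_of_nonneg_right h1 (by positivity)
  refine le_trans ?_ h3
  have h4 : 4 / a ^ 2 * ((a * t) ^ 2 / 2) = 2 * t ^ 2 := by field_simp; ring
  have h5 : 0 ≤ 4 / a ^ 2 * (1 + a * t) := by positivity
  have h6 : 0 ≤ 2 * (a * t + (a * t) ^ 2 / 2) := by positivity
  nlinarith [sq_nonneg (1 - t)]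

/-! ### The characteristic determinant and exponential kernels -/

section Laplace

variable {K r br : ℝ} {g : Measure ℝ} {k : Fin 2 → Fin 2 → ℝ → ℝ}

theorem laplace_kLc_eq (hk : ∀ i i' t, 0 ≤ t → kLc K r g br t i i' = k i i' t) (z : ℂ)
    (i i' : Fin 2) : laplace (kLc K r g br) z i i' =
      ∫ t in Ioi (0 : ℝ), (k i i' t : ℂ) * Complex.exp (-z * t) := by
  simp only [laplace, Matrix.of_apply]
  exact setIntegral_congr_fun measurableSet_Ioi fun t ht => by
    simp only [hk i i' t (le_of_lt ht)]

/-- The Volterra kernel is real, so conjugation passes through the Laplace transform. -/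
theorem charDet_conj (K r : ℝ) (g : Measure ℝ) (b : ℝ) (z : ℂ) :
    charDet K r g b (conj z) = conj (charDet K r g b z) := by
  have e : ∀ i i', laplace (kLc K r g b) (conj z) i i' =
      conj (laplace (kLc K r g b) z i i') := by
    intro i i'
    simp only [laplace, Matrix.of_apply]
    rw [← integral_conj]
    refine integral_congr_ae (Eventually.of_forall fun t => ?_)
    simp [← Complex.exp_conj]
  simp only [charDet, Matrix.det_fin_two, Matrix.add_apply, e, map_sub, map_mul, map_add]
  simp

theorem integral_mul_expKernel {z : ℂ} {i i' : Fin 2}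
    (hint : Integrable (fun t : ℝ => (k i i' t : ℂ) * Complex.exp (-z * t)) halfLine)
    (c : Fin 2 → ℂ) (γ : ℂ) :
    ∫ t in Ioi (0 : ℝ), k i i' t * expKernel z c γ i' t =
      (γ * ((∫ t in Ioi (0 : ℝ), (k i i' t : ℂ) * Complex.exp (-z * t)) * c i')).re := by
  rw [← integral_mul_const, ← integral_const_mul]
  have h := (hint.mul_const (c i')).const_mul γ
  have e := Complex.reCLM.integral_comp_comm h
  simp only [Complex.reCLM_apply] at e
  rw [← e]
  refine integral_congr_ae (Eventually.of_forall fun t => ?_)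
  simp only [expKernel]
  rw [show γ * ((k i i' t : ℂ) * Complex.exp (-z * t) * c i') =
    (k i i' t : ℂ) * (γ * Complex.exp (-z * t) * c i') by ring, Complex.re_ofReal_mul]

theorem integrable_mul_exp {z : ℂ} {j A : ℝ}
    (h : ∀ t : ℝ, 0 ≤ t → Real.exp (-z.re * t) ≤ A * wt (-j) t) (hj : 1 < br + j)
    (hk : ∀ i i', ∃ A, IsKernel br (k i i') A) (i i' : Fin 2) :
    Integrable (fun t : ℝ => (k i i' t : ℂ) * Complex.exp (-z * t)) halfLine := by
  obtain ⟨B, hB⟩ := hk i i'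
  refine ((integrable_wt hj).integrableOn.const_mul (B * A)).mono' ?_ ?_
  · exact ((Complex.continuous_ofReal.comp hB.continuous).mul (Complex.continuous_exp.comp
      (continuous_const.mul Complex.continuous_ofReal))).aestronglyMeasurable
  · filter_upwards [ae_restrict_mem measurableSet_Ioi] with t ht
    have ht' : 0 ≤ t := le_of_lt ht
    have e : (-z * t).re = -z.re * t := by simp
    rw [norm_mul, Complex.norm_real, Complex.norm_exp, e, Real.norm_eq_abs]
    refine (mul_le_mul (hB.bound t ht') (h t ht') (Real.exp_pos _).le
      (mul_nonneg hB.nonneg (wt_pos _ _).le)).trans_eq ?_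
    rw [show -(br + j) = -br + -j by ring, ← wt_mul_wt]
    ring

end Laplace

/-- The modes attached to a root of the characteristic equation, parametrised by `γ ∈ ℂ`. -/
theorem IsFundamental.exists_modes {K r br j A : ℝ} {g : Measure ℝ}
    {U : Fin 2 → ℝ → ℕ → ℝ → ℂ} (h : IsFundamental K r br g U) {z : ℂ} (hA : 0 ≤ A)
    (hz : ∀ t : ℝ, 0 ≤ t → Real.exp (-z.re * t) ≤ A * wt (-j) t) (hj : 1 < br + j)
    (hD : charDet K r g br z = 0) :
    ∃ (F : ℂ → ℕ → ℝ → ℂ) (c : Fin 2 → ℂ), c ≠ 0 ∧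
      (∀ γ b, 0 ≤ b → b ≤ br → 1 < br - b + j → MemXp b (F γ)) ∧
      (∀ γ, ModeEq (opL K r g (F γ)) (F (z * γ))) ∧
      (∀ (x y : ℝ) (γ γ' : ℂ), F (x * γ + y * γ') = x • F γ + y • F γ') ∧
      ∀ γ, ModeEq (F γ) 0 → ModeEq (F (z * γ)) 0 ∧ ∀ i, (γ * c i).re = 0 := by
  obtain ⟨k, hk, hkL, hkU⟩ := h.exists_kLc_eq
  -- The null vector supplies the initial values of the kernels; `(𝓛k) c = -c` is the balance
  -- condition for every phase `γ` simultaneously.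
  obtain ⟨c, hc0, hc⟩ := Matrix.exists_mulVec_eq_zero_iff.2 hD
  have hint := integrable_mul_exp hz hj hk
  have hker : ∀ γ i, ∃ A, IsKernel j (expKernel z c γ i) A := fun γ i =>
    ⟨_, isKernel_expKernel hA hz c γ i⟩
  have hc' : ∀ i, ∑ i', (∫ t in Ioi (0 : ℝ), (k i i' t : ℂ) * Complex.exp (-z * t)) * c i' =
      -c i := by
    intro i
    have h1 := congrFun hc i
    rw [Matrix.add_mulVec, Matrix.one_mulVec, Pi.add_apply] at h1
    simp only [Matrix.mulVec, dotProduct, laplace_kLc_eq hkL, Pi.zero_apply] at h1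
    linear_combination h1
  have hval : ∀ γ i, -∑ i', ∫ t in Ioi (0 : ℝ), k i i' t * expKernel z c γ i' t =
      (γ * c i).re := by
    intro γ i
    simp only [integral_mul_expKernel (hint _ _)]
    rw [← Complex.re_sum, ← Finset.mul_sum, hc', mul_neg, Complex.neg_re, neg_neg]
  have h0 : ∀ γ i, expKernel z c γ i 0 = (γ * c i).re := fun γ i => by simp [expKernel]
  have hbal : ∀ γ, IsBalanced U (expKernel z c γ) := by
    intro γ
    obtain ⟨h1, h2⟩ := modeOf_one_zero (hker γ) hj hk hkU
    exact ⟨by rw [h1, hval, h0], by rw [h2, hval, h0]⟩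
  have hlin : ∀ (x y : ℝ) (γ γ' : ℂ), modeOf U (expKernel z c (x * γ + y * γ')) =
      x • modeOf U (expKernel z c γ) + y • modeOf U (expKernel z c γ') := by
    intro x y γ γ'
    rw [← h.modeOf_linear (hker γ) (hker γ') hj]
    congr 1
    funext i t
    simp only [expKernel]
    rw [← Complex.re_ofReal_mul, ← Complex.re_ofReal_mul, ← Complex.add_re]
    congr 1
    ring
  have hop : ∀ γ, ModeEq (opL K r g (modeOf U (expKernel z c γ)))
      (modeOf U (expKernel z c (z * γ))) := by
    intro γ
    have e : -modeOf U (expKernel z c (-z * γ)) = modeOf U (expKernel z c (z * γ)) := by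
      have := hlin (-1) 0 (-z * γ) 0
      simp only [Complex.ofReal_neg, Complex.ofReal_one, Complex.ofReal_zero, zero_mul, add_zero,
        zero_smul, neg_smul, one_smul] at this
      rw [← this]
      congr 2
      ring
    rw [← e]
    exact h.modeEq_opL_modeOf (isKernelPair_expKernel hA hz c γ) hj (hbal γ)
  refine ⟨fun γ => modeOf U (expKernel z c γ), c, hc0, fun γ b hb hbb hjb =>
    h.memXp_modeOf (isKernelPair_expKernel hA hz c γ) hb hbb hjb, hop, hlin, fun γ hγ => ?_⟩
  -- A vanishing mode has value `0` at frequency `0` by continuity; by balance this value records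
  -- `Re (γ c i)`.
  have hz0 := h.eq_zero_of_modeEq (hker γ) hj hγ
  refine ⟨fun ℓ hℓ => ?_, fun i => ?_⟩
  · filter_upwards [hop γ ℓ hℓ, modeEq_opL_of_eq_zero (K := K) (r := r) (g := g) hz0 ℓ hℓ]
      with ξ h1 h2
    rw [← h1, h2]
  · obtain ⟨h1, h2⟩ := hbal γ
    have h3 := hz0 0 0 le_rfl
    rw [zero_add] at h3
    rw [h3, h0] at h1 h2
    fin_cases i
    · exact h1.symm
    · exact h2.symm

theorem exists_eigenmode_of_charDet_eq_zero {K r br j A : ℝ} {g : Measure ℝ}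
    {U : Fin 2 → ℝ → ℕ → ℝ → ℂ} (h : IsFundamental K r br g U) {z : ℂ} (hA : 0 ≤ A)
    (hz : ∀ t : ℝ, 0 ≤ t → Real.exp (-z.re * t) ≤ A * wt (-j) t) (hj : 1 < br + j)
    (hD : charDet K r g br z = 0) (him : z.im = 0) :
    ∃ v, (∀ b, 0 ≤ b → b ≤ br → 1 < br - b + j → MemXp b v) ∧ IsEigenmode K r g z.re v := by
  obtain ⟨F, c, hc, hmem, hop, hlin, hzero⟩ := h.exists_modes hA hz hj hD
  obtain ⟨i, hi⟩ := Function.ne_iff.1 hc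
  -- This phase makes `Re (γ c i) = |c i|²`, which is nonzero, so the mode does not vanish.
  refine ⟨F (conj (c i)), hmem _, fun h0 => hi ?_, ?_⟩
  · have := (hzero _ h0).2 i
    rw [← Complex.normSq_eq_conj_mul_self, Complex.ofReal_re] at this
    exact Complex.normSq_eq_zero.1 this
  · have e : F (z * conj (c i)) = z.re • F (conj (c i)) := by
      have := hlin z.re 0 (conj (c i)) 0
      have hzr : z = (z.re : ℂ) := by apply Complex.ext <;> simp [him]
      rw [Complex.ofReal_zero, zero_smul, add_zero, zero_mul, add_zero] at this
      rw [← this, ← hzr]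
    rw [← e]
    exact hop _

theorem exists_rotatingPair_of_charDet_eq_zero {K r br j A : ℝ} {g : Measure ℝ}
    {U : Fin 2 → ℝ → ℕ → ℝ → ℂ} (h : IsFundamental K r br g U) {z : ℂ} (hA : 0 ≤ A)
    (hz : ∀ t : ℝ, 0 ≤ t → Real.exp (-z.re * t) ≤ A * wt (-j) t) (hj : 1 < br + j)
    (hD : charDet K r g br z = 0) (him : z.im ≠ 0) :
    ∃ vc vs, (∀ b, 0 ≤ b → b ≤ br → 1 < br - b + j → MemXp b vc ∧ MemXp b vs) ∧
      IsRotatingPair K r g z vc vs := by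
  obtain ⟨F, c, hc, hmem, hop, hlin, hzero⟩ := h.exists_modes hA hz hj hD
  -- The phases `1` and `-i` give the cosine and sine parts, with `z = Re z · 1 - Im z · (-i)` and
  -- `-i z = Im z · 1 + Re z · (-i)`.
  refine ⟨F 1, F (-Complex.I), fun b hb hbb hjb => ⟨hmem _ b hb hbb hjb, hmem _ b hb hbb hjb⟩,
    fun x y hxy => ?_, ?_, ?_⟩
  · rw [← hlin] at hxy
    set γ : ℂ := x * 1 + y * -Complex.I with hγ
    obtain ⟨h1, h2⟩ := hzero γ hxy
    have h3 := (hzero _ h1).2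
    -- Both `γ c` and `z γ c` have vanishing real part. Since `z` is not real, the imaginary part of
    -- `γ c` vanishes too.
    have h4 : γ = 0 := by
      obtain ⟨i, hi⟩ := Function.ne_iff.1 hc
      have h5 := h3 i
      rw [mul_assoc, Complex.mul_re, h2 i, mul_zero, zero_sub, neg_eq_zero] at h5
      have h6 : γ * c i = 0 := Complex.ext (h2 i) ((mul_eq_zero.1 h5).resolve_left him)
      exact (mul_eq_zero.1 h6).resolve_right hi
    have h5 := congrArg Complex.re h4
    have h6 := congrArg Complex.im h4
    simp [hγ] at h5 h6
    exact ⟨h5, h6⟩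
  · have e : F (z * 1) = z.re • F 1 - z.im • F (-Complex.I) := by
      have := hlin z.re (-z.im) 1 (-Complex.I)
      rw [neg_smul, ← sub_eq_add_neg] at this
      rw [← this]
      congr 1
      nth_rewrite 1 [← Complex.re_add_im z]
      push_cast
      ring
    rw [← e]
    exact hop _
  · have e : F (z * -Complex.I) = z.im • F 1 + z.re • F (-Complex.I) := by
      rw [← hlin z.im z.re 1 (-Complex.I)]
      congr 1
      nth_rewrite 1 [← Complex.re_add_im z]
      linear_combination (-(z.im : ℂ)) * Complex.I_mul_I
    rw [← e]
    exact hop _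

/-! ### Degenerate roots at zero -/

theorem isKernel_id : IsKernel (-1) (fun t => t) 1 := by
  refine ⟨zero_le_one, continuous_id, fun t ht => ?_⟩
  rw [abs_of_nonneg ht, wt, abs_of_nonneg ht, neg_neg, Real.rpow_one]
  linarith

/-- Dominated convergence for the difference quotients: `|e^{-xt} - 1| / x ≤ t`, and `t f(t)` is
integrable because `j > 2`. -/
theorem hasDerivWithinAt_laplace_zero {f : ℝ → ℝ} {j A : ℝ} (hf : IsKernel j f A) (hj : 2 < j) :
    HasDerivWithinAt (fun x : ℝ => ∫ t in Ioi (0 : ℝ), f t * Real.exp (-x * t))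
      (-∫ t in Ioi (0 : ℝ), t * f t) (Ici 0) 0 := by
  have htf : Integrable (fun t => t * f t) halfLine := (isKernel_id.mul hf).integrable (by linarith)
  have hfi : Integrable f halfLine := hf.integrable (by linarith)
  have hle : ∀ x t : ℝ, 0 ≤ x → 0 ≤ t → |Real.exp (-x * t) - 1| ≤ x * t := by
    intro x t hx ht
    have h1 := Real.add_one_le_exp (-x * t)
    have h2 : Real.exp (-x * t) ≤ 1 := Real.exp_le_one_iff.2 (by nlinarith [mul_nonneg hx ht])
    rw [abs_of_nonpos (by linarith)]
    linarith
  have hcont : ∀ x : ℝ, Continuous fun t : ℝ => Real.exp (-x * t) := fun x =>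
    Real.continuous_exp.comp (continuous_const.mul continuous_id)
  have hint : ∀ x : ℝ, 0 ≤ x → Integrable (fun t => f t * Real.exp (-x * t)) halfLine := by
    intro x hx
    refine hfi.norm.mono' (hf.continuous.mul (hcont x)).aestronglyMeasurable ?_
    filter_upwards [ae_restrict_mem measurableSet_Ioi] with t ht
    rw [norm_mul, Real.norm_of_nonneg (Real.exp_pos _).le]
    exact mul_le_of_le_one_right (norm_nonneg _)
      (Real.exp_le_one_iff.2 (by nlinarith [mul_nonneg hx (le_of_lt (mem_Ioi.1 ht))]))
  rw [hasDerivWithinAt_iff_tendsto_slope, ← integral_neg]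
  have hlim : Tendsto (fun x : ℝ => ∫ t in Ioi (0 : ℝ), f t * (x⁻¹ * (Real.exp (-x * t) - 1)))
      (𝓝[Ici 0 \ {0}] 0) (𝓝 (∫ t in Ioi (0 : ℝ), -(t * f t))) := by
    refine tendsto_integral_filter_of_dominated_convergence (fun t => ‖t * f t‖) ?_ ?_ htf.norm ?_
    · exact Eventually.of_forall fun x => (hf.continuous.mul
        (continuous_const.mul ((hcont x).sub continuous_const))).aestronglyMeasurable
    · filter_upwards [self_mem_nhdsWithin] with x hx
      have hx0 : 0 < x := lt_of_le_of_ne hx.1 (Ne.symm hx.2)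
      filter_upwards [ae_restrict_mem measurableSet_Ioi] with t ht
      have ht' : 0 ≤ t := le_of_lt ht
      rw [norm_mul, norm_mul, norm_mul, norm_inv, Real.norm_of_nonneg hx0.le,
        Real.norm_of_nonneg ht', mul_comm]
      refine mul_le_mul_of_nonneg_right ?_ (norm_nonneg _)
      rw [inv_mul_le_iff₀ hx0]
      exact hle x t hx0.le ht'
    · refine Eventually.of_forall fun t => ?_
      have h1 : HasDerivAt (fun x : ℝ => Real.exp (-x * t)) (-t) 0 := by
        have h2 : HasDerivAt (fun x : ℝ => -x * t) (-t) 0 := by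
          simpa using ((hasDerivAt_id (0 : ℝ)).neg).mul_const t
        simpa using h2.exp
      have h3 := (hasDerivAt_iff_tendsto_slope.1 h1).mono_left
        (nhdsWithin_mono (0 : ℝ) (show Ici 0 \ {0} ⊆ {(0 : ℝ)}ᶜ from fun x hx => hx.2))
      have h4 := h3.const_mul (f t)
      rw [show f t * -t = -(t * f t) by ring] at h4
      refine h4.congr fun x => ?_
      rw [slope_def_module]
      simp
  refine hlim.congr' ?_
  filter_upwards [self_mem_nhdsWithin] with x hx
  rw [slope_def_module, sub_zero, smul_eq_mul, ← integral_sub (hint x hx.1) (hint 0 le_rfl),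
    ← integral_const_mul]
  refine integral_congr_ae (Eventually.of_forall fun t => ?_)
  simp only [neg_zero, zero_mul, Real.exp_zero]
  ring

/-- Jordan chains of a singular pencil `M + x N` whose determinant vanishes to second order. -/
theorem exists_jordan_chain {M N : Fin 2 → Fin 2 → ℝ} (hdet : M 0 0 * M 1 1 - M 0 1 * M 1 0 = 0)
    (htr : N 0 0 * M 1 1 + M 0 0 * N 1 1 - (N 0 1 * M 1 0 + M 0 1 * N 1 0) = 0) (hM : M ≠ 0) :
    ∃ p q : Fin 2 → ℝ, p ≠ 0 ∧ (∀ i, ∑ i', M i i' * p i' = 0) ∧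
      ∀ i, ∑ i', (M i i' * q i' + N i i' * p i') = 0 := by
  obtain ⟨i, hi⟩ := Function.ne_iff.1 hM
  obtain ⟨i', hi'⟩ := Function.ne_iff.1 hi
  have hne : ∀ (p : Fin 2 → ℝ) i, p i ≠ 0 → p ≠ 0 := fun p i hp h => hp (by rw [h]; rfl)
  simp only [Pi.zero_apply] at hi'
  simp only [Fin.sum_univ_two, Fin.forall_fin_two]
  -- A row of `M` containing the nonzero entry determines `p` up to scale. That row of `M q = -N p`
  -- is solved by dividing by the entry; the other row is then the derivative condition on the
  -- determinant.
  fin_cases i <;> fin_cases i' <;> simp only [Fin.zero_eta, Fin.mk_one, Fin.isValue] at hi'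
  · refine ⟨![-M 0 1, M 0 0], ![(N 0 0 * M 0 1 - N 0 1 * M 0 0) / M 0 0, 0],
      hne _ 1 (by simpa using hi'), ⟨?_, ?_⟩, ?_, ?_⟩ <;> simp <;> field_simp
    · ring
    · linear_combination hdet
    · ring
    · linear_combination M 0 0 * htr - N 0 0 * hdet
  · refine ⟨![-M 0 1, M 0 0], ![0, (N 0 0 * M 0 1 - N 0 1 * M 0 0) / M 0 1],
      hne _ 0 (by simpa using hi'), ⟨?_, ?_⟩, ?_, ?_⟩ <;> simp <;> field_simp
    · ring
    · linear_combination hdet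
    · ring
    · linear_combination M 0 1 * htr - N 0 1 * hdet
  · refine ⟨![-M 1 1, M 1 0], ![(N 1 0 * M 1 1 - N 1 1 * M 1 0) / M 1 0, 0],
      hne _ 1 (by simpa using hi'), ⟨?_, ?_⟩, ?_, ?_⟩ <;> simp <;> field_simp
    · linear_combination -hdet
    · ring
    · linear_combination -M 1 0 * htr + N 1 0 * hdet
    · ring
  · refine ⟨![-M 1 1, M 1 0], ![0, (N 1 0 * M 1 1 - N 1 1 * M 1 0) / M 1 1],
      hne _ 0 (by simpa using hi'), ⟨?_, ?_⟩, ?_, ?_⟩ <;> simp <;> field_simp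
    · linear_combination -hdet
    · ring
    · linear_combination -M 1 1 * htr + N 1 1 * hdet
    · ring

/-- `q - t p`. -/
def affineKernel (q p : Fin 2 → ℝ) (i : Fin 2) (t : ℝ) : ℝ := q i - t * p i

theorem isKernel_affineKernel (q p : Fin 2 → ℝ) (i : Fin 2) :
    IsKernel (-1) (affineKernel q p i) (|q i| + |p i|) where
  nonneg := by positivity
  continuous := continuous_const.sub (continuous_id.mul continuous_const)
  bound t ht := by
    rw [wt, abs_of_nonneg ht, neg_neg, Real.rpow_one]
    refine (abs_sub _ _).trans ?_
    rw [abs_mul, abs_of_nonneg ht]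
    nlinarith [abs_nonneg (q i), abs_nonneg (p i)]

/-- Constant kernels are treated apart from affine ones because their better order, `0` instead of
`-1`, is what gives eigenmodes all weights up to `br - 1`. -/
theorem isKernel_affineKernel_zero (q : Fin 2 → ℝ) (i : Fin 2) :
    IsKernel 0 (affineKernel q 0 i) |q i| where
  nonneg := by positivity
  continuous := continuous_const.sub (continuous_id.mul continuous_const)
  bound t ht := by simp [wt, affineKernel]

theorem hasDerivAt_affineKernel (q p : Fin 2 → ℝ) (i : Fin 2) (t : ℝ) :
    HasDerivAt (affineKernel q p i) (affineKernel (-p) 0 i t) t := by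
  have := ((hasDerivAt_id t).mul_const (p i)).const_sub (q i)
  refine this.congr_deriv ?_
  simp [affineKernel]

theorem isKernelPair_affineKernel (q p : Fin 2 → ℝ) :
    IsKernelPair (-1) (affineKernel q p) (affineKernel (-p) 0) :=
  ⟨fun i => ⟨_, isKernel_affineKernel q p i⟩, fun i => ⟨_, isKernel_affineKernel (-p) 0 i⟩,
    hasDerivAt_affineKernel q p⟩

theorem isKernelPair_affineKernel_zero (q : Fin 2 → ℝ) :
    IsKernelPair 0 (affineKernel q 0) (affineKernel 0 0) :=
  ⟨fun i => ⟨_, isKernel_affineKernel_zero q i⟩, fun i => ⟨_, isKernel_affineKernel_zero 0 i⟩,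
    fun i t => by simpa using hasDerivAt_affineKernel q 0 i t⟩

/-- The value and the right derivative at `0` of the real characteristic determinant. -/
theorem charDet_eq_and_deriv_eq {K r br : ℝ} {g : Measure ℝ} {k : Fin 2 → Fin 2 → ℝ → ℝ}
    (hk : ∀ i i', ∃ A, IsKernel br (k i i') A)
    (hkL : ∀ i i' t, 0 ≤ t → kLc K r g br t i i' = k i i' t) (hbr : 2 < br)
    (h0 : charDet K r g br 0 = 0)
    (h1 : HasDerivWithinAt (charDet K r g br) 0 {z : ℂ | 0 ≤ z.re} 0) {M N : Fin 2 → Fin 2 → ℝ}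
    (hM : M = fun i i' => (if i = i' then 1 else 0) + ∫ t in Ioi (0 : ℝ), k i i' t)
    (hN : N = fun i i' => -∫ t in Ioi (0 : ℝ), t * k i i' t) :
    M 0 0 * M 1 1 - M 0 1 * M 1 0 = 0 ∧
      N 0 0 * M 1 1 + M 0 0 * N 1 1 - (N 0 1 * M 1 0 + M 0 1 * N 1 0) = 0 := by
  let L : Fin 2 → Fin 2 → ℝ → ℝ := fun i i' x => ∫ t in Ioi (0 : ℝ), k i i' t * Real.exp (-x * t)
  have hL : ∀ i i' (x : ℝ), laplace (kLc K r g br) x i i' = (L i i' x : ℂ) := by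
    intro i i' x
    rw [laplace_kLc_eq hkL]
    simp only [L]
    rw [← integral_complex_ofReal]
    refine integral_congr_ae (Eventually.of_forall fun t => ?_)
    simp only
    push_cast
    rfl
  have hLd : ∀ i i', HasDerivWithinAt (L i i') (N i i') (Ici 0) 0 := by
    intro i i'
    obtain ⟨A, hA⟩ := hk i i'
    rw [hN]
    exact hasDerivWithinAt_laplace_zero hA hbr
  have hM00 : M 0 0 = 1 + L 0 0 0 := by simp [hM, L]
  have hM11 : M 1 1 = 1 + L 1 1 0 := by simp [hM, L]
  have hM01 : M 0 1 = L 0 1 0 := by simp [hM, L]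
  have hM10 : M 1 0 = L 1 0 0 := by simp [hM, L]
  have hdet : ∀ x : ℝ, charDet K r g br x =
      (((1 + L 0 0 x) * (1 + L 1 1 x) - L 0 1 x * L 1 0 x : ℝ) : ℂ) := by
    intro x
    simp only [charDet, Matrix.det_fin_two, Matrix.add_apply, hL]
    simp
  constructor
  · have := hdet 0
    rw [Complex.ofReal_zero, h0] at this
    rw [hM00, hM11, hM01, hM10]
    exact_mod_cast this.symm
  · have hd := ((((hLd 0 0).const_add 1).mul ((hLd 1 1).const_add 1)).sub
      ((hLd 0 1).mul (hLd 1 0))).ofReal_comp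
    -- The derivative within the closed right half plane is restricted to the real half axis, where
    -- one-sided derivatives are still unique.
    have hc : HasDerivWithinAt (fun x : ℝ => charDet K r g br x) 0 (Ici 0) 0 := by
      have h2 : HasDerivWithinAt (fun x : ℝ => (x : ℂ)) 1 (Ici 0) 0 :=
        (Complex.ofRealCLM.hasDerivAt (x := (0 : ℝ))).hasDerivWithinAt
      have h3 := HasDerivWithinAt.scomp (g₁ := charDet K r g br) (h := fun x : ℝ => (x : ℂ))
        (t' := {z : ℂ | 0 ≤ z.re}) (0 : ℝ) (by simpa using h1) h2
        (fun x hx => by simpa using hx)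
      rw [smul_zero] at h3
      exact h3
    have hu := (uniqueDiffWithinAt_Ici (0 : ℝ)).eq_deriv _ (hd.congr_of_mem
      (fun x _ => hdet x) self_mem_Ici) hc
    rw [hM00, hM11, hM01, hM10]
    exact_mod_cast hu

/-- For the kernel `q - t p`, balance is exactly `M q + N p = 0`, and its derivative is `-p`. Hence
`L` maps the mode of `q - t p` to the mode of the constant `p`, and the latter to zero. -/
theorem exists_degenerate_modes {K r br : ℝ} {g : Measure ℝ} {U : Fin 2 → ℝ → ℕ → ℝ → ℂ}
    (h : IsFundamental K r br g U) (hbr : 2 < br) (h0 : charDet K r g br 0 = 0)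
    (h1 : HasDerivWithinAt (charDet K r g br) 0 {z : ℂ | 0 ≤ z.re} 0) :
    (∃ v₁ v₂, (∀ b : ℝ, 0 ≤ b → b < br - 1 → MemXp b v₁ ∧ MemXp b v₂) ∧ ModeIndep v₁ v₂ ∧
      IsEigenmode K r g 0 v₁ ∧ IsEigenmode K r g 0 v₂) ∨
    (∃ v₀ v₁, (∀ b : ℝ, 0 ≤ b → b < br - 1 → MemXp b v₀) ∧
      (∀ b : ℝ, 0 ≤ b → b < br - 2 → MemXp b v₁) ∧
      IsEigenmode K r g 0 v₀ ∧ ModeEq (opL K r g v₁) v₀) := by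
  obtain ⟨k, hk, hkL, hkU⟩ := h.exists_kLc_eq
  obtain ⟨M, hM⟩ : ∃ M : Fin 2 → Fin 2 → ℝ, M = fun i i' => (if i = i' then 1 else 0) +
    ∫ t in Ioi (0 : ℝ), k i i' t := ⟨_, rfl⟩
  obtain ⟨N, hN⟩ : ∃ N : Fin 2 → Fin 2 → ℝ, N = fun i i' => -∫ t in Ioi (0 : ℝ), t * k i i' t :=
    ⟨_, rfl⟩
  obtain ⟨hdet, htr⟩ := charDet_eq_and_deriv_eq hk hkL hbr h0 h1 hM hN
  have hki : ∀ i i', Integrable (k i i') halfLine := fun i i' => by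
    obtain ⟨A, hA⟩ := hk i i'
    exact hA.integrable (by linarith)
  have hkti : ∀ i i', Integrable (fun t => t * k i i' t) halfLine := fun i i' => by
    obtain ⟨A, hA⟩ := hk i i'
    exact (isKernel_id.mul hA).integrable (by linarith)
  have hval : ∀ (q p : Fin 2 → ℝ) i, ∑ i', ∫ t in Ioi (0 : ℝ), k i i' t * affineKernel q p i' t =
      ∑ i', (M i i' * q i' + N i i' * p i') - q i := by
    intro q p i
    have e : ∀ i', ∫ t in Ioi (0 : ℝ), k i i' t * affineKernel q p i' t =
        (∫ t in Ioi (0 : ℝ), k i i' t) * q i' - (∫ t in Ioi (0 : ℝ), t * k i i' t) * p i' := by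
      intro i'
      rw [← integral_mul_const, ← integral_mul_const,
        ← integral_sub ((hki i i').mul_const _) ((hkti i i').mul_const _)]
      refine integral_congr_ae (Eventually.of_forall fun t => ?_)
      simp only [affineKernel]
      ring
    simp only [e, Fin.sum_univ_two, hM, hN]
    fin_cases i <;> simp <;> ring
  have hbal : ∀ q p : Fin 2 → ℝ, (∀ i, ∑ i', (M i i' * q i' + N i i' * p i') = 0) →
      IsBalanced U (affineKernel q p) := by
    intro q p hqp
    obtain ⟨e1, e2⟩ := modeOf_one_zero (isKernelPair_affineKernel q p).kernel (by linarith) hk hkU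
    refine ⟨?_, ?_⟩
    · rw [e1, hval, hqp]; simp [affineKernel]
    · rw [e2, hval, hqp]; simp [affineKernel]
  have hbal0 : ∀ p : Fin 2 → ℝ, (∀ i, ∑ i', M i i' * p i' = 0) →
      IsBalanced U (affineKernel p 0) := fun p hp => hbal p 0 fun i => by simpa using hp i
  have hone : ∀ p : Fin 2 → ℝ, (∀ i, ∑ i', M i i' * p i' = 0) →
      modeOf U (affineKernel p 0) 1 0 = p 0 + p 1 * Complex.I := by
    intro p hp
    obtain ⟨e1, e2⟩ := hbal0 p hp
    apply Complex.ext
    · rw [e1]; simp [affineKernel]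
    · rw [e2]; simp [affineKernel]
  have hmem : ∀ p b, 0 ≤ b → b < br - 1 → MemXp b (modeOf U (affineKernel p 0)) :=
    fun p b hb hbb => h.memXp_modeOf (isKernelPair_affineKernel_zero p) hb (by linarith)
      (by linarith)
  have hker0 : ∀ (p : Fin 2 → ℝ) i, ∃ A, IsKernel 0 (affineKernel p 0 i) A := fun p i =>
    ⟨_, isKernel_affineKernel_zero p i⟩
  have heig : ∀ p : Fin 2 → ℝ, p ≠ 0 → (∀ i, ∑ i', M i i' * p i' = 0) →
      IsEigenmode K r g 0 (modeOf U (affineKernel p 0)) := by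
    intro p hp0 hp
    refine ⟨fun hz => hp0 ?_, ?_⟩
    · have h2 := h.eq_zero_of_modeEq (hker0 p) (by linarith) hz 0 0 le_rfl
      rw [zero_add, hone p hp] at h2
      have h3 := congrArg Complex.re h2
      have h4 := congrArg Complex.im h2
      simp at h3 h4
      funext i
      fin_cases i
      · exact h3
      · exact h4
    · have h2 := h.modeEq_opL_modeOf (isKernelPair_affineKernel_zero p) (by linarith) (hbal0 p hp)
      -- A constant kernel has zero derivative, so its mode is annihilated.
      have e : -modeOf U (affineKernel 0 0) = (0 : ℝ) • modeOf U (affineKernel p 0) := by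
        funext ℓ ξ
        simp [modeOf, superpose, affineKernel]
      rwa [e] at h2
  by_cases hM0 : M = 0
  · left
    have hz : ∀ (p : Fin 2 → ℝ) i, ∑ i', M i i' * p i' = 0 := fun p i => by simp [hM0]
    refine ⟨modeOf U (affineKernel ![1, 0] 0), modeOf U (affineKernel ![0, 1] 0),
      fun b hb hbb => ⟨hmem _ b hb hbb, hmem _ b hb hbb⟩, fun x y hxy => ?_,
      heig _ (fun h => by simpa using congrFun h 0) (hz _),
      heig _ (fun h => by simpa using congrFun h 1) (hz _)⟩
    have hker : ∀ i, ∃ A, IsKernel 0 (affineKernel ![x, y] 0 i) A := hker0 _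
    have e : modeOf U (affineKernel ![x, y] 0) =
        x • modeOf U (affineKernel ![1, 0] 0) + y • modeOf U (affineKernel ![0, 1] 0) := by
      rw [← h.modeOf_linear (hker0 _) (hker0 _) (by linarith)]
      congr 1
      funext i t
      fin_cases i <;> simp [affineKernel]
    rw [← e] at hxy
    have h2 := h.eq_zero_of_modeEq hker (by linarith) hxy 0 0 le_rfl
    rw [zero_add, hone _ (hz _)] at h2
    have h3 := congrArg Complex.re h2
    have h4 := congrArg Complex.im h2
    simp at h3 h4
    exact ⟨h3, h4⟩
  · right
    obtain ⟨p, q, hp0, hp, hq⟩ := exists_jordan_chain hdet htr hM0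
    refine ⟨modeOf U (affineKernel p 0), modeOf U (affineKernel q p), hmem p, fun b hb hbb =>
      h.memXp_modeOf (isKernelPair_affineKernel q p) hb (by linarith) (by linarith),
      heig p hp0 hp, ?_⟩
    have h2 := h.modeEq_opL_modeOf (isKernelPair_affineKernel q p) (by linarith) (hbal q p hq)
    have e : -modeOf U (affineKernel (-p) 0) = modeOf U (affineKernel p 0) := by
      have := h.modeOf_linear (hker0 (-p)) (hker0 0) (by linarith) (-1) 0
      rw [zero_smul, add_zero, neg_smul, one_smul] at this
      rw [← this]
      congr 1
      funext i t
      simp [affineKernel]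
    rwa [e] at h2

end Kuramoto

/-! ### The four cases of the proposition -/

theorem mainTheorem5 (K r : ℝ) (g : Measure ℝ) [IsProbabilityMeasure g]
    (hstat : Kuramoto.IsStationaryState K r g) (br : ℝ) (hbr : 0 ≤ br)
    (hr : Kuramoto.MemXp br (Kuramoto.rR K r g))
    (hi : Kuramoto.MemXp br (Kuramoto.rI K r g)) :
    (∀ z : ℂ, Kuramoto.charDet K r g br z = 0 → 0 < z.re → z.im = 0 →
      ∃ v, Kuramoto.MemXp br v ∧ Kuramoto.IsEigenmode K r g z.re v) ∧
    (∀ z : ℂ, Kuramoto.charDet K r g br z = 0 → 0 < z.re → z.im ≠ 0 →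
      Kuramoto.charDet K r g br (conj z) = 0 ∧
      ∃ vc vs, Kuramoto.MemXp br vc ∧ Kuramoto.MemXp br vs ∧
        Kuramoto.IsRotatingPair K r g z vc vs) ∧
    (1 < br → ∀ z : ℂ, Kuramoto.charDet K r g br z = 0 → z.re = 0 →
      (z.im = 0 →
        ∃ v, (∀ b : ℝ, 0 ≤ b → b < br - 1 → Kuramoto.MemXp b v) ∧
          Kuramoto.IsEigenmode K r g z.re v) ∧
      (z.im ≠ 0 →
        Kuramoto.charDet K r g br (conj z) = 0 ∧
        ∃ vc vs,
          (∀ b : ℝ, 0 ≤ b → b < br - 1 → Kuramoto.MemXp b vc ∧ Kuramoto.MemXp b vs) ∧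
          Kuramoto.IsRotatingPair K r g z vc vs)) ∧
    (2 < br → Kuramoto.charDet K r g br 0 = 0 →
      HasDerivWithinAt (Kuramoto.charDet K r g br) 0 {z : ℂ | 0 ≤ z.re} 0 →
      (∃ v₁ v₂,
        (∀ b : ℝ, 0 ≤ b → b < br - 1 → Kuramoto.MemXp b v₁ ∧ Kuramoto.MemXp b v₂) ∧
        Kuramoto.ModeIndep v₁ v₂ ∧
        Kuramoto.IsEigenmode K r g 0 v₁ ∧ Kuramoto.IsEigenmode K r g 0 v₂) ∨
      (∃ v₀ v₁,
        (∀ b : ℝ, 0 ≤ b → b < br - 1 → Kuramoto.MemXp b v₀) ∧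
        (∀ b : ℝ, 0 ≤ b → b < br - 2 → Kuramoto.MemXp b v₁) ∧
        Kuramoto.IsEigenmode K r g 0 v₀ ∧
        Kuramoto.ModeEq (Kuramoto.opL K r g v₁) v₀)) := by
  obtain ⟨U, hU⟩ := Kuramoto.exists_isFundamental hbr hr hi
  -- On the imaginary axis the exponential is only bounded, i.e. of order `0`, which costs one power
  -- of the weight.
  have h0 : ∀ z : ℂ, z.re = 0 → ∀ t : ℝ, 0 ≤ t →
      Real.exp (-z.re * t) ≤ 1 * Kuramoto.wt (-0) t := fun z hz t _ => by
    simp [hz, Kuramoto.wt]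
  refine ⟨fun z hD hz him => ?_, fun z hD hz him => ⟨?_, ?_⟩,
    fun hbr1 z hD hz => ⟨fun him => ?_, fun him => ⟨?_, ?_⟩⟩,
    fun hbr2 hD hD' => Kuramoto.exists_degenerate_modes hU hbr2 hD hD'⟩
  · obtain ⟨v, hv, he⟩ := Kuramoto.exists_eigenmode_of_charDet_eq_zero hU (by positivity)
      (fun t ht => Kuramoto.exp_neg_le_wt hz ht) (by linarith) hD him
    exact ⟨v, hv br hbr le_rfl (by linarith), he⟩
  · rw [Kuramoto.charDet_conj, hD, map_zero]
  · obtain ⟨vc, vs, hv, he⟩ := Kuramoto.exists_rotatingPair_of_charDet_eq_zero hU (by positivity)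
      (fun t ht => Kuramoto.exp_neg_le_wt hz ht) (by linarith) hD him
    obtain ⟨hc, hs⟩ := hv br hbr le_rfl (by linarith)
    exact ⟨vc, vs, hc, hs, he⟩
  · obtain ⟨v, hv, he⟩ := Kuramoto.exists_eigenmode_of_charDet_eq_zero hU zero_le_one (h0 z hz)
      (by linarith) hD him
    exact ⟨v, fun b hb hbb => hv b hb (by linarith) (by linarith), he⟩
  · rw [Kuramoto.charDet_conj, hD, map_zero]
  · obtain ⟨vc, vs, hv, he⟩ := Kuramoto.exists_rotatingPair_of_charDet_eq_zero hU zero_le_one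
      (h0 z hz) (by linarith) hD him
    exact ⟨vc, vs, fun b hb hbb => hv b hb (by linarith) (by linarith), he⟩
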